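/- **Conventions.** All varieties are over $\mathbb C$. For a toric variety $X$ with character lattice $M$, dual lattice $N$ and set $R$ of torus-invariant prime divisors, let $\mathrm{div}\colon M\to\mathbb Z^R$ send a character to its divisor, so that $A_{n-1}(X)=\mathrm{coker}(\mathrm{div})$, and let $-\kappa_X=\sum_{\rho\in R}\rho$. For $D\in\mathbb Z^R$ put $P_D=\{\mu\in M_{\mathbb R}:\mathrm{div}(\mu)+D\ge 0\}$. A *toric Landau–Ginzburg model* $(X,W,K)$ is a toric variety $X$ with a regular function $W$ and a class $K\in A_{n-1}(X)_{\mathbb C/\mathbb Z}$. If $W=\sum_{\xi\in\Xi}q_\xi\,\xi$ with $\Xi\subset M$ finite and all $q_\xi\neq0$, let $\mathrm{mon}\colon N\to\mathbb Z^{\Xi}$ be $\nu\mapsto(\nu(\xi))_\xi$ and let $L\in\mathrm{coker}(\mathrm{mon})_{\mathbb C/\mathbb Z}$ be the class of $\big(\tfrac1{2\pi i}\log q_\xi\big)_\xi$. The *linear data* of the model are $(\mathrm{div},K)$ and $(\mathrm{mon},L)$. Conversely, let $A\colon M'\to\mathbb Z^r$ and $B\colon N'\to\mathbb Z^s$ be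 homomorphisms, $N'=\mathrm{Hom}(M',\mathbb Z)$, with classes $K'\in\mathrm{coker}(A)_{\mathbb C/\mathbb Z}$, $L'\in\mathrm{coker}(B)_{\mathbb C/\mathbb Z}$ and lifts $\alpha\in\mathbb C^r$, $\beta\in\mathbb C^s$ of them. Let $X'$ be the toric variety of the inward normal fan of $\{\xi\in M'_{\mathbb R}: A\xi+\mathrm{Im}\,\alpha\ge0\}$. The pair is *kopasetic* if this polyhedral set has non-empty interior, there is a surjection $k\colon\mathbb Z^r\to\mathbb Z^{R_{X'}}$ sending each standard generator to a standard generator or to $0$ with $k\circ A=\mathrm{div}_{X'}$, and $A\circ B^{\tau}\ge0$; it then defines the model $(X',W',k(K'))$ with $W'=\sum_j e^{2\pi i\beta_j}\chi^{b_j}$, where $b_j\in M'$ is the $j$-th row of $B$ (other lifts only change the origin of the torus). The *dual* of $(X,W,K)$ is the model defined by $(A,K')=(\mathrm{mon},L)$ and $(B,L')=(\mathrm{div},K)$, provided that this pair is kopasetic. **Theorem.** Let $Y$ be an $n$-dimensional (Gorenstein) Fano toric variety, i.e. $Y$ is complete and $-\kappa_Y$ is Cartier and ample. Let $D_1,\dots,D_c$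 ($c\ge1$) be a Calabi–Yau nef sub-partition: torus-invariant nef Cartier divisors $D_j>0$ with $-\kappa_Y-\sum_jD_j\ge0$ and $[-\kappa_Y]=[\sum_jD_j]$, such that the convex hulls $C_j$ of $(P_{D_j}\cap M)\setminus\{0\}$ are non-empty and the vertices of $\mathrm{conv}\big(\bigcup_jC_j\big)$ are exactly the vertices of the $C_j$. Let $\varphi_j$ be the convex support function of $D_j$ (linear on the cones of the fan of $Y$, with value at the primitive generator of each ray equal to the coefficient of $D_j$ there). Put $\mathcal V=\bigoplus_j\mathcal O_Y(D_j)$, $X=\mathrm{Tot}(\mathcal V^\vee)$, and let $W_{BB}\colon X\to\mathbb C$ be the function defined by the global section $$w_{BB}=\sum_{j}\Big(\chi^{0}+\sum_{0\ne\sigma\in P_{D_j}\cap M}e^{-2\pi}\,\chi^{\sigma}\Big)$$ of $\mathcal V$, where $\chi^\sigma$ is the section of $\mathcal O_Y(D_j)$ corresponding to $\sigma\in P_{D_j}\cap M$. Let $\nabla_j=\{\mu\in M_{\mathbb R}:\nu(\mu)\ge-\varphi_j(\nu)\ \forall\nu\in N_{\mathbb R}\}$, $(P^*)^\circ=\mathrm{conv}(\nabla_1\cup\dots\cup\nabla_c)$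 and $\mathbb E_j^*=\mathrm{vert}(\mathrm{conv}(\nabla_j\setminus\{0\}))$. Then $(P^*)^\circ$ is a reflexive polytope and $\{\mathbb E_1^*,\dots,\mathbb E_c^*\}$ is a nef partition of its vertices: the $\mathbb E^*_j$ are non-empty and pairwise disjoint with union $\mathrm{vert}((P^*)^\circ)$, and there are convex functions $\varphi_1^*,\dots,\varphi_c^*$ on $M_{\mathbb R}$, integral linear on the cones of the inward normal fan of $P^*:=((P^*)^\circ)^\circ\subset N_{\mathbb R}$, with $\varphi^*_i(e)=\delta_{ij}$ for $e\in\mathbb E_j^*$. Let $Y^*$ be the toric variety of that fan, $D_j^*$ the sum of the torus-invariant prime divisors of $Y^*$ whose primitive ray generators lie in $\mathbb E_j^*$, and $\mathcal V^*=\bigoplus_j\mathcal O_{Y^*}(D_j^*)$. For every $K\in A_{n-1}(Y)_{\mathbb C/\mathbb Z}$, pulled back to $X$, the toric Landau–Ginzburg model $(X,W_{BB},K)$ has a dual $(X',W',K')$, and 1. $X'=\mathrm{Tot}((\mathcal V^*)^\vee)$, by an isomorphism which is the identity on the torus with character lattice $N\oplus\mathbb Z^c$; 2. $W'$ is the function on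 $\mathrm{Tot}((\mathcal V^*)^\vee)$ defined by a global section of $\mathcal V^*$. Thus the dual is the Landau–Ginzburg model of a member of the Batyrev–Borisov mirror family. -/

import Mathlib

open CategoryTheory CategoryTheory.Limits AlgebraicGeometry Opposite Matrix

noncomputable section

namespace ToricLG

section Polyhedra

variable {ι : Type} [Fintype ι]

/-! ### Lattices

The lattices `M` and `N = Hom(M, ℤ)` are both written `ι → ℤ`, their real forms `ι → ℝ`, and the
pairing is the dot product. -/

/-- The inclusion of a lattice into its real form. -/
def realVec (u : ι → ℤ) : ι → ℝ := fun i => (u i : ℝ)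

/-- Primitive lattice vectors (in particular non-zero). -/
def IsPrimitive (u : ι → ℤ) : Prop := ∀ k : ℤ, (∀ i, k ∣ u i) → IsUnit k

/-! ### Polyhedral sets, normal fans, polars -/

/-- The polyhedral set `{ξ | A ξ + α ≥ 0}`; the rows of `A` are the lattice vectors `A t`. -/
def polyhedron {T : Type} (A : T → ι → ℤ) (α : T → ℝ) : Set (ι → ℝ) :=
  {ξ | ∀ t, 0 ≤ realVec (A t) ⬝ᵥ ξ + α t}

/-- `F` is a non-empty face of `P`: the locus where some linear functional attains its minimum
over `P` (the functional `0` gives `P` itself). -/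
def IsFace (P F : Set (ι → ℝ)) : Prop :=
  F.Nonempty ∧ ∃ ν : ι → ℝ, F = {x | x ∈ P ∧ ∀ y ∈ P, ν ⬝ᵥ x ≤ ν ⬝ᵥ y}

/-- The inward normal cone of `P` along `F`: functionals whose minimum on `P` is attained at all
points of `F`. -/
def normalCone (P F : Set (ι → ℝ)) : Set (ι → ℝ) :=
  {ν | ∀ x ∈ F, ∀ y ∈ P, ν ⬝ᵥ x ≤ ν ⬝ᵥ y}

/-- The set of cones of the inward normal fan of `P`. -/
def normalFan (P : Set (ι → ℝ)) : Set (Set (ι → ℝ)) :=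
  {σ | ∃ F, IsFace P F ∧ σ = normalCone P F}

/-- The polar `{ξ | ν(ξ) + 1 ≥ 0 for all ν ∈ C}`. -/
def polar (C : Set (ι → ℝ)) : Set (ι → ℝ) := {ξ | ∀ ν ∈ C, 0 ≤ ν ⬝ᵥ ξ + 1}

/-- Lattice polytopes. -/
def IsLatticePolytope (Q : Set (ι → ℝ)) : Prop :=
  ∃ F : Finset (ι → ℤ), Q = convexHull ℝ (realVec '' (F : Set (ι → ℤ)))

/-- Reflexive polytopes. -/
def IsReflexive (Q : Set (ι → ℝ)) : Prop :=
  IsLatticePolytope Q ∧ (0 : ι → ℝ) ∈ interior Q ∧ IsLatticePolytope (polar Q)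

/-! ### Fans -/

/-- Cones generated by finitely many lattice vectors. -/
def IsRationalCone (σ : Set (ι → ℝ)) : Prop :=
  ∃ F : Finset (ι → ℤ), σ = {x | ∃ a : (ι → ℤ) → ℝ, (∀ u, 0 ≤ a u) ∧ x = ∑ u ∈ F, a u • realVec u}

/-- `τ` is a face of the cone `σ`: it is cut out by a linear functional non-negative on `σ`. -/
def IsConeFace (σ τ : Set (ι → ℝ)) : Prop :=
  ∃ m : ι → ℝ, (∀ x ∈ σ, 0 ≤ m ⬝ᵥ x) ∧ τ = {x | x ∈ σ ∧ m ⬝ᵥ x = 0}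

variable (ι) in
/-- Fans of strongly convex rational polyhedral cones. -/
structure Fan where
  cones : Set (Set (ι → ℝ))
  finite : cones.Finite
  nonempty : cones.Nonempty
  rational : ∀ σ ∈ cones, IsRationalCone σ
  stronglyConvex : ∀ σ ∈ cones, ∀ x, x ∈ σ → -x ∈ σ → x = 0
  face_mem : ∀ σ ∈ cones, ∀ τ, IsConeFace σ τ → τ ∈ cones
  inter_face : ∀ σ ∈ cones, ∀ τ ∈ cones, IsConeFace σ (σ ∩ τ)

end Polyhedra

section Varieties

variable {ι : Type}

/-! ### Toric varieties -/

variable (ι) in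
/-- A toric variety with character lattice `ι → ℤ`, presented by torus-invariant affine open
subsets `Spec ℂ[S_j]`, where `S_j` is the semigroup of those characters which are regular on the
`j`-th subset; `i ≤ j` means that the `i`-th subset is contained in the `j`-th. -/
structure Charts where
  Index : Type
  [order : PartialOrder Index]
  monoid : Index → AddSubmonoid (ι → ℤ)
  anti : ∀ i j, i ≤ j → monoid j ≤ monoid i

attribute [instance] Charts.order

namespace Charts

/-- The coordinate rings `ℂ[S_j]` of the charts, with their restriction maps. -/
def coordinateRing (X : Charts ι) : X.Indexᵒᵖ ⥤ CommRingCat.{0} where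
  obj j := CommRingCat.of (AddMonoidAlgebra ℂ (X.monoid j.unop))
  map {i j} f := CommRingCat.ofHom (AddMonoidAlgebra.mapDomainRingHom ℂ
    (AddSubmonoid.inclusion (X.anti _ _ (leOfHom f.unop))))
  map_id j := by
    ext x
    all_goals simp
    all_goals rfl
  map_comp f g := by
    rw [← CommRingCat.ofHom_comp, ← AddMonoidAlgebra.mapDomainRingHom_comp]
    rfl

/-- The charts as a diagram of affine schemes (as locally ringed spaces). -/
def diagram (X : Charts ι) : X.Index ⥤ LocallyRingedSpace.{0} :=
  X.coordinateRing.rightOp ⋙ Spec.toLocallyRingedSpace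

/-- The toric variety: the gluing of the charts, i.e. the colimit of the diagram of charts. -/
def space (X : Charts ι) : LocallyRingedSpace.{0} := colimit X.diagram

end Charts

variable (ι) in
/-- The torus `Spec ℂ[M]`. -/
def torus : LocallyRingedSpace.{0} :=
  Spec.toLocallyRingedSpace.obj (op (CommRingCat.of (AddMonoidAlgebra ℂ (ι → ℤ))))

namespace Charts

/-- The inclusion of the torus into the toric variety, through the `j`-th chart. -/
def torusMap (X : Charts ι) (j : X.Index) : torus ι ⟶ X.space :=
  Spec.toLocallyRingedSpace.map
    (CommRingCat.ofHom (AddMonoidAlgebra.mapDomainRingHom ℂ (X.monoid j).subtype)).op ≫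
    colimit.ι X.diagram j

/-- Two toric varieties with the same torus are equal: there is an isomorphism which restricts to
the identity of the torus. -/
def SameToricVariety (X Z : Charts ι) : Prop :=
  ∃ e : X.space ≅ Z.space, ∀ i j, X.torusMap i ≫ e.hom = Z.torusMap j

variable [Fintype ι]

/-- The torus-invariant prime divisors. Such a divisor is identified with the primitive vector `u`
for which the order of vanishing of a character `m` along it is `u ⬝ᵥ m`. It meets a chart `S` if
the half-space of the characters with `0 ≤ u ⬝ᵥ m` is the localization of `S` at the characters of
`S` which do not vanish along the divisor. -/
def rays (X : Charts ι) : Set (ι → ℤ) :=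
  {u | IsPrimitive u ∧ ∃ j, (∀ s ∈ X.monoid j, 0 ≤ u ⬝ᵥ s) ∧
    ∀ m, 0 ≤ u ⬝ᵥ m → ∃ s ∈ X.monoid j, u ⬝ᵥ s = 0 ∧ m + s ∈ X.monoid j}

/-- The rows of the character-to-divisor map `M → ℤ^R`. -/
def div (X : Charts ι) : X.rays → ι → ℤ := fun u => u

/-- The characters occurring in the global sections of `O(D)`, that is, the lattice points of
`P_D`. -/
def sectionPoints (X : Charts ι) (D : X.rays → ℤ) : Set (ι → ℤ) :=
  {m | ∀ u, 0 ≤ X.div u ⬝ᵥ m + D u}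

/-- The characters occurring in the sections of `O(D)` over the `j`-th chart (the divisor `u` meets
the chart if and only if no character regular on the chart has a pole along it). -/
def localSectionPoints (X : Charts ι) (D : X.rays → ℤ) (j : X.Index) : Set (ι → ℤ) :=
  {m | ∀ u, (∀ s ∈ X.monoid j, 0 ≤ X.div u ⬝ᵥ s) → 0 ≤ X.div u ⬝ᵥ m + D u}

/-- The total space of `O(-D_1) ⊕ ⋯ ⊕ O(-D_c)` for Cartier divisors `D_k`. Over the `j`-th chart
of the base, its ring of functions is generated by the functions on that chart and by the sections
of the `O(D_k)`, considered as functions linear on the fibres: the section `χ^m` of `O(D_k)` is the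
function `χ^m t_k`, where `t_k` is the fibre coordinate corresponding to the rational section `1`
of `O(D_k)`. The characters are thus `χ^m t^e`, with `m : ι → ℤ` and `e : Fin c → ℤ`. -/
def tot (Y : Charts ι) {c : ℕ} (D : Fin c → Y.rays → ℤ) : Charts (ι ⊕ Fin c) where
  Index := Y.Index
  monoid j := AddSubmonoid.closure
    ({x | ∃ m ∈ Y.monoid j, x = Sum.elim m 0} ∪
      {x | ∃ k, ∃ m ∈ Y.localSectionPoints (D k) j, x = Sum.elim m (Pi.single k 1)})
  anti i j h := by
    refine AddSubmonoid.closure_mono (Set.union_subset_union ?_ ?_)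
    · rintro x ⟨m, hm, rfl⟩
      exact ⟨m, Y.anti i j h hm, rfl⟩
    · rintro x ⟨k, m, hm, rfl⟩
      exact ⟨k, m, fun u hu => hm u fun s hs => hu s (Y.anti i j h hs), rfl⟩

end Charts

/-- Laurent polynomials, i.e. regular functions on the torus. -/
abbrev Laurent (ι : Type) : Type := AddMonoidAlgebra ℂ (ι → ℤ)

lemma support_finsum {T : Type} (f : T → Laurent ι) (s : Set (ι → ℤ))
    (h : ∀ t, ∀ m ∈ (f t).coeff.support, m ∈ s) :
    ∀ m ∈ (∑ᶠ t, f t).coeff.support, m ∈ s := by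
  refine finsum_induction (fun g : Laurent ι => ∀ m ∈ g.coeff.support, m ∈ s) ?_ ?_ h
  · intro m hm
    simp at hm
  · intro a b ha hb m hm
    classical
    have := Finsupp.support_add (g₁ := a.coeff) (g₂ := b.coeff) hm
    rcases Finset.mem_union.mp this with h' | h'
    · exact ha m h'
    · exact hb m h'

/-- A Laurent polynomial is a regular function on a toric variety: its terms are regular on all
charts. -/
def Charts.IsRegular (X : Charts ι) (W : Laurent ι) : Prop :=
  ∀ m ∈ W.coeff.support, ∀ j, m ∈ X.monoid j

/-- The function `∑ s_k t_k` on the total space of the dual bundle defined by a section `s`. -/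
def sectionFunction {c : ℕ} (s : Fin c → Laurent ι) : Laurent (ι ⊕ Fin c) :=
  ∑ k, AddMonoidAlgebra.mapDomain (fun m => Sum.elim m (Pi.single k 1)) (s k)

end Varieties

section LandauGinzburg

variable {ι : Type} [Fintype ι]

/-- The toric variety of a set of cones: a cone `σ` gives the chart `Spec ℂ[σ^∨ ∩ M]`. -/
def fanVariety (cones : Set (Set (ι → ℝ))) : Charts ι where
  Index := cones
  monoid σ :=
    { carrier := {m | ∀ ν ∈ σ.1, 0 ≤ ν ⬝ᵥ realVec m}
      zero_mem' := fun ν _ => by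
        have : realVec (0 : ι → ℤ) = 0 := by funext i; simp [realVec]
        simp [this]
      add_mem' := fun {a b} ha hb ν hν => by
        have : realVec (a + b) = realVec a + realVec b := by funext i; simp [realVec]
        rw [this, dotProduct_add]
        exact add_nonneg (ha ν hν) (hb ν hν) }
  anti σ τ h _ hm ν hν := hm ν ((show σ.1 ⊆ τ.1 from h) hν)

/-- The toric variety of a fan. -/
def Fan.variety (Y : Fan ι) : Charts ι := fanVariety Y.cones

/-! ### Sections and functions on total spaces -/

/-- `s = (s_1, …, s_c)` is a global section of `O(D_1) ⊕ ⋯ ⊕ O(D_c)`. -/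
def Charts.IsGlobalSection (Y : Charts ι) {c : ℕ} (D : Fin c → Y.rays → ℤ)
    (s : Fin c → Laurent ι) : Prop :=
  ∀ k, ∀ m ∈ (s k).coeff.support, m ∈ Y.sectionPoints (D k)

lemma sectionFunction_regular (Y : Charts ι) {c : ℕ} (D : Fin c → Y.rays → ℤ)
    (s : Fin c → Laurent ι) (hs : Y.IsGlobalSection D s) :
    (Y.tot D).IsRegular (sectionFunction s) := by
  classical
  intro x hx j
  have key := support_finsum
    (fun k => AddMonoidAlgebra.mapDomain (fun m => Sum.elim m (Pi.single k 1)) (s k))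
    {x | x ∈ (Y.tot D).monoid j} ?_ x ?_
  · exact key
  · intro k m hm
    have := Finsupp.mapDomain_support hm
    obtain ⟨m', hm', rfl⟩ := Finset.mem_image.mp this
    exact AddSubmonoid.subset_closure (Or.inr ⟨k, m', fun u _ => hs k m' hm' u, rfl⟩)
  · rw [finsum_eq_sum_of_fintype]
    exact hx

/-! ### Linear data -/

/-- `ℂ/ℤ`. -/
abbrev CZ : Type := ℂ ⧸ AddSubgroup.zmultiples (1 : ℂ)

/-- The map `G ⊗ ℂ/ℤ → (ℂ/ℤ)^T` induced by a homomorphism `C` of lattices with rows `C t`. -/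
def rowMap {T : Type} (C : T → ι → ℤ) : (ι → CZ) →+ (T → CZ) where
  toFun h t := ∑ i, C t i • h i
  map_zero' := by funext t; simp
  map_add' a b := by
    funext t
    simp only [Pi.add_apply, zsmul_add, Finset.sum_add_distrib]

/-- `coker(C)_{ℂ/ℤ}`. For the character-to-divisor map of `X` this is `A_{n-1}(X)_{ℂ/ℤ}`. -/
abbrev Coker {T : Type} (C : T → ι → ℤ) : Type := (T → CZ) ⧸ (rowMap C).range

/-- The class in `coker(C)_{ℂ/ℤ}` of an element of `(ℂ/ℤ)^T`. -/
def Coker.mk {T : Type} (C : T → ι → ℤ) (x : T → CZ) : Coker C := QuotientAddGroup.mk x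

/-- The class in `coker(C)_{ℂ/ℤ}` of an element of `ℂ^T`. -/
def Coker.ofComplex {T : Type} (C : T → ι → ℤ) (x : T → ℂ) : Coker C :=
  Coker.mk C fun t => (x t : CZ)

variable (ι) in
/-- Linear `ℂ/ℤ`-data: a homomorphism `C` from the lattice to `ℤ^T`, given by its rows, and an
element of `coker(C)_{ℂ/ℤ}`. -/
structure LinearData where
  T : Type
  C : T → ι → ℤ
  c : Coker C

/-! ### Toric Landau–Ginzburg models -/

variable (ι) in
/-- A toric Landau–Ginzburg model: a toric variety, a class in `A_{n-1}(X)_{ℂ/ℤ}` and a regular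
function (given by its restriction to the torus). -/
structure LGModel where
  X : Charts ι
  K : Coker X.div
  W : Laurent ι
  regular : X.IsRegular W

/-- The linear data `(div, K)`. -/
def LGModel.divData (𝓛 : LGModel ι) : LinearData ι where
  T := 𝓛.X.rays
  C := 𝓛.X.div
  c := 𝓛.K

/-- The linear data `(mon, L)` of the superpotential `W = ∑ q_ξ ξ`. The rows of `mon` are the terms
`ξ` of `W`, and `L` is the class of `(q_ξ)` under the isomorphism `exp(2πi·) : ℂ/ℤ → ℂ^×`. -/
def LGModel.monData (𝓛 : LGModel ι) : LinearData ι where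
  T := 𝓛.W.coeff.support
  C ξ := ξ
  c := Coker.ofComplex _ fun ξ => Complex.log (𝓛.W.coeff ξ) / (2 * Real.pi * Complex.I)

/-- The image in `G^R` of an element of `G^T` under the map `ℤ^T → ℤ^R` which sends the standard
generator `t` to the standard generator `k t`, or to zero if `k t = none`. -/
def pushGen {T R G : Type} [AddCommGroup G] (k : T → Option R) (x : T → G) : R → G :=
  fun ρ => ∑ᶠ (t : T) (_ : k t = some ρ), x t

/-- The choices by which a pair `(A, K)`, `(B, L)` of linear data defines a Landau–Ginzburg model:
lifts `α` and `β` of `K` and `L`, which amount to choices of origins, and a map `k` eliminating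
redundant inequalities. They exist if and only if the pair is kopasetic. -/
structure Realization (A B : LinearData ι) where
  α : A.T → ℂ
  lift_α : Coker.ofComplex A.C α = A.c
  interior_nonempty : (interior (polyhedron A.C fun t => (α t).im)).Nonempty
  k : A.T → Option (fanVariety (normalFan (polyhedron A.C fun t => (α t).im))).rays
  k_surjective : ∀ ρ, ∃ t, k t = some ρ
  k_div : pushGen k A.C = (fanVariety (normalFan (polyhedron A.C fun t => (α t).im))).div
  nonneg : ∀ t s, 0 ≤ A.C t ⬝ᵥ B.C s
  β : B.T → ℂ
  lift_β : Coker.ofComplex B.C β = B.c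

namespace Realization

variable {A B : LinearData ι}

/-- The polyhedral set of `(A, Im K)`. -/
def P (r : Realization A B) : Set (ι → ℝ) := polyhedron A.C fun t => (r.α t).im

/-- The function `∑ exp(2πi β_s) χ^s`. -/
def potential (r : Realization A B) : Laurent ι :=
  ∑ᶠ s, AddMonoidAlgebra.single (B.C s) (Complex.exp (2 * Real.pi * Complex.I * r.β s))

/-- The toric Landau–Ginzburg model defined by a kopasetic pair of linear data: the toric variety
`X(A, Im K)`, the class `k(K)` and the function `W(B, L)`. -/
def model (r : Realization A B) : LGModel ι where
  X := fanVariety (normalFan r.P)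
  K := Coker.ofComplex _ (pushGen r.k r.α)
  W := r.potential
  regular := by
    classical
    intro m hm j
    refine support_finsum _ {m | m ∈ (fanVariety (normalFan r.P)).monoid j} ?_ m hm
    intro s m hm
    have hm' : m = B.C s := by
      have := Finsupp.support_single_subset hm
      simpa using this
    subst hm'
    obtain ⟨σ, F, ⟨⟨x, hx⟩, ν₀, hF⟩, rfl⟩ := j
    intro ν hν
    have hxP : x ∈ r.P := by rw [hF] at hx; exact hx.1
    have hcast : ∀ t, realVec (A.C t) ⬝ᵥ realVec (B.C s) = ((A.C t ⬝ᵥ B.C s : ℤ) : ℝ) := by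
      intro t
      simp [realVec, dotProduct]
    have hy : x + realVec (B.C s) ∈ r.P := by
      intro t
      have h1 := hxP t
      have h2 : (0 : ℝ) ≤ realVec (A.C t) ⬝ᵥ realVec (B.C s) := by
        rw [hcast]; exact_mod_cast r.nonneg t s
      rw [dotProduct_add]
      linarith
    have := hν x hx _ hy
    rw [dotProduct_add] at this
    linarith

end Realization

/-- The ways to realize the dual linear data `(A', K') = (mon, L)`, `(B', L') = (div, K)` of a
toric Landau–Ginzburg model. If `r` is one of them, then `r.model` is the dual model. -/
abbrev LGModel.Dual (𝓛 : LGModel ι) : Type := Realization 𝓛.monData 𝓛.divData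

/-! ### Fano toric varieties and nef partitions -/

/-- `φ` is an integral convex function, linear on the given cones. -/
def IsIntegralConvexPL (cones : Set (Set (ι → ℝ))) (φ : (ι → ℝ) → ℝ) : Prop :=
  ConvexOn ℝ Set.univ φ ∧ ∀ σ ∈ cones, ∃ m : ι → ℤ, ∀ x ∈ σ, φ x = realVec m ⬝ᵥ x

/-- Completeness, and Cartier data for the anticanonical divisor `∑ ρ` for which the latter is
ample: over every maximal cone `σ` there is a character `m` with `m ⬝ᵥ u = -1` for the rays `u`
of `σ` and `m ⬝ᵥ u > -1` for all other rays `u`. -/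
def Fan.IsFano (Y : Fan ι) : Prop :=
  (⋃₀ Y.cones = Set.univ) ∧
    ∀ σ ∈ Y.cones, (interior σ).Nonempty → ∃ m : ι → ℤ, ∀ u : Y.variety.rays,
      -1 ≤ m ⬝ᵥ u.1 ∧ (m ⬝ᵥ u.1 = -1 ↔ realVec u.1 ∈ σ)

/-- `φ` is the support function of `D`; with `IsIntegralConvexPL`, this says that `D` is a nef
Cartier divisor. -/
def Fan.IsSupportFunction (Y : Fan ι) (D : Y.variety.rays → ℤ) (φ : (ι → ℝ) → ℝ) : Prop :=
  ∀ u, φ (realVec u.1) = D u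

/-- Givental collections: `D_k > 0` and `-κ - ∑ D_k ≥ 0`. -/
def IsGivental (Y : Charts ι) {c : ℕ} (D : Fin c → Y.rays → ℤ) : Prop :=
  (∀ k, 0 < D k) ∧ ∀ u, 0 ≤ 1 - ∑ k, D k u

/-- Calabi–Yau collections: `-κ` is linearly equivalent to `∑ D_k`. -/
def IsCalabiYau (Y : Charts ι) {c : ℕ} (D : Fin c → Y.rays → ℤ) : Prop :=
  ∃ m : ι → ℤ, ∀ u, 1 - ∑ k, D k u = Y.div u ⬝ᵥ m

/-- The non-zero lattice points of `P_D`, as real vectors. -/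
def nonzeroPoints (Y : Charts ι) (D : Y.rays → ℤ) : Set (ι → ℝ) :=
  realVec '' (Y.sectionPoints D \ {0})

/-- Nef sub-partitions: Givental collections such that the hulls `C_k` of the non-zero lattice
points of the `P_{D_k}` are non-empty, and the vertices of the hull of all these points are exactly
the vertices of the `C_k`. -/
def IsNefSubPartition (Y : Charts ι) {c : ℕ} (D : Fin c → Y.rays → ℤ) : Prop :=
  IsGivental Y D ∧
  (convexHull ℝ (⋃ k, nonzeroPoints Y (D k))).extremePoints ℝ =
    ⋃ k, (convexHull ℝ (nonzeroPoints Y (D k))).extremePoints ℝ ∧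
  ∀ k, (convexHull ℝ (nonzeroPoints Y (D k))).Nonempty

/-- Nef partitions of the vertices of a polytope `Q`, with respect to the inward normal fan of the
polar of `Q`. -/
def IsNefPartition (Q : Set (ι → ℝ)) {c : ℕ} (E : Fin c → Set (ι → ℝ)) : Prop :=
  (⋃ k, E k = Q.extremePoints ℝ) ∧ (∀ k, (E k).Nonempty) ∧
  (Pairwise fun i j => Disjoint (E i) (E j)) ∧
  ∃ φ : Fin c → (ι → ℝ) → ℝ, (∀ i, IsIntegralConvexPL (normalFan (polar Q)) (φ i)) ∧
    ∀ i j, ∀ e ∈ E j, φ i e = if i = j then 1 else 0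

/-! ### The dual nef partition -/

/-- `∇ = {μ | ν(μ) ≥ -φ(ν) for all ν}`. -/
def nabla (φ : (ι → ℝ) → ℝ) : Set (ι → ℝ) := {μ | ∀ ν : ι → ℝ, -φ ν ≤ ν ⬝ᵥ μ}

/-- `(P^*)° = conv(∇_1 ∪ ⋯ ∪ ∇_c)`. -/
def dualPolar {c : ℕ} (φ : Fin c → (ι → ℝ) → ℝ) : Set (ι → ℝ) :=
  convexHull ℝ (⋃ k, nabla (φ k))

/-- The blocks `E_k^* = vert(conv(∇_k \ {0}))` of the dual nef partition. -/
def dualBlock {c : ℕ} (φ : Fin c → (ι → ℝ) → ℝ) (k : Fin c) : Set (ι → ℝ) :=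
  (convexHull ℝ (nabla (φ k) \ {0})).extremePoints ℝ

/-- The toric variety `Y^*` of the inward normal fan of `P^* = ((P^*)°)°`. -/
def dualVariety {c : ℕ} (φ : Fin c → (ι → ℝ) → ℝ) : Charts ι :=
  fanVariety (normalFan (polar (dualPolar φ)))

open Classical in
/-- The divisor `D_k^*`: the sum of the torus-invariant prime divisors of `Y^*` in `E_k^*`. -/
def dualDivisor {c : ℕ} (φ : Fin c → (ι → ℝ) → ℝ) (k : Fin c) : (dualVariety φ).rays → ℤ :=
  fun u => if realVec u.1 ∈ dualBlock φ k then 1 else 0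

/-! ### The Landau–Ginzburg model of the Batyrev–Borisov section -/

open Classical in
/-- The section `w_BB`: in each `O(D_k)`, the sum over the lattice points `m` of `P_{D_k}` of
`exp(-2π) χ^m` if `m ≠ 0` and of `χ^0` if `m = 0`. -/
def wBB (Y : Charts ι) {c : ℕ} (D : Fin c → Y.rays → ℤ) (k : Fin c) : Laurent ι :=
  ∑ᶠ m : Y.sectionPoints (D k),
    AddMonoidAlgebra.single m.1 (if m.1 = 0 then 1 else Complex.exp (-2 * Real.pi))

lemma wBB_isGlobalSection (Y : Charts ι) {c : ℕ} (D : Fin c → Y.rays → ℤ) :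
    Y.IsGlobalSection D (wBB Y D) := by
  classical
  intro k
  refine support_finsum _ _ ?_
  intro m x hx
  have := Finsupp.support_single_subset hx
  rw [Finset.mem_singleton] at this
  rw [this]
  exact m.2

open Classical in
/-- The pullback of a torus-invariant divisor from `Y` to the total space of a bundle: the
coefficient at the preimage of a prime divisor `u` of `Y` is that of `u`, all others vanish. -/
def pullback (Y : Charts ι) {c : ℕ} (D : Fin c → Y.rays → ℤ) {G : Type} [AddCommGroup G]
    (κ : Y.rays → G) : (Y.tot D).rays → G :=
  fun v => if h : (fun i => v.1 (Sum.inl i)) ∈ Y.rays then κ ⟨_, h⟩ else 0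

/-- The model `(X, W_BB, K)` with `X = Tot(O(-D_1) ⊕ ⋯ ⊕ O(-D_c))`, `W_BB` defined by `w_BB` and
`K` the pullback of the class `[κ] ∈ A_{n-1}(Y)_{ℂ/ℤ}`. -/
def modelBB (Y : Charts ι) {c : ℕ} (D : Fin c → Y.rays → ℤ) (κ : Y.rays → CZ) :
    LGModel (ι ⊕ Fin c) where
  X := Y.tot D
  K := Coker.mk _ (pullback Y D κ)
  W := sectionFunction (wBB Y D)
  regular := sectionFunction_regular Y D _ (wBB_isGlobalSection Y D)

end LandauGinzburg

end ToricLG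

end

/-! The proof rests on two dual families of support functions. Because 1 - ∑ D_k is effective and
principal on a complete fan, it vanishes, so each ray u of Y has D_k(u) = 1 for exactly one k and 0
for the others. Let φ*_k(μ) be the maximum of -⟨u, μ⟩ over u = 0 and the rays u of the k-th block
(`dualSupport`); likewise φ_k(ν) is the maximum of -⟨l, ν⟩ over finitely many lattice points l of
∇_k. Expanding ν in the rays of a cone containing it gives ⟨ν, μ⟩ ≥ -∑ φ_k(ν) φ*_k(μ)
(`neg_sum_le_dotProduct`).

It follows that P* = {φ_k ≤ 1 for all k} is the Minkowski sum of the hulls of 0 and the k-th block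
(`polar_eq`), hence a lattice polytope on whose normal cones every φ*_k is linear
(`exists_dualSupport_eq_on_cone`). At a non-zero lattice point of ∇_k, φ*_i is 1 for i = k and 0
otherwise (`dualSupport_of_mem_nabla`). This gives reflexivity and the nef partition, with φ*_k the
support function of D*_k.

The monomials of W_BB are (m, e_k) with m a lattice point of ∇_k, and log q/(2πi) has imaginary part
0 for q = 1 and 1 for q = e^{-2π}. The polyhedron of the dual data is therefore {(ν, x) : x_k ≥
max(0, φ_k(ν) - 1)} (`polyhedron_modelBB`), whose slice x = 0 is P*. On it ⟨(μ, y), (ν, x)⟩ ≥ -∑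
φ*_k(μ) + ∑ (y_k - φ*_k(μ)) x_k, so a functional (μ, y) has a minimum exactly when y_k ≥ φ*_k(μ) for
all k, and the minimum is then reached on the slice. Thus the epigraphs of φ* over the normal cones
of P* belong to the normal fan, and every cone of that fan lies in a smallest one of them
(`epigraph_mem_normalFan`, `exists_base_cone`). These epigraphs give the charts of the total space
over Y*, and a Galois connection shows that gluing them alone is enough (`sameToricVariety`).

The monomials of W' are among the rays of X, namely (0, e_k) and (u, D_1(u), …, D_c(u))
(`tot_rays`). By the partition property they all have the form (u, e_k), so W' is linear on the
fibres, and u is a section point of D*_k (`exists_section`). -/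

namespace ToricLG

/-! ### Farkas' lemma -/

section Farkas

variable {ι : Type} [Fintype ι]

/-- Farkas' lemma over an ordered field. -/
theorem farkas {K T : Type} [Field K] [LinearOrder K] [IsStrictOrderedRing K] (s : Finset T)
    (A : T → ι → K) (b : ι → K) (h : ∀ y, (∀ t ∈ s, 0 ≤ A t ⬝ᵥ y) → 0 ≤ b ⬝ᵥ y) :
    ∃ a : T → K, (∀ t, 0 ≤ a t) ∧ b = ∑ t ∈ s, a t • A t := by
  classical
  induction s using Finset.induction_on generalizing A b with
  | empty =>
    refine ⟨0, fun _ => le_rfl, ?_⟩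
    have h1 := h (-b) (by simp)
    rw [dotProduct_neg, neg_nonneg] at h1
    have h2 : 0 ≤ b ⬝ᵥ b := Finset.sum_nonneg fun i _ => mul_self_nonneg _
    simpa using dotProduct_self_eq_zero.mp (le_antisymm h1 h2)
  | insert i s hi ih =>
    by_cases hb : ∀ y, (∀ t ∈ s, 0 ≤ A t ⬝ᵥ y) → 0 ≤ b ⬝ᵥ y
    · obtain ⟨a, ha, hab⟩ := ih A b hb
      refine ⟨fun t => if t = i then 0 else a t, fun t => by dsimp only; split_ifs <;> simp [ha], ?_⟩
      rw [Finset.sum_insert hi, hab]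
      simp only [if_true, zero_smul, zero_add]
      refine Finset.sum_congr rfl fun t ht => ?_
      rw [if_neg (ne_of_mem_of_not_mem ht hi)]
    · push Not at hb
      obtain ⟨y₁, hy₁, hby₁⟩ := hb
      have hA₁ : A i ⬝ᵥ y₁ < 0 := by
        by_contra hcon
        refine absurd (h y₁ fun t ht => ?_) (not_le.mpr hby₁)
        rcases Finset.mem_insert.mp ht with rfl | ht
        · exact not_lt.mp hcon
        · exact hy₁ t ht
      obtain ⟨y₀, hy₀, hby₀, hA₀⟩ : ∃ y₀, (∀ t ∈ s, 0 ≤ A t ⬝ᵥ y₀) ∧ b ⬝ᵥ y₀ < 0 ∧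
          A i ⬝ᵥ y₀ = -1 := by
        have hpos : 0 < (-(A i ⬝ᵥ y₁))⁻¹ := inv_pos.mpr (neg_pos.mpr hA₁)
        refine ⟨(-(A i ⬝ᵥ y₁))⁻¹ • y₁, fun t ht => ?_, ?_, ?_⟩
        · rw [dotProduct_smul, smul_eq_mul]; exact mul_nonneg hpos.le (hy₁ t ht)
        · rw [dotProduct_smul, smul_eq_mul]; exact mul_neg_of_pos_of_neg hpos hby₁
        · rw [dotProduct_smul, smul_eq_mul]; field_simp [hA₁.ne]
      -- The map v ↦ v + (v ⬝ᵥ y₀) • A i kills `A i` and is adjoint to the projection along `y₀`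
      -- onto the hyperplane where `A i` vanishes. Induction applies to the images of the remaining
      -- `A t` and of `b`.
      have key : ∀ (v : ι → K) y, (v + (v ⬝ᵥ y₀) • A i) ⬝ᵥ y = v ⬝ᵥ (y + (A i ⬝ᵥ y) • y₀) := by
        intro v y
        rw [add_dotProduct, dotProduct_add, smul_dotProduct, dotProduct_smul, smul_eq_mul,
          smul_eq_mul, mul_comm]
      obtain ⟨a, ha, hab⟩ := ih (fun t => A t + (A t ⬝ᵥ y₀) • A i) (b + (b ⬝ᵥ y₀) • A i) (by
        intro y hy
        rw [key]
        refine h _ fun t ht => ?_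
        rcases Finset.mem_insert.mp ht with rfl | ht
        · rw [dotProduct_add, dotProduct_smul, hA₀]; simp
        · rw [← key]; exact hy t ht)
      refine ⟨fun t => if t = i then (∑ t ∈ s, a t * (A t ⬝ᵥ y₀)) - b ⬝ᵥ y₀ else a t,
        fun t => ?_, ?_⟩
      · dsimp only
        split_ifs
        · have := Finset.sum_nonneg fun t ht => mul_nonneg (ha t) (hy₀ t ht)
          linarith
        · exact ha t
      · rw [Finset.sum_insert hi]
        have : ∑ t ∈ s, (if t = i then (∑ t ∈ s, a t * (A t ⬝ᵥ y₀)) - b ⬝ᵥ y₀ else a t) • A t =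
            ∑ t ∈ s, a t • A t := Finset.sum_congr rfl fun t ht => by
          rw [if_neg (ne_of_mem_of_not_mem ht hi)]
        simp only [this, if_true]
        rw [sub_smul, Finset.sum_smul]
        simp only [smul_add, Finset.sum_add_distrib, smul_smul] at hab
        refine (eq_sub_of_add_eq hab).trans ?_
        abel

lemma realVec_dotProduct (u v : ι → ℤ) : realVec u ⬝ᵥ realVec v = ((u ⬝ᵥ v : ℤ) : ℝ) := by
  simp [realVec, dotProduct]

lemma realVec_injective {ι : Type} : Function.Injective (realVec : (ι → ℤ) → ι → ℝ) := fun u v h =>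
  funext fun i => by simpa [realVec] using congrFun h i

@[simp] lemma realVec_zero {ι : Type} : realVec (0 : ι → ℤ) = 0 := by funext i; simp [realVec]

@[simp] lemma realVec_eq_zero {ι : Type} {u : ι → ℤ} : realVec u = 0 ↔ u = 0 :=
  ⟨fun h => realVec_injective (h.trans realVec_zero.symm), fun h => by rw [h, realVec_zero]⟩

lemma realVec_add {ι : Type} (u v : ι → ℤ) : realVec (u + v) = realVec u + realVec v := by
  funext i; simp [realVec]

lemma realVec_neg {ι : Type} (u : ι → ℤ) : realVec (-u) = -realVec u := by
  funext i; simp [realVec]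

lemma realVec_smul {ι : Type} (a : ℤ) (u : ι → ℤ) : realVec (a • u) = (a : ℝ) • realVec u := by
  funext i; simp [realVec]

lemma realVec_sum {ι T : Type} (s : Finset T) (u : T → ι → ℤ) :
    realVec (∑ t ∈ s, u t) = ∑ t ∈ s, realVec (u t) := by
  funext i; simp [realVec]

/-- The convex cone generated by finitely many lattice vectors. -/
def coneHull (F : Finset (ι → ℤ)) : Set (ι → ℝ) :=
  {x | ∃ a : (ι → ℤ) → ℝ, (∀ u, 0 ≤ a u) ∧ x = ∑ u ∈ F, a u • realVec u}

lemma mem_coneHull_of_mem {F : Finset (ι → ℤ)} {f : ι → ℤ} (hf : f ∈ F) :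
    realVec f ∈ coneHull F := by
  classical
  refine ⟨Pi.single f 1, fun u => ?_, ?_⟩
  · by_cases h : u = f
    · subst h; simp
    · simp [h]
  · rw [Finset.sum_eq_single_of_mem f hf]
    · simp
    · intro b _ hb
      simp [hb]

lemma add_mem_coneHull {F : Finset (ι → ℤ)} {x y : ι → ℝ} (hx : x ∈ coneHull F)
    (hy : y ∈ coneHull F) : x + y ∈ coneHull F := by
  obtain ⟨a, ha, rfl⟩ := hx
  obtain ⟨b, hb, rfl⟩ := hy
  exact ⟨a + b, fun u => add_nonneg (ha u) (hb u), by simp [add_smul, Finset.sum_add_distrib]⟩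

lemma smul_mem_coneHull {F : Finset (ι → ℤ)} {x : ι → ℝ} {r : ℝ} (hr : 0 ≤ r)
    (hx : x ∈ coneHull F) : r • x ∈ coneHull F := by
  obtain ⟨a, ha, rfl⟩ := hx
  exact ⟨r • a, fun u => mul_nonneg hr (ha u), by simp [Finset.smul_sum, smul_smul]⟩

lemma zero_mem_coneHull (F : Finset (ι → ℤ)) : (0 : ι → ℝ) ∈ coneHull F :=
  ⟨0, fun _ => le_rfl, by simp⟩

lemma sum_mem_coneHull {T : Type} {F : Finset (ι → ℤ)} (s : Finset T) (x : T → ι → ℝ)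
    (hx : ∀ t ∈ s, x t ∈ coneHull F) : ∑ t ∈ s, x t ∈ coneHull F := by
  classical
  induction s using Finset.induction_on with
  | empty => simpa using zero_mem_coneHull F
  | insert i s hi ih =>
    rw [Finset.sum_insert hi]
    exact add_mem_coneHull (hx _ (Finset.mem_insert_self _ _))
      (ih fun t ht => hx t (Finset.mem_insert_of_mem ht))

lemma coneHull_subset {F G : Finset (ι → ℤ)} (h : ∀ f ∈ F, realVec f ∈ coneHull G) :
    coneHull F ⊆ coneHull G := by
  rintro x ⟨a, ha, rfl⟩
  exact sum_mem_coneHull _ _ fun f hf => smul_mem_coneHull (ha f) (h f hf)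

lemma nonneg_of_mem_coneHull {F : Finset (ι → ℤ)} {x y : ι → ℝ} (hx : x ∈ coneHull F)
    (h : ∀ f ∈ F, 0 ≤ realVec f ⬝ᵥ y) : 0 ≤ x ⬝ᵥ y := by
  obtain ⟨a, ha, rfl⟩ := hx
  rw [sum_dotProduct]
  refine Finset.sum_nonneg fun f hf => ?_
  rw [smul_dotProduct]
  exact mul_nonneg (ha f) (h f hf)

lemma mem_coneHull_iff {F : Finset (ι → ℤ)} {x : ι → ℝ} :
    x ∈ coneHull F ↔ ∀ y, (∀ f ∈ F, 0 ≤ realVec f ⬝ᵥ y) → 0 ≤ x ⬝ᵥ y := by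
  refine ⟨fun hx y hy => nonneg_of_mem_coneHull hx hy, fun h => ?_⟩
  obtain ⟨a, ha, hab⟩ := farkas F realVec x h
  exact ⟨a, ha, hab⟩

lemma isClosed_coneHull (F : Finset (ι → ℤ)) : IsClosed (coneHull F) := by
  have : coneHull F = ⋂ (y : ι → ℝ) (_ : ∀ f ∈ F, 0 ≤ realVec f ⬝ᵥ y), {x | 0 ≤ x ⬝ᵥ y} := by
    ext x
    simp only [Set.mem_iInter, Set.mem_ofPred_eq]
    exact mem_coneHull_iff
  rw [this]
  refine isClosed_iInter fun y => isClosed_iInter fun _ => isClosed_le continuous_const ?_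
  unfold dotProduct
  fun_prop

/-- Farkas' lemma for lattice vectors. -/
theorem realVec_mem_coneHull {F : Finset (ι → ℤ)} {b : ι → ℤ}
    (h : ∀ m : ι → ℤ, (∀ f ∈ F, 0 ≤ f ⬝ᵥ m) → 0 ≤ b ⬝ᵥ m) : realVec b ∈ coneHull F := by
  classical
  obtain ⟨a, ha, hab⟩ := farkas (K := ℚ) F (fun f i => (f i : ℚ)) (fun i => (b i : ℚ)) (by
    intro y hy
    obtain ⟨N, hN⟩ := IsLocalization.exist_integer_multiples_of_finset (nonZeroDivisors ℤ)
      (Finset.univ.image y)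
    have hN' : ∀ i, ∃ z : ℤ, (z : ℚ) = (N : ℤ) * y i := fun i => by
      obtain ⟨z, hz⟩ := hN (y i) (Finset.mem_image_of_mem _ (Finset.mem_univ i))
      exact ⟨z, by simpa [Algebra.smul_def] using hz⟩
    choose z hz using hN'
    have hN0 : (N : ℤ) ≠ 0 := nonZeroDivisors.coe_ne_zero N
    -- The integral test vector is N • z with z = N • y; the square makes the scaling factor
    -- positive whatever the sign of N.
    have hpos : (0 : ℚ) < ((N : ℤ) : ℚ) ^ 2 := by positivity
    have hdot : ∀ f : ι → ℤ, ((f ⬝ᵥ ((N : ℤ) • z) : ℤ) : ℚ) =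
        ((N : ℤ) : ℚ) ^ 2 * ((fun i => (f i : ℚ)) ⬝ᵥ y) := by
      intro f
      simp only [dotProduct, Pi.smul_apply, smul_eq_mul, Int.cast_sum, Int.cast_mul, hz,
        Finset.mul_sum]
      exact Finset.sum_congr rfl fun i _ => by ring
    have h1 := h ((N : ℤ) • z) fun f hf => by
      have : (0 : ℚ) ≤ ((f ⬝ᵥ ((N : ℤ) • z) : ℤ) : ℚ) := by
        rw [hdot]; exact mul_nonneg hpos.le (hy f hf)
      exact_mod_cast this
    have h2 : (0 : ℚ) ≤ ((b ⬝ᵥ ((N : ℤ) • z) : ℤ) : ℚ) := by exact_mod_cast h1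
    rw [hdot] at h2
    exact nonneg_of_mul_nonneg_right h2 hpos)
  refine ⟨fun u => (a u : ℝ), fun u => Rat.cast_nonneg.mpr (ha u), ?_⟩
  funext i
  have := congrArg (fun q : ℚ => (q : ℝ)) (congrFun hab i)
  simpa [realVec] using this

end Farkas

/-! ### Primitive vectors -/

section Primitive

variable {ι : Type} [Fintype ι]

/-- Bézout: a generator of the ideal spanned by the coordinates divides all of them, hence is a
unit. -/
lemma IsPrimitive.exists_dotProduct_eq_one {u : ι → ℤ} (hu : IsPrimitive u) :
    ∃ w : ι → ℤ, u ⬝ᵥ w = 1 := by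
  obtain ⟨g, hg⟩ := (IsPrincipalIdealRing.principal (Ideal.span (Set.range u))).principal
  have hg' : Ideal.span (Set.range u) = Ideal.span {g} := hg
  have hunit : IsUnit g := hu g fun i => by
    rw [← Ideal.mem_span_singleton, ← hg']
    exact Ideal.subset_span ⟨i, rfl⟩
  have h1 : (1 : ℤ) ∈ Ideal.span (Set.range u) := by
    rw [hg', Ideal.span_singleton_eq_top.mpr hunit]; trivial
  obtain ⟨w, hw⟩ := Ideal.mem_span_range_iff_exists_fun.mp h1
  exact ⟨w, by rw [dotProduct_comm]; exact hw⟩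

lemma IsPrimitive.ne_zero {u : ι → ℤ} (hu : IsPrimitive u) : u ≠ 0 := by
  rintro rfl
  obtain ⟨w, hw⟩ := hu.exists_dotProduct_eq_one
  simp at hw

lemma exists_isPrimitive {f : ι → ℤ} (hf : f ≠ 0) :
    ∃ (u : ι → ℤ) (a : ℤ), IsPrimitive u ∧ 0 < a ∧ f = a • u := by
  obtain ⟨g, hg⟩ := (IsPrincipalIdealRing.principal (Ideal.span (Set.range f))).principal
  have hg' : Ideal.span (Set.range f) = Ideal.span {g} := hg
  have hdvd : ∀ i, g ∣ f i := fun i => by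
    rw [← Ideal.mem_span_singleton, ← hg']
    exact Ideal.subset_span ⟨i, rfl⟩
  have hg0 : g ≠ 0 := by
    rintro rfl
    exact hf (funext fun i => zero_dvd_iff.mp (hdvd i))
  choose u hu using fun i => abs_dvd g (f i) |>.mpr (hdvd i)
  refine ⟨u, |g|, fun k hk => ?_, abs_pos.mpr hg0, funext fun i => by simp [hu i]⟩
  have : g ∈ Ideal.span {g * k} := by
    have h1 : Ideal.span (Set.range f) ≤ Ideal.span {g * k} := by
      rw [Ideal.span_le]
      rintro _ ⟨i, rfl⟩
      rw [SetLike.mem_coe, Ideal.mem_span_singleton, hu i]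
      exact mul_dvd_mul (by simp) (hk i)
    exact h1 (hg' ▸ Ideal.mem_span_singleton_self g)
  rw [Ideal.mem_span_singleton] at this
  obtain ⟨l, hl⟩ := this
  refine IsUnit.of_mul_eq_one l (mul_left_cancel₀ hg0 ?_)
  rw [← mul_assoc, ← hl, mul_one]

/-- On the hyperplane orthogonal to `v` the form `f` is non-negative at both x and -x, so it
vanishes there and is determined by its value at some `w` with v ⬝ᵥ w = 1. Rays are identified below
from inclusions of half-spaces in this way. -/
lemma IsPrimitive.eq_smul {v f : ι → ℤ} (hv : IsPrimitive v) (hf : f ≠ 0)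
    (h : ∀ m, 0 ≤ v ⬝ᵥ m → 0 ≤ f ⬝ᵥ m) : ∃ a : ℤ, 0 < a ∧ f = a • v := by
  classical
  obtain ⟨w, hw⟩ := hv.exists_dotProduct_eq_one
  have key : ∀ m, f ⬝ᵥ m = (f ⬝ᵥ w) * (v ⬝ᵥ m) := by
    intro m
    have e : v ⬝ᵥ (m - (v ⬝ᵥ m) • w) = 0 := by
      rw [dotProduct_sub, dotProduct_smul, hw]; simp
    have h1 := h (m - (v ⬝ᵥ m) • w) e.ge
    have h2 := h (-(m - (v ⬝ᵥ m) • w)) (by rw [dotProduct_neg, e]; simp)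
    rw [dotProduct_neg] at h2
    have h3 : f ⬝ᵥ (m - (v ⬝ᵥ m) • w) = 0 := by omega
    rw [dotProduct_sub, dotProduct_smul, smul_eq_mul] at h3
    linarith
  have hfv : f = (f ⬝ᵥ w) • v := by
    funext i
    have := key (Pi.single i 1)
    simpa using this
  refine ⟨f ⬝ᵥ w, lt_of_le_of_ne (h w (by rw [hw]; simp)) fun e => hf ?_, hfv⟩
  rw [hfv, ← e, zero_smul]

lemma IsPrimitive.eq_of_smul {u v : ι → ℤ} (hu : IsPrimitive u) {a : ℤ} (ha : 0 < a)
    (h : u = a • v) : u = v := by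
  have := hu a fun i => ⟨v i, by rw [h]; simp⟩
  rcases Int.isUnit_iff.mp this with h1 | h1
  · rw [h, h1, one_smul]
  · omega

end Primitive

/-! ### Gluing a toric variety from a cofinal family of charts -/

section Gluing

variable {ι : Type}

namespace Charts

/-- The inclusion of the torus into the `j`-th chart. -/
noncomputable def chartTorusMap (X : Charts ι) (j : X.Index) : torus ι ⟶ X.diagram.obj j :=
  Spec.toLocallyRingedSpace.map
    (CommRingCat.ofHom (AddMonoidAlgebra.mapDomainRingHom ℂ (X.monoid j).subtype)).op

lemma torusMap_eq (X : Charts ι) (j : X.Index) :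
    X.torusMap j = X.chartTorusMap j ≫ colimit.ι X.diagram j := rfl

lemma chartTorusMap_comp (X : Charts ι) {i j : X.Index} (h : i ⟶ j) :
    X.chartTorusMap i ≫ X.diagram.map h = X.chartTorusMap j := by
  refine (Spec.toLocallyRingedSpace.map_comp _ _).symm.trans
    (congrArg (fun φ => Spec.toLocallyRingedSpace.map φ) ?_)
  refine Quiver.Hom.unop_inj (CommRingCat.hom_ext ?_)
  refine (AddMonoidAlgebra.mapDomainRingHom_comp (R := ℂ) _ _).symm.trans ?_
  rfl

lemma torusMap_eq_of_le (X : Charts ι) {i j : X.Index} (h : i ≤ j) :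
    X.torusMap i = X.torusMap j := by
  rw [torusMap_eq, torusMap_eq, ← X.chartTorusMap_comp (homOfLE h), Category.assoc,
    colimit.w]

/-- The charts of a toric variety that belong to a partially ordered family of indices. -/
def restrict (X : Charts ι) {J : Type} [PartialOrder J] (f : J → X.Index) (hf : Monotone f) :
    Charts ι where
  Index := J
  monoid j := X.monoid (f j)
  anti _ _ h := X.anti _ _ (hf h)

/-- A toric variety is the gluing of any family of its charts for which every chart is contained
in a smallest chart of the family. -/
theorem sameToricVariety_restrict (X : Charts ι) {J : Type} [PartialOrder J] (f : J → X.Index)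
    (hf : Monotone f) (g : X.Index → J) (hgf : GaloisConnection g f) (o : X.Index)
    (ho : ∀ i, o ≤ i) : X.SameToricVariety (X.restrict f hf) := by
  -- A right adjoint is final, so restricting the diagram along `f` keeps the colimit.
  have hfin : hf.functor.Final := Functor.final_of_adjunction hgf.adjunction
  refine ⟨(Functor.Final.colimitIso hf.functor X.diagram).symm, fun i (j : J) => ?_⟩
  -- Through the smallest chart `o`, the torus inclusion via `i` equals the one via `f j`.
  rw [← X.torusMap_eq_of_le (ho i), X.torusMap_eq_of_le (ho (f j)), torusMap_eq]
  refine (Category.assoc _ _ _).trans ?_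
  have := Functor.Final.ι_colimitIso_inv hf.functor X.diagram j
  exact congrArg (fun h => X.chartTorusMap (f j) ≫ h) this

theorem sameToricVariety_of_galoisConnection (X Z : Charts ι) (f : Z.Index → X.Index)
    (g : X.Index → Z.Index) (hgf : GaloisConnection g f) (o : X.Index) (ho : ∀ i, o ≤ i)
    (hm : ∀ j, Z.monoid j = X.monoid (f j)) : X.SameToricVariety Z := by
  -- The monoids agree only propositionally; with the whole family as a variable, the equation can
  -- be substituted.
  have key : ∀ (J : Type) [PartialOrder J] (S : J → AddSubmonoid (ι → ℤ)) (hS) (f : J → X.Index)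
      (hf : Monotone f), S = (fun j => X.monoid (f j)) → Charts.mk J S hS = X.restrict f hf := by
    rintro J _ S hS f hf rfl
    rfl
  have : Z = X.restrict f hgf.monotone_u := key Z.Index Z.monoid Z.anti f _ (funext hm)
  rw [this]
  exact X.sameToricVariety_restrict f hgf.monotone_u g hgf o ho

end Charts

end Gluing

/-! ### Rays of rational cones -/

section Rays

variable {ι : Type} [Fintype ι]

/-- The lattice points of the dual of a cone. -/
def latticeDual (σ : Set (ι → ℝ)) : Set (ι → ℤ) := {m | ∀ ν ∈ σ, 0 ≤ ν ⬝ᵥ realVec m}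

/-- The half-space of `u` contains `S` and is the localization of `S` at the elements of `S`
orthogonal to `u`. -/
def IsRayOf (S : Set (ι → ℤ)) (u : ι → ℤ) : Prop :=
  (∀ s ∈ S, 0 ≤ u ⬝ᵥ s) ∧ ∀ m, 0 ≤ u ⬝ᵥ m → ∃ s ∈ S, u ⬝ᵥ s = 0 ∧ m + s ∈ S

lemma mem_latticeDual_coneHull {F : Finset (ι → ℤ)} {m : ι → ℤ} :
    m ∈ latticeDual (coneHull F) ↔ ∀ f ∈ F, 0 ≤ f ⬝ᵥ m := by
  refine ⟨fun h f hf => ?_, fun h ν hν => nonneg_of_mem_coneHull hν fun f hf => ?_⟩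
  · have := h _ (mem_coneHull_of_mem hf)
    rw [realVec_dotProduct] at this
    exact_mod_cast this
  · rw [realVec_dotProduct]
    exact_mod_cast h f hf

lemma realVec_mem_of_nonneg_latticeDual {F : Finset (ι → ℤ)} {u : ι → ℤ}
    (h : ∀ s ∈ latticeDual (coneHull F), 0 ≤ u ⬝ᵥ s) : realVec u ∈ coneHull F :=
  realVec_mem_coneHull fun m hm => h m (mem_latticeDual_coneHull.mpr hm)

/-- A ray of a finitely generated cone is spanned by one of the generators. -/
theorem IsRayOf.exists_generator {F : Finset (ι → ℤ)} {u : ι → ℤ} (hu : IsPrimitive u)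
    (h : IsRayOf (latticeDual (coneHull F)) u) : ∃ f ∈ F, ∃ a : ℤ, 0 < a ∧ f = a • u := by
  obtain ⟨a, ha, hua⟩ := realVec_mem_of_nonneg_latticeDual h.1
  obtain ⟨f, hf, hfa, hf0⟩ : ∃ f ∈ F, 0 < a f ∧ f ≠ 0 := by
    by_contra! hcon
    refine hu.ne_zero (realVec_eq_zero.mp (hua.trans (Finset.sum_eq_zero fun f hf => ?_)))
    rcases (ha f).eq_or_lt with e | e
    · rw [← e, zero_smul]
    · rw [hcon f hf e, realVec_zero, smul_zero]
  refine ⟨f, hf, hu.eq_smul hf0 fun m hm => ?_⟩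
  obtain ⟨s, hs, hus, hms⟩ := h.2 m hm
  rw [mem_latticeDual_coneHull] at hs hms
  -- Here u ⬝ᵥ s = 0 is a sum of non-negative terms, so the generator `f`, whose coefficient is
  -- positive, is orthogonal to `s`.
  have h1 : ∑ g ∈ F, a g * (realVec g ⬝ᵥ realVec s) = 0 := by
    have : realVec u ⬝ᵥ realVec s = 0 := by rw [realVec_dotProduct, hus]; simp
    rw [hua, sum_dotProduct] at this
    simpa [smul_dotProduct] using this
  have h2 := (Finset.sum_eq_zero_iff_of_nonneg fun g hg => mul_nonneg (ha g) (by
    rw [realVec_dotProduct]; exact_mod_cast hs g hg)).mp h1 f hf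
  have h3 : f ⬝ᵥ s = 0 := by
    have := (mul_eq_zero.mp h2).resolve_left hfa.ne'
    rw [realVec_dotProduct] at this
    exact_mod_cast this
  have h4 := hms f hf
  rwa [dotProduct_add, h3, add_zero] at h4

lemma exists_of_mem_coneHull_insert [DecidableEq ι] {F : Finset (ι → ℤ)} {p : ι → ℤ} {x : ι → ℝ}
    (hx : x ∈ coneHull (insert p F)) :
    ∃ r : ℝ, 0 ≤ r ∧ ∃ y ∈ coneHull F, x = r • realVec p + y := by
  obtain ⟨a, ha, rfl⟩ := hx
  by_cases hp : p ∈ F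
  · rw [Finset.insert_eq_of_mem hp]
    exact ⟨0, le_rfl, _, ⟨a, ha, rfl⟩, by simp⟩
  · rw [Finset.sum_insert hp]
    exact ⟨a p, ha p, _, ⟨a, ha, rfl⟩, rfl⟩

/-- A strongly convex rational cone is generated by its rays. -/
theorem exists_rays_generating (F : Finset (ι → ℤ))
    (hp : ∀ x, x ∈ coneHull F → -x ∈ coneHull F → x = 0) :
    ∃ G : Finset (ι → ℤ), (∀ u ∈ G, IsPrimitive u ∧ IsRayOf (latticeDual (coneHull F)) u) ∧
      coneHull G = coneHull F := by
  classical
  -- A generating subset of least cardinality is irredundant.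
  obtain ⟨E, hE, hmin⟩ := Finset.exists_min_image
    (F.powerset.filter fun E => coneHull E = coneHull F) Finset.card ⟨F, by simp⟩
  simp only [Finset.mem_filter, Finset.mem_powerset] at hE hmin
  obtain ⟨hEF, hEF'⟩ := hE
  rw [← hEF'] at hp ⊢
  have hnot : ∀ f ∈ E, realVec f ∉ coneHull (E.erase f) := by
    intro f hf hmem
    have h1 : coneHull (E.erase f) = coneHull E := by
      refine subset_antisymm
        (coneHull_subset fun g hg => mem_coneHull_of_mem (Finset.mem_of_mem_erase hg))
        (coneHull_subset fun g hg => ?_)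
      by_cases hgf : g = f
      · rw [hgf]; exact hmem
      · exact mem_coneHull_of_mem (Finset.mem_erase.mpr ⟨hgf, hg⟩)
    have h2 := hmin (E.erase f) ⟨(Finset.erase_subset _ _).trans hEF, h1.trans hEF'⟩
    exact absurd (Finset.card_erase_lt_of_mem hf) (not_lt.mpr h2)
  have hne : ∀ f ∈ E, f ≠ 0 := by
    rintro f hf rfl
    exact hnot 0 hf (by rw [realVec_zero]; exact zero_mem_coneHull _)
  -- Each `f` spans an exposed ray. The functional is a sum over the other generators g; if some g
  -- admitted no summand, Farkas would put -g in the cone generated by `E` and -f, against strong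
  -- convexity or irredundancy.
  have hsep : ∀ f ∈ E, ∃ s : ι → ℤ, f ⬝ᵥ s = 0 ∧ ∀ g ∈ E.erase f, 0 < g ⬝ᵥ s := by
    intro f hf
    have hone : ∀ g ∈ E.erase f, ∃ s : ι → ℤ, f ⬝ᵥ s = 0 ∧ (∀ h ∈ E, 0 ≤ h ⬝ᵥ s) ∧
        0 < g ⬝ᵥ s := by
      intro g hg
      have hgE := Finset.mem_of_mem_erase hg
      by_contra! hcon
      have h1 : realVec (-g) ∈ coneHull (insert (-f) E) := realVec_mem_coneHull fun m hm => by
        have hf1 := hm _ (Finset.mem_insert_self _ _)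
        have hE1 : ∀ h ∈ E, 0 ≤ h ⬝ᵥ m := fun h hh => hm h (Finset.mem_insert_of_mem hh)
        rw [neg_dotProduct, neg_nonneg] at hf1 ⊢
        exact hcon m (le_antisymm hf1 (hE1 f hf)) hE1
      obtain ⟨r, hr, y, hy, hgy⟩ := exists_of_mem_coneHull_insert h1
      rw [← Finset.insert_erase hf] at hy
      obtain ⟨t, ht, z, hz, rfl⟩ := exists_of_mem_coneHull_insert hy
      rw [realVec_neg, realVec_neg] at hgy
      rcases le_or_gt r t with hrt | hrt
      · refine hne g hgE (realVec_eq_zero.mp (hp _ (mem_coneHull_of_mem hgE) ?_))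
        have : -realVec g = (t - r) • realVec f + z := by
          rw [hgy, sub_smul, smul_neg]; abel
        rw [this]
        exact add_mem_coneHull (smul_mem_coneHull (sub_nonneg.mpr hrt) (mem_coneHull_of_mem hf))
          (coneHull_subset (fun g hg => mem_coneHull_of_mem (Finset.mem_of_mem_erase hg)) hz)
      · refine hnot f hf ?_
        have h0 : 0 < r - t := sub_pos.mpr hrt
        have : realVec f = (r - t)⁻¹ • (realVec g + z) := by
          rw [eq_inv_smul_iff₀ h0.ne', ← neg_neg (realVec g), hgy, sub_smul, smul_neg]
          abel
        rw [this]
        exact smul_mem_coneHull (inv_nonneg.mpr h0.le)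
          (add_mem_coneHull (mem_coneHull_of_mem hg) hz)
    choose! s hs0 hsE hsg using hone
    refine ⟨∑ g ∈ E.erase f, s g, ?_, fun g hg => ?_⟩
    · rw [dotProduct_sum]
      exact Finset.sum_eq_zero fun g hg => hs0 g hg
    · rw [dotProduct_sum]
      exact Finset.sum_pos' (fun h hh => hsE h hh g (Finset.mem_of_mem_erase hg))
        ⟨g, hg, hsg g hg⟩
  choose! u a hu ha hfu using fun f (hf : f ∈ E) => exists_isPrimitive (hne f hf)
  refine ⟨E.image u, ?_, subset_antisymm (coneHull_subset ?_) (coneHull_subset ?_)⟩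
  · intro v hv
    obtain ⟨f, hf, rfl⟩ := Finset.mem_image.mp hv
    have hpos : ∀ m, 0 ≤ u f ⬝ᵥ m ↔ 0 ≤ f ⬝ᵥ m := by
      intro m
      conv_rhs => rw [hfu f hf, smul_dotProduct, smul_eq_mul]
      exact (mul_nonneg_iff_of_pos_left (ha f hf)).symm
    refine ⟨hu f hf, fun s hs => (hpos s).mpr (mem_latticeDual_coneHull.mp hs f hf),
      fun m hm => ?_⟩
    obtain ⟨s, hs0, hs⟩ := hsep f hf
    have hs0' : u f ⬝ᵥ s = 0 := by
      rw [hfu f hf, smul_dotProduct, smul_eq_mul] at hs0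
      exact (mul_eq_zero.mp hs0).resolve_left (ha f hf).ne'
    -- By integrality g ⬝ᵥ s ≥ 1 for g ≠ f, so this multiple of `s` outweighs every negative g ⬝ᵥ m.
    refine ⟨(∑ g ∈ E, |g ⬝ᵥ m|) • s, mem_latticeDual_coneHull.mpr fun g hg => ?_, ?_,
      mem_latticeDual_coneHull.mpr fun g hg => ?_⟩
    · rw [dotProduct_smul, smul_eq_mul]
      refine mul_nonneg (Finset.sum_nonneg fun _ _ => abs_nonneg _) ?_
      by_cases hgf : g = f
      · rw [hgf, hs0]
      · exact (hs g (Finset.mem_erase.mpr ⟨hgf, hg⟩)).le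
    · rw [dotProduct_smul, hs0', smul_zero]
    · rw [dotProduct_add, dotProduct_smul, smul_eq_mul]
      by_cases hgf : g = f
      · rw [hgf, hs0, mul_zero, add_zero]
        exact (hpos m).mp hm
      · have h1 := hs g (Finset.mem_erase.mpr ⟨hgf, hg⟩)
        have h2 : |g ⬝ᵥ m| ≤ ∑ g ∈ E, |g ⬝ᵥ m| :=
          Finset.single_le_sum (f := fun g => |g ⬝ᵥ m|) (fun _ _ => abs_nonneg _) hg
        have h3 := neg_abs_le (g ⬝ᵥ m)
        nlinarith [abs_nonneg (g ⬝ᵥ m)]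
  · intro v hv
    obtain ⟨f, hf, rfl⟩ := Finset.mem_image.mp hv
    have h1 : realVec (u f) = ((a f : ℝ))⁻¹ • realVec f := by
      have h0 : (a f : ℝ) ≠ 0 := by exact_mod_cast (ha f hf).ne'
      rw [eq_inv_smul_iff₀ h0, ← realVec_smul, ← hfu f hf]
    rw [h1]
    exact smul_mem_coneHull (inv_nonneg.mpr (by exact_mod_cast (ha f hf).le))
      (mem_coneHull_of_mem hf)
  · intro f hf
    rw [hfu f hf, realVec_smul]
    exact smul_mem_coneHull (by exact_mod_cast (ha f hf).le)
      (mem_coneHull_of_mem (Finset.mem_image_of_mem u hf))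

/-- The normal cones of a polyhedron are generated by normals of the defining half-spaces. -/
theorem normalCone_polyhedron {T : Type} [Finite T] (A : T → ι → ℤ) (α : T → ℝ)
    {F : Set (ι → ℝ)} (hF : IsFace (polyhedron A α) F) :
    ∃ G : Finset (ι → ℤ), (∀ g ∈ G, g ∈ Set.range A) ∧
      normalCone (polyhedron A α) F = coneHull G := by
  classical
  have := Fintype.ofFinite T
  obtain ⟨hne, ν₀, hF₀⟩ := hF
  let act : (ι → ℝ) → Finset T := fun x => Finset.univ.filter fun t => realVec (A t) ⬝ᵥ x + α t = 0
  -- A point of `F` with the fewest active inequalities serves as a relative interior point: if an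
  -- inequality active at `x` were strict at z ∈ F, the midpoint would have fewer active ones.
  obtain ⟨x, hx, hmin⟩ := exists_minimal_of_wellFoundedLT
    (P := fun N : ℕ => ∃ x ∈ F, (act x).card = N) (by
      obtain ⟨x, hx⟩ := hne
      exact ⟨_, x, hx, rfl⟩) |>.elim fun N hN => by
    obtain ⟨⟨x, hx, rfl⟩, hmin⟩ := hN
    exact (⟨x, hx, fun z hz => (le_total _ _).elim id fun h => hmin ⟨z, hz, rfl⟩ h⟩ :
      ∃ x ∈ F, ∀ z ∈ F, (act x).card ≤ (act z).card)
  have hFP : ∀ z ∈ F, z ∈ polyhedron A α := fun z hz => by rw [hF₀] at hz; exact hz.1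
  have hact : ∀ t ∈ act x, ∀ z ∈ F, realVec (A t) ⬝ᵥ z + α t = 0 := by
    intro t ht z hz
    by_contra hcon
    have hdot : ∀ v : ι → ℝ, v ⬝ᵥ ((1 / 2 : ℝ) • x + (1 / 2 : ℝ) • z) =
        (v ⬝ᵥ x + v ⬝ᵥ z) / 2 := by
      intro v
      rw [dotProduct_add, dotProduct_smul, dotProduct_smul, smul_eq_mul, smul_eq_mul]
      ring
    have hw : (1 / 2 : ℝ) • x + (1 / 2 : ℝ) • z ∈ F := by
      have hx' := hx
      have hz' := hz
      rw [hF₀] at hx' hz' ⊢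
      refine ⟨fun t => ?_, fun y hy => ?_⟩
      · have h1 := hx'.1 t
        have h2 := hz'.1 t
        rw [hdot]
        linarith
      · have h1 := hx'.2 y hy
        have h2 := hz'.2 y hy
        rw [hdot]
        linarith
    refine absurd (hmin _ hw) (not_le.mpr (Finset.card_lt_card ⟨fun s hs => ?_, fun hsub => ?_⟩))
    · simp only [act, Finset.mem_filter, Finset.mem_univ, true_and] at hs ⊢
      have h1 := hFP x hx s
      have h2 := hFP z hz s
      rw [hdot] at hs
      linarith
    · have h0 := hsub ht
      simp only [act, Finset.mem_filter, Finset.mem_univ, true_and] at h0 ht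
      rw [hdot] at h0
      exact hcon (by linarith)
  refine ⟨(act x).image A, fun g hg => ?_, subset_antisymm ?_ ?_⟩
  · obtain ⟨t, -, rfl⟩ := Finset.mem_image.mp hg
    exact ⟨t, rfl⟩
  · intro ν hν
    rw [mem_coneHull_iff]
    intro y hy
    -- For small ε > 0 the point x + ε • y remains in the polyhedron: active inequalities persist by
    -- the sign condition on `y`, the others by continuity.
    have hev : ∀ᶠ ε in nhdsWithin (0 : ℝ) (Set.Ioi 0), ∀ t,
        0 ≤ realVec (A t) ⬝ᵥ (x + ε • y) + α t := by
      rw [Filter.eventually_all]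
      intro t
      by_cases ht : t ∈ act x
      · filter_upwards [self_mem_nhdsWithin] with ε hε
        have h1 := hy _ (Finset.mem_image_of_mem A ht)
        have h2 := hFP x hx t
        rw [dotProduct_add, dotProduct_smul, smul_eq_mul]
        have := mul_nonneg (le_of_lt (Set.mem_Ioi.mp hε)) h1
        linarith
      · have h1 : 0 < realVec (A t) ⬝ᵥ x + α t := lt_of_le_of_ne (hFP x hx t) fun e => ht (by
          simp only [act, Finset.mem_filter, Finset.mem_univ, true_and]; exact e.symm)
        have hc : Continuous fun ε : ℝ => realVec (A t) ⬝ᵥ (x + ε • y) + α t := by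
          simp only [dotProduct_add, dotProduct_smul, smul_eq_mul]
          fun_prop
        have h2 : ∀ᶠ ε in nhds (0 : ℝ), 0 < realVec (A t) ⬝ᵥ (x + ε • y) + α t :=
          hc.continuousAt.eventually (lt_mem_nhds (by simpa using h1))
        exact (h2.filter_mono nhdsWithin_le_nhds).mono fun _ h => h.le
    obtain ⟨ε, hε, hε0⟩ := (hev.and self_mem_nhdsWithin).exists
    have h1 := hν x hx _ hε
    rw [dotProduct_add, dotProduct_smul, smul_eq_mul] at h1
    exact nonneg_of_mul_nonneg_right (by linarith) (Set.mem_Ioi.mp hε0)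
  · rintro ν ⟨a, ha, rfl⟩ z hz y hy
    rw [sum_dotProduct, sum_dotProduct]
    refine Finset.sum_le_sum fun g hg => ?_
    obtain ⟨t, ht, rfl⟩ := Finset.mem_image.mp hg
    rw [smul_dotProduct, smul_dotProduct]
    refine mul_le_mul_of_nonneg_left ?_ (ha _)
    have h1 := hact t ht z hz
    have h2 := hy t
    linarith

end Rays

/-! ### Total spaces of split bundles -/

section TotalSpace

variable {ι : Type} [Fintype ι]

/-- The cone `σ` is generated by finitely many of its rays. -/
def IsGeneratedByRays (σ : Set (ι → ℝ)) : Prop :=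
  ∃ G : Finset (ι → ℤ), σ = coneHull G ∧ ∀ u ∈ G, IsPrimitive u ∧ IsRayOf (latticeDual σ) u

lemma IsRationalCone.isGeneratedByRays {σ : Set (ι → ℝ)} (h : IsRationalCone σ)
    (hp : ∀ x, x ∈ σ → -x ∈ σ → x = 0) : IsGeneratedByRays σ := by
  obtain ⟨F, rfl⟩ := h
  obtain ⟨G, hG, hGF⟩ := exists_rays_generating F hp
  exact ⟨G, hGF.symm, hG⟩

lemma sumElim_dotProduct {κ : Type} [Fintype κ] (u : ι → ℤ) (a : κ → ℤ) (x : ι ⊕ κ → ℤ) :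
    Sum.elim u a ⬝ᵥ x = (u ⬝ᵥ fun i => x (Sum.inl i)) + a ⬝ᵥ fun k => x (Sum.inr k) := by
  simp [dotProduct]

variable {cones : Set (Set (ι → ℝ))} {c : ℕ} {D : Fin c → (fanVariety cones).rays → ℤ}

/-- Over a cone on which the divisors `D_k` have Cartier data `m_k`, the total space is the product
of the chart of the base with an affine space. -/
theorem mem_tot_monoid {j : (fanVariety cones).Index} (hj : IsGeneratedByRays j.1)
    {m : Fin c → ι → ℤ}
    (hm : ∀ k, ∀ u : (fanVariety cones).rays, realVec u.1 ∈ j.1 → D k u = m k ⬝ᵥ u.1)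
    {x : ι ⊕ Fin c → ℤ} :
    x ∈ ((fanVariety cones).tot D).monoid j ↔ (∀ k, 0 ≤ x (Sum.inr k)) ∧
      (fun i => x (Sum.inl i)) + ∑ k, x (Sum.inr k) • m k ∈ (fanVariety cones).monoid j := by
  classical
  obtain ⟨G, hG, hray⟩ := hj
  have hmem : ∀ n : ι → ℤ, n ∈ (fanVariety cones).monoid j ↔ ∀ u ∈ G, 0 ≤ u ⬝ᵥ n := fun n => by
    rw [← mem_latticeDual_coneHull, ← hG]; rfl
  constructor
  · intro hx
    induction hx using AddSubmonoid.closure_induction with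
    | mem x hx =>
      rcases hx with ⟨n, hn, rfl⟩ | ⟨k, n, hn, rfl⟩
      · simpa using hn
      · refine ⟨fun l => by simp only [Sum.elim_inr, Pi.single_apply]; split_ifs <;> simp, ?_⟩
        have : ∑ l, (Sum.elim n (Pi.single k 1) : ι ⊕ Fin c → ℤ) (Sum.inr l) • m l = m k := by
          rw [Finset.sum_eq_single k]
          · simp
          · intro l _ hl
            simp [hl]
          · simp
        rw [this, hmem]
        intro u hu
        have h1 := hn ⟨u, (hray u hu).1, j, (hray u hu).2⟩ (hray u hu).2.1
        have huj : realVec u ∈ j.1 := hG.symm ▸ mem_coneHull_of_mem hu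
        rw [hm k _ huj, dotProduct_comm (m k)] at h1
        simp only [Sum.elim_inl]
        rw [dotProduct_add]
        exact h1
    | zero => exact ⟨fun _ => le_rfl, by
      convert ((fanVariety cones).monoid j).zero_mem using 1
      funext i
      simp⟩
    | add x y _ _ hx hy =>
      refine ⟨fun k => add_nonneg (hx.1 k) (hy.1 k), ?_⟩
      convert add_mem hx.2 hy.2 using 1
      funext i
      simp only [Pi.add_apply, Finset.sum_apply, Pi.smul_apply, smul_eq_mul, add_mul,
        Finset.sum_add_distrib]
      ring
  · rintro ⟨hx, hxm⟩
    -- The vector (-m_k, e_k) is the exponent of a local generator of O(D_k); removing x_k copies of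
    -- each leaves a character of the base.
    have hsum : x = Sum.elim ((fun i => x (Sum.inl i)) + ∑ k, x (Sum.inr k) • m k) 0 +
        ∑ k, (x (Sum.inr k)).toNat • (Sum.elim (-m k) (Pi.single k 1) : ι ⊕ Fin c → ℤ) := by
      have hz : ∀ k, (((x (Sum.inr k)).toNat : ℕ) : ℤ) = x (Sum.inr k) :=
        fun k => Int.toNat_of_nonneg (hx k)
      funext i
      rcases i with i | l
      · simp [hz]
      · simp [hz, Pi.single_apply]
    have hlin : ∀ k, Sum.elim (-m k) (Pi.single k 1) ∈ ((fanVariety cones).tot D).monoid j := by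
      refine fun k => AddSubmonoid.subset_closure (Or.inr ⟨k, -m k, fun u hu => ?_, rfl⟩)
      have hu' : realVec u.1 ∈ j.1 := by
        rw [hG]
        refine realVec_mem_of_nonneg_latticeDual ?_
        rw [← hG]
        exact hu
      rw [hm k u hu', dotProduct_neg, dotProduct_comm (m k)]
      exact (neg_add_cancel _).ge
    rw [hsum]
    refine AddSubmonoid.add_mem _ ?_ (AddSubmonoid.sum_mem _ fun k _ =>
      AddSubmonoid.nsmul_mem _ (hlin k) _)
    exact AddSubmonoid.subset_closure (Or.inl ⟨_, hxm, rfl⟩)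

/-- The torus-invariant prime divisors of the total space of a split bundle are the preimages of
those of the base and the subbundles complementary to the summands. -/
theorem tot_rays (hcones : ∀ σ ∈ cones, IsGeneratedByRays σ)
    (hD : ∀ k, ∀ σ ∈ cones, ∃ m : ι → ℤ, ∀ u : (fanVariety cones).rays, realVec u.1 ∈ σ →
      D k u = m ⬝ᵥ u.1) {v : ι ⊕ Fin c → ℤ} (hv : v ∈ ((fanVariety cones).tot D).rays) :
    (∃ k, v = Sum.elim (0 : ι → ℤ) (Pi.single k 1)) ∨
      ∃ u : (fanVariety cones).rays, v = Sum.elim u.1 fun k => D k u := by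
  classical
  obtain ⟨hprim, (j : (fanVariety cones).Index), hnonneg, hloc⟩ := hv
  obtain ⟨u, a, rfl⟩ : ∃ u a, v = Sum.elim u a :=
    ⟨fun i => v (Sum.inl i), fun k => v (Sum.inr k), by funext i; rcases i <;> rfl⟩
  choose m hm using fun k => hD k j.1 j.2
  have hmem := @mem_tot_monoid ι _ cones c D j (hcones j.1 j.2) m hm
  have hb : ∀ k, 0 ≤ a k - m k ⬝ᵥ u := by
    intro k
    have h1 := hnonneg (Sum.elim (-m k) (Pi.single k 1)) (by
      rw [hmem]
      refine ⟨fun l => by simp only [Sum.elim_inr, Pi.single_apply]; split_ifs <;> simp, ?_⟩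
      have : ∑ l, (Sum.elim (-m k) (Pi.single k 1) : ι ⊕ Fin c → ℤ) (Sum.inr l) • m l = m k := by
        rw [Finset.sum_eq_single k]
        · simp
        · intro l _ hl
          simp [hl]
        · simp
      rw [this]
      convert ((fanVariety cones).monoid j).zero_mem using 1
      exact neg_add_cancel (m k))
    rw [sumElim_dotProduct] at h1
    simp only [Sum.elim_inl, Sum.elim_inr] at h1
    have h2 : (u ⬝ᵥ fun i => (-m k) i) = -(m k ⬝ᵥ u) := by
      rw [dotProduct_comm]; exact neg_dotProduct _ _
    have h3 : (a ⬝ᵥ fun l => (Pi.single k 1 : Fin c → ℤ) l) = a k := by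
      simpa using dotProduct_single_one a k
    rw [h2, h3] at h1
    omega
  -- In the local trivialization `v` has base component `u` and fibre components a_k - ⟨m_k, u⟩,
  -- which are non-negative.
  have hpair : ∀ x : ι ⊕ Fin c → ℤ, Sum.elim u a ⬝ᵥ x =
      u ⬝ᵥ ((fun i => x (Sum.inl i)) + ∑ k, x (Sum.inr k) • m k) +
        ∑ k, (a k - m k ⬝ᵥ u) * x (Sum.inr k) := by
    intro x
    rw [sumElim_dotProduct, dotProduct_add, dotProduct_sum, add_assoc, ← Finset.sum_add_distrib]
    congr 1
    refine Finset.sum_congr rfl fun k _ => ?_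
    rw [dotProduct_smul, smul_eq_mul, dotProduct_comm u (m k)]
    ring
  have hu0 : ∀ s ∈ (fanVariety cones).monoid j, 0 ≤ u ⬝ᵥ s := by
    intro s hs
    have := hnonneg (Sum.elim s 0) (AddSubmonoid.subset_closure (Or.inl ⟨s, hs, rfl⟩))
    simpa [sumElim_dotProduct] using this
  by_cases hk : ∃ k, 0 < a k - m k ⬝ᵥ u
  · obtain ⟨k, hk⟩ := hk
    left
    refine ⟨k, ?_⟩
    have hne : (Sum.elim 0 (Pi.single k 1) : ι ⊕ Fin c → ℤ) ≠ 0 := fun h => by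
      simpa using congrFun h (Sum.inr k)
    have hdot : ∀ x : ι ⊕ Fin c → ℤ,
        (Sum.elim 0 (Pi.single k 1) : ι ⊕ Fin c → ℤ) ⬝ᵥ x = x (Sum.inr k) := by
      intro x
      rw [sumElim_dotProduct]
      simp
    -- With a positive k-th fibre component, elements of the monoid orthogonal to `v` have k-th
    -- exponent 0, so the half-space of `v` lies in that of (0, e_k).
    obtain ⟨t, ht, htv⟩ := hprim.eq_smul hne (by
      intro x hx
      obtain ⟨s, hs, hs0, hxs⟩ := hloc x hx
      rw [hmem] at hs hxs
      rw [hpair] at hs0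
      have h1 : ∀ l ∈ Finset.univ, 0 ≤ (a l - m l ⬝ᵥ u) * s (Sum.inr l) :=
        fun l _ => mul_nonneg (hb l) (hs.1 l)
      have h2 := hu0 _ hs.2
      have h3 := Finset.sum_nonneg h1
      have h4 := (Finset.sum_eq_zero_iff_of_nonneg h1).mp (by omega) k (Finset.mem_univ k)
      have h5 := (mul_eq_zero.mp h4).resolve_left hk.ne'
      have h6 := hxs.1 k
      rw [Pi.add_apply, h5, add_zero] at h6
      rw [hdot]
      exact h6)
    refine (IsPrimitive.eq_of_smul (fun d hd => ?_) ht htv).symm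
    have := hd (Sum.inr k)
    simp only [Sum.elim_inr, Pi.single_eq_same] at this
    exact isUnit_of_dvd_one this
  · right
    have ha : ∀ k, a k = m k ⬝ᵥ u := fun k => by
      have h1 := hb k
      have h2 : ¬ 0 < a k - m k ⬝ᵥ u := fun h => hk ⟨k, h⟩
      omega
    have hu : u ∈ (fanVariety cones).rays := by
      refine ⟨fun d hd => hprim d fun i => ?_, j, hu0, fun n hn => ?_⟩
      · rcases i with i | k
        · exact hd i
        · rw [Sum.elim_inr, ha k]
          exact Finset.dvd_sum fun i _ => Dvd.dvd.mul_left (hd i) _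
      · obtain ⟨s, hs, hs0, hns⟩ := hloc (Sum.elim n 0) (by simpa [sumElim_dotProduct] using hn)
        rw [hmem] at hs hns
        rw [hpair] at hs0
        refine ⟨_, hs.2, ?_, ?_⟩
        · simpa [ha] using hs0
        · convert hns.2 using 1
          funext i
          simp [add_assoc]
    refine ⟨⟨u, hu⟩, ?_⟩
    have hσ : realVec u ∈ j.1 := by
      obtain ⟨G, hG, -⟩ := hcones j.1 j.2
      rw [hG]
      refine realVec_mem_of_nonneg_latticeDual ?_
      rw [← hG]
      exact hu0
    congr 1
    funext k
    rw [ha k]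
    exact (hm k ⟨u, hu⟩ hσ).symm

end TotalSpace

/-! ### Convex geometry -/

section Convex

variable {ι : Type} [Fintype ι]

/-- The hull of a finite set is closed, so Hahn–Banach separates it strictly from a point outside.
-/
lemma mem_convexHull_of_forall_dotProduct {S : Set (ι → ℝ)} (hS : S.Finite) {x : ι → ℝ}
    (h : ∀ y, ∃ l ∈ S, l ⬝ᵥ y ≤ x ⬝ᵥ y) : x ∈ convexHull ℝ S := by
  classical
  by_contra hx
  obtain ⟨f, u, hfx, hfS⟩ := geometric_hahn_banach_point_closed
    (convex_convexHull ℝ S) (hS.isClosed_convexHull ℝ) hx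
  have hf : ∀ v, f v = v ⬝ᵥ fun i => f (Pi.single i 1) := by
    intro v
    conv_lhs => rw [pi_eq_sum_univ' v]
    simp [dotProduct]
  obtain ⟨l, hl, hlx⟩ := h fun i => f (Pi.single i 1)
  rw [← hf, ← hf] at hlx
  exact absurd (hfS l (subset_convexHull ℝ S hl)) (by linarith)

lemma convex_halfSpace_dotProduct (y : ι → ℝ) (r : ℝ) : Convex ℝ {x : ι → ℝ | r ≤ x ⬝ᵥ y} := by
  intro a ha b hb s t hs ht hst
  simp only [Set.mem_ofPred_eq] at ha hb ⊢
  rw [add_dotProduct, smul_dotProduct, smul_dotProduct, smul_eq_mul, smul_eq_mul]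
  calc r = s * r + t * r := by rw [← add_mul, hst, one_mul]
    _ ≤ _ := add_le_add (mul_le_mul_of_nonneg_left ha hs) (mul_le_mul_of_nonneg_left hb ht)

lemma mem_polar_convexHull {S : Set (ι → ℝ)} {ξ : ι → ℝ} :
    ξ ∈ polar (convexHull ℝ S) ↔ ∀ v ∈ S, 0 ≤ v ⬝ᵥ ξ + 1 := by
  refine ⟨fun h v hv => h v (subset_convexHull ℝ S hv), fun h v hv => ?_⟩
  have : convexHull ℝ S ⊆ {x | -1 ≤ x ⬝ᵥ ξ} :=
    convexHull_min (fun v hv => by have := h v hv; simp only [Set.mem_ofPred_eq]; linarith)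
      (convex_halfSpace_dotProduct ξ _)
  have h1 : -1 ≤ v ⬝ᵥ ξ := this hv
  linarith

lemma convex_polar (C : Set (ι → ℝ)) : Convex ℝ (polar C) := by
  have : polar C = ⋂ ν ∈ C, {ξ : ι → ℝ | -1 ≤ ξ ⬝ᵥ ν} := by
    ext ξ
    simp only [polar, Set.mem_iInter, Set.mem_ofPred_eq]
    refine forall₂_congr fun ν _ => ?_
    rw [dotProduct_comm]
    exact ⟨fun h => by linarith, fun h => by linarith⟩
  rw [this]
  exact convex_iInter fun ν => convex_iInter fun _ => convex_halfSpace_dotProduct ν _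

lemma convex_nabla (φ : (ι → ℝ) → ℝ) : Convex ℝ (nabla φ) := by
  have : nabla (φ) = ⋂ ν : ι → ℝ, {μ | -φ ν ≤ μ ⬝ᵥ ν} := by
    ext μ
    simp only [nabla, Set.mem_iInter, Set.mem_ofPred_eq]
    exact forall_congr' fun ν => by rw [dotProduct_comm]
  rw [this]
  exact convex_iInter fun ν => convex_halfSpace_dotProduct ν _

/-- Removing a point `0` from a convex set removes it from the extreme points. -/
lemma extremePoints_convexHull_diff_zero {E : Type} [AddCommGroup E] [Module ℝ E] {C : Set E}
    (hC : Convex ℝ C) (h0 : (0 : E) ∈ C) :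
    (convexHull ℝ (C \ {0})).extremePoints ℝ = C.extremePoints ℝ \ {0} := by
  -- If 0 is extreme, C \ {0} is already convex. Otherwise 0 is a proper convex combination of
  -- non-zero points and the hull is all of `C`.
  by_cases hext : (0 : E) ∈ C.extremePoints ℝ
  · rw [((hC.mem_extremePoints_iff_convex_sdiff).mp hext).2.convexHull_eq]
    -- An extreme point t • b would lie strictly between (t / 2) • b and b, and that segment avoids
    -- 0.
    have aux : ∀ x, x ∈ (C \ {0}).extremePoints ℝ → ∀ b ∈ C, ∀ t : ℝ, 0 < t → t < 1 →
        t • b = x → False := by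
      intro x hx b hb t ht ht1 hbx
      have hx0 : x ≠ 0 := (extremePoints_subset hx).2
      have hb0 : b ≠ 0 := fun h => hx0 (by rw [← hbx, h, smul_zero])
      have hm : (t / 2) • b ∈ C \ {0} := by
        refine ⟨?_, fun h => ?_⟩
        · have := hC h0 hb (a := 1 - t / 2) (b := t / 2) (by linarith) (by linarith) (by ring)
          simpa using this
        · rcases smul_eq_zero.mp (Set.mem_singleton_iff.mp h) with h | h
          · linarith
          · exact hb0 h
      have hseg : x ∈ openSegment ℝ ((t / 2) • b) b := by
        have hden : 0 < 2 - t := by linarith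
        have hden' := hden.ne'
        refine ⟨(2 - 2 * t) / (2 - t), t / (2 - t), div_pos (by linarith) hden,
          div_pos ht hden, ?_, ?_⟩
        · field_simp; ring
        · rw [smul_smul, ← add_smul, ← hbx]
          congr 1
          field_simp
          ring
      have h1 := (mem_extremePoints.mp hx).2 _ hm _ ⟨hb, hb0⟩ hseg
      have h2 : (1 - t) • b = 0 := by rw [sub_smul, one_smul, hbx, h1.2, sub_self]
      rcases smul_eq_zero.mp h2 with h | h
      · linarith
      · exact hb0 h
    ext x
    constructor
    · intro hx
      have hx1 : x ∈ C \ {0} := extremePoints_subset hx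
      refine ⟨mem_extremePoints.mpr ⟨hx1.1, fun a ha b hb hab => ?_⟩, hx1.2⟩
      by_cases ha0 : a = 0
      · obtain ⟨s, t, hs, ht, hst, hxe⟩ := hab
        rw [ha0, smul_zero, zero_add] at hxe
        exact (aux x hx b hb t ht (by linarith) hxe).elim
      by_cases hb0 : b = 0
      · obtain ⟨s, t, hs, ht, hst, hxe⟩ := hab
        rw [hb0, smul_zero, add_zero] at hxe
        exact (aux x hx a ha s hs (by linarith) hxe).elim
      exact (mem_extremePoints.mp hx).2 a ⟨ha, ha0⟩ b ⟨hb, hb0⟩ hab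
    · rintro ⟨hx, hx0⟩
      exact inter_extremePoints_subset_extremePoints_of_subset Set.sdiff_subset
        ⟨⟨extremePoints_subset hx, hx0⟩, hx⟩
  · have hmem : (0 : E) ∈ convexHull ℝ (C \ {0}) := by
      rw [mem_extremePoints] at hext
      push Not at hext
      obtain ⟨a, ha, b, hb, hab, hne⟩ := hext h0
      have hab' := hab
      obtain ⟨s, t, hs, ht, hst, h⟩ := hab
      have ha0 : a ≠ 0 := by
        intro ha0
        rw [ha0, smul_zero, zero_add] at h
        exact hne ha0 ((smul_eq_zero.mp h).resolve_left ht.ne')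
      have hb0 : b ≠ 0 := by
        intro hb0
        rw [hb0, smul_zero, add_zero] at h
        exact ha0 ((smul_eq_zero.mp h).resolve_left hs.ne')
      have ha' : a ∈ C \ {0} := ⟨ha, ha0⟩
      have hb' : b ∈ C \ {0} := ⟨hb, hb0⟩
      exact (convex_convexHull ℝ _).openSegment_subset (subset_convexHull ℝ _ ha')
        (subset_convexHull ℝ _ hb') hab'
    have : convexHull ℝ (C \ {0}) = C := by
      refine subset_antisymm (convexHull_min Set.sdiff_subset hC) fun x hx => ?_
      by_cases hx0 : x = 0
      · rw [hx0]; exact hmem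
      · exact subset_convexHull ℝ _ ⟨hx, hx0⟩
    rw [this, Set.sdiff_singleton_eq_self hext]

end Convex

/-! ### The dual of a nef partition -/

/-- The convex-geometric content of a nef partition: the support functions `φ_k` take the values
`0` and `1` at the lattice vectors `R` generating a complete fan, on the cones of which they are
linear, and `φ_k` is the support function of the lattice points `L_k`. -/
structure IsNefDatum {ι : Type} [Fintype ι] {c : ℕ} (φ : Fin c → (ι → ℝ) → ℝ)
    (R : Finset (ι → ℤ)) (L : Fin c → Finset (ι → ℤ)) : Prop where
  pos : 0 < c
  value : ∀ u ∈ R, ∃ k, ∀ l, φ l (realVec u) = if l = k then 1 else 0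
  decomp : ∀ ν, ∃ a : (ι → ℤ) → ℝ, (∀ u, 0 ≤ a u) ∧ ν = ∑ u ∈ R, a u • realVec u ∧
    ∀ k, φ k ν = ∑ u ∈ R, a u * φ k (realVec u)
  le_dotProduct : ∀ k, ∀ l ∈ L k, ∀ ν, -φ k ν ≤ ν ⬝ᵥ realVec l
  attained : ∀ k ν, ∃ l ∈ L k, φ k ν = -(ν ⬝ᵥ realVec l)
  nontrivial : ∀ k, ∃ u ∈ R, φ k (realVec u) = 1

open Classical in
/-- The origin and the elements of the `k`-th block of a nef partition. -/
noncomputable def blockPoints {ι : Type} {c : ℕ} (φ : Fin c → (ι → ℝ) → ℝ)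
    (R : Finset (ι → ℤ)) (k : Fin c) : Finset (ι → ℤ) :=
  insert 0 (R.filter fun u => φ k (realVec u) = 1)

/-- The support functions `φ_k^*` of the dual nef partition. -/
noncomputable def dualSupport {ι : Type} [Fintype ι] {c : ℕ} (φ : Fin c → (ι → ℝ) → ℝ)
    (R : Finset (ι → ℤ)) (k : Fin c) (μ : ι → ℝ) : ℝ :=
  (blockPoints φ R k).sup' ⟨0, by simp [blockPoints]⟩ fun u => -(realVec u ⬝ᵥ μ)

section DualSupport

variable {ι : Type} [Fintype ι] {c : ℕ} (φ : Fin c → (ι → ℝ) → ℝ) (R : Finset (ι → ℤ))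

lemma zero_mem_blockPoints (k : Fin c) : 0 ∈ blockPoints φ R k := by simp [blockPoints]

variable {φ R}

lemma mem_blockPoints_of_value {k : Fin c} {u : ι → ℤ} (hu : u ∈ R)
    (h : φ k (realVec u) = 1) : u ∈ blockPoints φ R k := by
  simp [blockPoints, hu, h]

lemma le_dualSupport {k : Fin c} {u : ι → ℤ} (hu : u ∈ blockPoints φ R k) (μ : ι → ℝ) :
    -(realVec u ⬝ᵥ μ) ≤ dualSupport φ R k μ :=
  Finset.le_sup' (fun u => -(realVec u ⬝ᵥ μ)) hu

lemma dualSupport_nonneg (k : Fin c) (μ : ι → ℝ) : 0 ≤ dualSupport φ R k μ := by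
  simpa using le_dualSupport (zero_mem_blockPoints φ R k) μ

lemma exists_dualSupport_eq (φ : Fin c → (ι → ℝ) → ℝ) (R : Finset (ι → ℤ)) (k : Fin c)
    (μ : ι → ℝ) : ∃ e ∈ blockPoints φ R k, dualSupport φ R k μ = -(realVec e ⬝ᵥ μ) :=
  Finset.exists_mem_eq_sup' _ _

lemma dualSupport_zero (k : Fin c) : dualSupport φ R k 0 = 0 := by
  obtain ⟨e, -, he⟩ := exists_dualSupport_eq φ R k 0
  simpa using he

lemma convexOn_dualSupport (k : Fin c) : ConvexOn ℝ Set.univ (dualSupport φ R k) := by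
  refine ⟨convex_univ, fun x _ y _ s t hs ht _ => ?_⟩
  obtain ⟨e, he, hee⟩ := exists_dualSupport_eq φ R k (s • x + t • y)
  rw [hee, dotProduct_add, dotProduct_smul, dotProduct_smul]
  simp only [smul_eq_mul]
  nlinarith [mul_le_mul_of_nonneg_left (le_dualSupport he x) hs,
    mul_le_mul_of_nonneg_left (le_dualSupport he y) ht]

end DualSupport

namespace IsNefDatum

variable {ι : Type} [Fintype ι] {c : ℕ} {φ : Fin c → (ι → ℝ) → ℝ}
  {R : Finset (ι → ℤ)} {L : Fin c → Finset (ι → ℤ)}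

lemma map_zero (h : IsNefDatum φ R L) (k : Fin c) : φ k 0 = 0 := by
  obtain ⟨l, -, hl⟩ := h.attained k 0
  simpa using hl

lemma value_nonneg (h : IsNefDatum φ R L) {u : ι → ℤ} (hu : u ∈ R) (k : Fin c) :
    0 ≤ φ k (realVec u) := by
  obtain ⟨l, hl⟩ := h.value u hu
  rw [hl]
  split_ifs <;> norm_num

lemma nonneg (h : IsNefDatum φ R L) (k : Fin c) (ν : ι → ℝ) : 0 ≤ φ k ν := by
  obtain ⟨a, ha, -, hk⟩ := h.decomp ν
  rw [hk]
  exact Finset.sum_nonneg fun u hu => mul_nonneg (ha u) (h.value_nonneg hu k)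

lemma add_le (h : IsNefDatum φ R L) (k : Fin c) (x y : ι → ℝ) : φ k (x + y) ≤ φ k x + φ k y := by
  obtain ⟨l, hl, hxy⟩ := h.attained k (x + y)
  rw [hxy, add_dotProduct]
  linarith [h.le_dotProduct k l hl x, h.le_dotProduct k l hl y]

/-- Only an inequality, since the block contains the origin, where every φ_l vanishes. -/
lemma value_blockPoints (h : IsNefDatum φ R L) {k : Fin c} {e : ι → ℤ}
    (he : e ∈ blockPoints φ R k) (l : Fin c) : φ l (realVec e) ≤ if l = k then 1 else 0 := by
  simp only [blockPoints, Finset.mem_insert, Finset.mem_filter] at he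
  rcases he with rfl | ⟨heR, hek⟩
  · rw [realVec_zero, h.map_zero]
    split_ifs <;> norm_num
  · obtain ⟨i, hi⟩ := h.value e heR
    have : k = i := by
      by_contra hne
      rw [hi, if_neg hne] at hek
      norm_num at hek
    rw [hi, this]

/-- For ν = u in `R` the sum reduces to φ*_i(μ) ≥ -⟨u, μ⟩, with i the block of u. The decomposition
of ν extends this, as all φ_k are additive along it. -/
lemma neg_sum_le_dotProduct (h : IsNefDatum φ R L) (ν μ : ι → ℝ) :
    -∑ k, φ k ν * dualSupport φ R k μ ≤ ν ⬝ᵥ μ := by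
  obtain ⟨a, ha, hν, hk⟩ := h.decomp ν
  have h1 : ∀ u ∈ R, -∑ k, φ k (realVec u) * dualSupport φ R k μ ≤ realVec u ⬝ᵥ μ := by
    intro u hu
    obtain ⟨i, hi⟩ := h.value u hu
    have h2 := le_dualSupport (mem_blockPoints_of_value hu ((hi i).trans (if_pos rfl))) μ
    have h3 : ∑ k, φ k (realVec u) * dualSupport φ R k μ = dualSupport φ R i μ := by
      simp [hi]
    rw [h3]
    linarith
  calc -∑ k, φ k ν * dualSupport φ R k μ
      = ∑ u ∈ R, a u * -∑ k, φ k (realVec u) * dualSupport φ R k μ := by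
        simp only [hk, Finset.sum_mul, mul_neg, Finset.mul_sum, Finset.sum_neg_distrib, mul_assoc]
        rw [Finset.sum_comm]
    _ ≤ ∑ u ∈ R, a u * (realVec u ⬝ᵥ μ) :=
        Finset.sum_le_sum fun u hu => mul_le_mul_of_nonneg_left (h1 u hu) (ha u)
    _ = ν ⬝ᵥ μ := by
        conv_rhs => rw [hν, sum_dotProduct]
        simp [smul_dotProduct]

/-- Multiply x_k + 1 - φ_k(ν) ≥ 0 by φ*_k(μ) ≥ 0 and sum. With x = y = 0 this bounds μ on P*; in
general it bounds (μ, y) on the total polyhedron. -/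
lemma neg_sum_dualSupport_le (h : IsNefDatum φ R L) {ν μ : ι → ℝ} {x y : Fin c → ℝ}
    (hx : ∀ k, φ k ν - 1 ≤ x k) :
    -∑ k, dualSupport φ R k μ + ∑ k, (y k - dualSupport φ R k μ) * x k ≤
      ν ⬝ᵥ μ + ∑ k, y k * x k := by
  have h1 := h.neg_sum_le_dotProduct ν μ
  have h2 : 0 ≤ ∑ k, dualSupport φ R k μ * (x k + 1 - φ k ν) := Finset.sum_nonneg fun k _ =>
    mul_nonneg (dualSupport_nonneg k μ) (by linarith [hx k])
  have h3 : ∑ k, dualSupport φ R k μ * (x k + 1 - φ k ν) =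
      (∑ k, y k * x k) + (∑ k, dualSupport φ R k μ) - (∑ k, φ k ν * dualSupport φ R k μ) -
        ∑ k, (y k - dualSupport φ R k μ) * x k := by
    rw [← Finset.sum_add_distrib, ← Finset.sum_sub_distrib, ← Finset.sum_sub_distrib]
    exact Finset.sum_congr rfl fun k _ => by ring
  linarith

/-- Completeness: -μ is a non-negative combination of `R`, so ⟨-μ, μ⟩ ≥ 0. -/
lemma eq_zero_of_nonneg (h : IsNefDatum φ R L) {μ : ι → ℝ}
    (hμ : ∀ u ∈ R, 0 ≤ realVec u ⬝ᵥ μ) : μ = 0 := by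
  obtain ⟨a, ha, hν, -⟩ := h.decomp (-μ)
  have h1 : 0 ≤ (-μ) ⬝ᵥ μ := by
    rw [hν, sum_dotProduct]
    refine Finset.sum_nonneg fun u hu => ?_
    rw [smul_dotProduct]
    exact mul_nonneg (ha u) (hμ u hu)
  have h2 : 0 ≤ μ ⬝ᵥ μ := Finset.sum_nonneg fun i _ => mul_self_nonneg _
  rw [neg_dotProduct] at h1
  exact dotProduct_self_eq_zero.mp (by linarith)

lemma mem_nabla (h : IsNefDatum φ R L) {k : Fin c} {μ : ι → ℝ} :
    μ ∈ nabla (φ k) ↔ ∀ u ∈ R, -φ k (realVec u) ≤ realVec u ⬝ᵥ μ := by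
  refine ⟨fun hμ u _ => hμ _, fun hμ ν => ?_⟩
  obtain ⟨a, ha, hν, hk⟩ := h.decomp ν
  rw [hk]
  conv_rhs => rw [hν, sum_dotProduct]
  rw [← Finset.sum_neg_distrib]
  refine Finset.sum_le_sum fun u hu => ?_
  rw [smul_dotProduct, smul_eq_mul, ← mul_neg]
  exact mul_le_mul_of_nonneg_left (hμ u hu) (ha u)

/-- The inequalities of ∇_k are indexed by `R`; grouping them by blocks, on which φ_k is constant,
turns them into bounds on the φ*_l. -/
lemma mem_nabla_iff_dualSupport (h : IsNefDatum φ R L) {k : Fin c} {μ : ι → ℝ} :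
    μ ∈ nabla (φ k) ↔ ∀ l, dualSupport φ R l μ ≤ if l = k then 1 else 0 := by
  constructor
  · intro hμ l
    obtain ⟨e, he, hel⟩ := exists_dualSupport_eq φ R l μ
    have h1 := h.value_blockPoints he k
    have h2 := hμ (realVec e)
    rw [hel]
    simp only [eq_comm (a := k)] at h1
    linarith
  · intro hμ
    rw [h.mem_nabla]
    intro u hu
    obtain ⟨i, hi⟩ := h.value u hu
    have h1 := le_dualSupport (mem_blockPoints_of_value hu ((hi i).trans (if_pos rfl))) μ
    have h2 := hμ i
    rw [hi]
    simp only [eq_comm (a := k)]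
    linarith

lemma zero_mem_nabla (h : IsNefDatum φ R L) (k : Fin c) : (0 : ι → ℝ) ∈ nabla (φ k) := by
  intro ν
  simpa using h.nonneg k ν

lemma mem_nabla_of_mem (h : IsNefDatum φ R L) {k : Fin c} {l : ι → ℤ} (hl : l ∈ L k) :
    realVec l ∈ nabla (φ k) := fun ν => h.le_dotProduct k l hl ν

lemma nabla_eq (h : IsNefDatum φ R L) (k : Fin c) :
    nabla (φ k) = convexHull ℝ (realVec '' (L k : Set (ι → ℤ))) := by
  refine subset_antisymm (fun μ hμ => ?_) (convexHull_min ?_ (convex_nabla _))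
  · refine mem_convexHull_of_forall_dotProduct ((L k).finite_toSet.image _) fun y => ?_
    obtain ⟨l, hl, hly⟩ := h.attained k y
    refine ⟨realVec l, ⟨l, hl, rfl⟩, ?_⟩
    have := hμ y
    rw [dotProduct_comm, dotProduct_comm μ]
    linarith
  · rintro _ ⟨l, hl, rfl⟩
    exact h.mem_nabla_of_mem hl

open Classical in
lemma dualPolar_eq (h : IsNefDatum φ R L) :
    dualPolar φ = convexHull ℝ (realVec '' ((Finset.univ.biUnion L : Finset (ι → ℤ)) :
      Set (ι → ℤ))) := by
  unfold dualPolar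
  refine subset_antisymm (convexHull_min ?_ (convex_convexHull ℝ _)) (convexHull_mono ?_)
  · refine Set.iUnion_subset fun k => ?_
    rw [h.nabla_eq k]
    refine convexHull_mono (Set.image_mono fun l hl => ?_)
    simpa using ⟨k, hl⟩
  · rintro _ ⟨l, hl, rfl⟩
    simp only [Finset.coe_biUnion, Set.mem_iUnion] at hl
    obtain ⟨k, -, hk⟩ := hl
    exact Set.mem_iUnion.mpr ⟨k, h.mem_nabla_of_mem hk⟩

lemma mem_polar_iff (h : IsNefDatum φ R L) {ξ : ι → ℝ} :
    ξ ∈ polar (dualPolar φ) ↔ ∀ k, φ k ξ ≤ 1 := by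
  unfold dualPolar
  rw [mem_polar_convexHull]
  constructor
  · intro hξ k
    obtain ⟨l, hl, hlk⟩ := h.attained k ξ
    have := hξ (realVec l) (Set.mem_iUnion.mpr ⟨k, h.mem_nabla_of_mem hl⟩)
    rw [dotProduct_comm] at this
    linarith
  · intro hξ v hv
    obtain ⟨k, hk⟩ := Set.mem_iUnion.mp hv
    have := hk ξ
    rw [dotProduct_comm]
    linarith [hξ k]

/-- A point of ∇_j pairs to at least -1 with the j-th block and to at least 0 with the others. -/
lemma sum_mem_polar (h : IsNefDatum φ R L) {e : Fin c → ι → ℤ}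
    (he : ∀ k, e k ∈ blockPoints φ R k) : ∑ k, realVec (e k) ∈ polar (dualPolar φ) := by
  unfold dualPolar
  rw [mem_polar_convexHull]
  intro v hv
  obtain ⟨j, hj⟩ := Set.mem_iUnion.mp hv
  rw [h.mem_nabla_iff_dualSupport] at hj
  have h1 : ∑ k, realVec (e k) ⬝ᵥ v ≥ ∑ k, -(if k = j then (1 : ℝ) else 0) :=
    Finset.sum_le_sum fun k _ => by linarith [hj k, le_dualSupport (he k) v]
  rw [dotProduct_comm, sum_dotProduct]
  simp at h1
  linarith

lemma zero_mem_polar (φ : Fin c → (ι → ℝ) → ℝ) : (0 : ι → ℝ) ∈ polar (dualPolar φ) := by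
  intro v _
  simp

lemma realVec_mem_polar (h : IsNefDatum φ R L) {u : ι → ℤ} (hu : u ∈ R) :
    realVec u ∈ polar (dualPolar φ) := by
  rw [h.mem_polar_iff]
  intro k
  obtain ⟨i, hi⟩ := h.value u hu
  rw [hi]
  split_ifs <;> norm_num

lemma neg_sum_dualSupport_le_of_mem_polar (h : IsNefDatum φ R L) {ξ : ι → ℝ}
    (hξ : ξ ∈ polar (dualPolar φ)) (μ : ι → ℝ) : -∑ k, dualSupport φ R k μ ≤ ξ ⬝ᵥ μ := by
  have := h.neg_sum_dualSupport_le (ν := ξ) (μ := μ) (x := 0) (y := 0)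
    (fun k => by have := h.mem_polar_iff.mp hξ k; simp; linarith)
  simpa using this

-- In each direction y the sum of the elements attaining φ*_k(y) pairs to -∑ φ*_k(y), which is a
-- lower bound for y on P*.
open Classical in
lemma polar_eq (h : IsNefDatum φ R L) : polar (dualPolar φ) = convexHull ℝ (realVec ''
    (((Fintype.piFinset fun k => blockPoints φ R k).image fun e => ∑ k, e k : Finset (ι → ℤ)) :
      Set (ι → ℤ))) := by
  refine subset_antisymm (fun ξ hξ => ?_) (convexHull_min ?_ (convex_polar _))
  · refine mem_convexHull_of_forall_dotProduct ((Finset.finite_toSet _).image _) fun y => ?_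
    choose e he hey using fun k => exists_dualSupport_eq φ R k y
    refine ⟨realVec (∑ k, e k), ⟨_, Finset.mem_coe.mpr (Finset.mem_image_of_mem _
      (Fintype.mem_piFinset.mpr he)), rfl⟩, ?_⟩
    have := h.neg_sum_dualSupport_le_of_mem_polar hξ y
    simp only [hey, Finset.sum_neg_distrib, neg_neg] at this
    rwa [realVec_sum, sum_dotProduct]
  · rintro _ ⟨_, hl, rfl⟩
    obtain ⟨e, he, rfl⟩ := Finset.mem_image.mp (Finset.mem_coe.mp hl)
    rw [realVec_sum]
    exact h.sum_mem_polar (Fintype.mem_piFinset.mp he)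

/-- The neighbourhood is given by c⟨u, μ⟩ > -1 for u in `R`. If μ were outside the hull, some y
would satisfy φ_k(y) < -⟨μ, y⟩ for all k. Summing over k gives ∑ a_u < -c⟨μ, y⟩, where a_u are the
coefficients of y in `R`, while the neighbourhood gives the opposite inequality. -/
lemma zero_mem_interior (h : IsNefDatum φ R L) : (0 : ι → ℝ) ∈ interior (dualPolar φ) := by
  classical
  let U : Set (ι → ℝ) := ⋂ u ∈ R, {μ | -1 < (c : ℝ) * (realVec u ⬝ᵥ μ)}
  have hU : IsOpen U := by
    refine isOpen_biInter_finset fun u _ => isOpen_lt continuous_const ?_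
    unfold dotProduct
    fun_prop
  have hsub : U ⊆ dualPolar φ := by
    intro μ hμ
    have hμ' : ∀ u ∈ R, -1 < (c : ℝ) * (realVec u ⬝ᵥ μ) := fun u hu => by
      simpa using Set.mem_iInter₂.mp hμ u hu
    rw [h.dualPolar_eq]
    refine mem_convexHull_of_forall_dotProduct ((Finset.finite_toSet _).image _) fun y => ?_
    by_contra! hcon
    have hφ : ∀ k, -(μ ⬝ᵥ y) > φ k y := by
      intro k
      obtain ⟨l, hl, hly⟩ := h.attained k y
      have := hcon (realVec l) ⟨l, by simpa using ⟨k, hl⟩, rfl⟩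
      rw [dotProduct_comm (realVec l)] at this
      linarith
    obtain ⟨a, ha, hy, hk⟩ := h.decomp y
    have hsum : ∑ k, φ k y = ∑ u ∈ R, a u := by
      simp only [hk]
      rw [Finset.sum_comm]
      refine Finset.sum_congr rfl fun u hu => ?_
      obtain ⟨i, hi⟩ := h.value u hu
      simp [hi]
    have h1 : -∑ u ∈ R, a u ≤ (c : ℝ) * (μ ⬝ᵥ y) := by
      conv_rhs => rw [dotProduct_comm, hy, sum_dotProduct, Finset.mul_sum]
      rw [← Finset.sum_neg_distrib]
      refine Finset.sum_le_sum fun u hu => ?_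
      rw [smul_dotProduct, smul_eq_mul]
      nlinarith [mul_le_mul_of_nonneg_left (hμ' u hu).le (ha u)]
    have : Nonempty (Fin c) := ⟨⟨0, h.pos⟩⟩
    have h2 : ∑ k, φ k y < ∑ _k : Fin c, -(μ ⬝ᵥ y) :=
      Finset.sum_lt_sum_of_nonempty Finset.univ_nonempty fun k _ => hφ k
    simp only [Finset.sum_const, Finset.card_univ, Fintype.card_fin, nsmul_eq_mul] at h2
    rw [hsum] at h2
    linarith
  refine mem_interior.mpr ⟨U, hsub, hU, ?_⟩
  simp [U]

end IsNefDatum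

/-! ### Reflexivity and the dual nef partition -/

namespace IsNefDatum

variable {ι : Type} [Fintype ι] {c : ℕ} {φ : Fin c → (ι → ℝ) → ℝ}
  {R : Finset (ι → ℤ)} {L : Fin c → Finset (ι → ℤ)}

theorem isReflexive (h : IsNefDatum φ R L) : IsReflexive (dualPolar φ) := by
  classical
  exact ⟨⟨_, h.dualPolar_eq⟩, h.zero_mem_interior, ⟨_, h.polar_eq⟩⟩

lemma dualBlock_eq (h : IsNefDatum φ R L) (k : Fin c) :
    dualBlock φ k = (nabla (φ k)).extremePoints ℝ \ {0} :=
  extremePoints_convexHull_diff_zero (convex_nabla _) (h.zero_mem_nabla k)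

lemma exists_of_mem_dualBlock (h : IsNefDatum φ R L) {k : Fin c} {v : ι → ℝ}
    (hv : v ∈ dualBlock φ k) : ∃ l ∈ L k, v = realVec l ∧ l ≠ 0 := by
  rw [h.dualBlock_eq, h.nabla_eq] at hv
  obtain ⟨l, hl, rfl⟩ := extremePoints_convexHull_subset hv.1
  exact ⟨l, hl, rfl, fun h0 => hv.2 (by simp [h0])⟩

lemma exists_int_dualSupport (φ : Fin c → (ι → ℝ) → ℝ) (R : Finset (ι → ℤ)) (k : Fin c)
    (l : ι → ℤ) : ∃ z : ℤ, dualSupport φ R k (realVec l) = z := by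
  obtain ⟨e, -, he⟩ := exists_dualSupport_eq φ R k (realVec l)
  exact ⟨-(e ⬝ᵥ l), by rw [he, realVec_dotProduct]; simp⟩

/-- The values are integers between 0 and the asserted ones. If φ*_k vanished as well, `l` would be
non-negative on all of `R`, hence 0. -/
lemma dualSupport_of_mem_nabla (h : IsNefDatum φ R L) {k : Fin c} {l : ι → ℤ} (hl : l ≠ 0)
    (hlk : realVec l ∈ nabla (φ k)) (i : Fin c) :
    dualSupport φ R i (realVec l) = if i = k then 1 else 0 := by
  rw [h.mem_nabla_iff_dualSupport] at hlk
  have hne : ∀ j, j ≠ k → dualSupport φ R j (realVec l) = 0 := fun j hj =>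
    le_antisymm (by simpa [hj] using hlk j) (dualSupport_nonneg j _)
  split_ifs with hik
  · subst hik
    obtain ⟨z, hz⟩ := exists_int_dualSupport φ R i l
    have h1 := hlk i
    have h2 := dualSupport_nonneg (φ := φ) (R := R) i (realVec l)
    rw [if_pos rfl, hz] at h1
    rw [hz] at h2 ⊢
    have h1' : z ≤ 1 := by exact_mod_cast h1
    have h2' : 0 ≤ z := by exact_mod_cast h2
    have h3 : z ≠ 0 := by
      rintro rfl
      refine hl (realVec_eq_zero.mp (h.eq_zero_of_nonneg fun u hu => ?_))
      obtain ⟨j, hj⟩ := h.value u hu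
      have h4 := le_dualSupport (mem_blockPoints_of_value hu ((hj j).trans (if_pos rfl)))
        (realVec l)
      have h5 : dualSupport φ R j (realVec l) = 0 := by
        by_cases hji : j = i
        · rw [hji, hz]; simp
        · exact hne j hji
      linarith
    have : z = 1 := by omega
    rw [this]
    norm_num
  · exact hne i hik

lemma dualSupport_of_mem_dualBlock (h : IsNefDatum φ R L) {k : Fin c} {v : ι → ℝ}
    (hv : v ∈ dualBlock φ k) (i : Fin c) : dualSupport φ R i v = if i = k then 1 else 0 := by
  obtain ⟨l, hl, rfl, hl0⟩ := h.exists_of_mem_dualBlock hv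
  exact h.dualSupport_of_mem_nabla hl0 (h.mem_nabla_of_mem hl) i

lemma sum_dualSupport_le_one (h : IsNefDatum φ R L) {μ : ι → ℝ} (hμ : μ ∈ dualPolar φ) :
    ∑ k, dualSupport φ R k μ ≤ 1 := by
  choose e he hek using fun k => exists_dualSupport_eq φ R k μ
  have := h.sum_mem_polar he μ hμ
  rw [dotProduct_comm, sum_dotProduct] at this
  simp only [hek, Finset.sum_neg_distrib]
  linarith

/-- On the hull ∑ φ*_l ≤ 1, so its points with φ*_k = 1 lie in ∇_k. At a non-zero vertex of ∇_k the
convex function φ*_k has its maximum 1, so a segment of the hull through the vertex has both ends in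
∇_k. Conversely a vertex of the hull lies in some ∇_k and is not the interior point 0. -/
lemma iUnion_dualBlock (h : IsNefDatum φ R L) :
    ⋃ k, dualBlock φ k = (dualPolar φ).extremePoints ℝ := by
  classical
  have hsub : ∀ k, nabla (φ k) ⊆ dualPolar φ := fun k =>
    (Set.subset_iUnion (fun k => nabla (φ k)) k).trans (subset_convexHull ℝ _)
  refine subset_antisymm (Set.iUnion_subset fun k v hv => ?_) fun v hv => ?_
  · have hv1 := h.dualSupport_of_mem_dualBlock hv
    rw [h.dualBlock_eq] at hv
    refine mem_extremePoints.mpr ⟨hsub k (extremePoints_subset hv.1), fun a ha b hb hab => ?_⟩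
    have hab' := hab
    obtain ⟨s, t, hs, ht, hst, hv'⟩ := hab
    have hconv := (convexOn_dualSupport (φ := φ) (R := R) k).2 (Set.mem_univ a) (Set.mem_univ b)
      hs.le ht.le hst
    rw [hv', hv1 k, if_pos rfl, smul_eq_mul, smul_eq_mul] at hconv
    have hle : ∀ w ∈ dualPolar φ, dualSupport φ R k w ≤ 1 := fun w hw =>
      (Finset.single_le_sum (f := fun l => dualSupport φ R l w)
        (fun l _ => dualSupport_nonneg l w) (Finset.mem_univ k)).trans (h.sum_dualSupport_le_one hw)
    have hnabla : ∀ w ∈ dualPolar φ, dualSupport φ R k w = 1 → w ∈ nabla (φ k) := by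
      intro w hw hwk
      rw [h.mem_nabla_iff_dualSupport]
      intro l
      have h1 := h.sum_dualSupport_le_one hw
      rw [← Finset.add_sum_erase _ _ (Finset.mem_univ k), hwk] at h1
      split_ifs with hlk
      · rw [hlk, hwk]
      · have h2 := Finset.single_le_sum (f := fun l => dualSupport φ R l w)
          (fun l _ => dualSupport_nonneg l w) (Finset.mem_erase.mpr ⟨hlk, Finset.mem_univ l⟩)
        linarith
    have ha1 := hle a ha
    have hb1 := hle b hb
    refine (mem_extremePoints.mp hv.1).2 a (hnabla a ha ?_) b (hnabla b hb ?_) hab'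
    · nlinarith
    · nlinarith
  · have hv0 : v ≠ 0 := by
      rintro rfl
      obtain ⟨k⟩ : Nonempty (Fin c) := ⟨⟨0, h.pos⟩⟩
      obtain ⟨u, hu, huk⟩ := h.nontrivial k
      have hu0 : realVec u ≠ 0 := fun h0 => by
        rw [h0, h.map_zero] at huk
        norm_num at huk
      have hcont : Filter.Tendsto (fun ε : ℝ => ε • realVec u) (nhdsWithin 0 (Set.Ioi 0))
          (nhds 0) := by
        have : Filter.Tendsto (fun ε : ℝ => ε • realVec u) (nhds 0) (nhds ((0 : ℝ) • realVec u)) :=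
          (continuous_id.smul continuous_const).tendsto 0
        rw [zero_smul] at this
        exact this.mono_left nhdsWithin_le_nhds
      have hnhds := mem_interior_iff_mem_nhds.mp h.zero_mem_interior
      have h1 := hcont.eventually hnhds
      have h2 := (by simpa using hcont.neg :
        Filter.Tendsto (fun ε : ℝ => -(ε • realVec u)) (nhdsWithin 0 (Set.Ioi 0))
          (nhds 0)).eventually hnhds
      obtain ⟨ε, ⟨hε1, hε2⟩, hε⟩ := ((h1.and h2).and self_mem_nhdsWithin).exists
      have := ((mem_extremePoints.mp hv).2 _ hε1 _ hε2
        ⟨1 / 2, 1 / 2, by norm_num, by norm_num, by norm_num, by simp⟩).1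
      exact (smul_ne_zero (Set.mem_Ioi.mp hε).ne' hu0) this
    obtain ⟨k, hk⟩ := Set.mem_iUnion.mp (extremePoints_convexHull_subset hv)
    refine Set.mem_iUnion.mpr ⟨k, ?_⟩
    rw [h.dualBlock_eq]
    exact ⟨inter_extremePoints_subset_extremePoints_of_subset (hsub k) ⟨hk, hv⟩, hv0⟩

/-- Otherwise ∇_k ⊆ {0} by Krein–Milman, contradicting φ_k(u) = 1 for some u in `R`. -/
lemma dualBlock_nonempty (h : IsNefDatum φ R L) (k : Fin c) : (dualBlock φ k).Nonempty := by
  by_contra hcon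
  rw [h.dualBlock_eq, Set.not_nonempty_iff_eq_empty, Set.sdiff_eq_empty] at hcon
  have hcompact : IsCompact (nabla (φ k)) := by
    rw [h.nabla_eq]
    exact ((L k).finite_toSet.image _).isCompact_convexHull ℝ
  have h1 := closure_convexHull_extremePoints hcompact (convex_nabla (φ k))
  have h2 : nabla (φ k) ⊆ {0} := by
    rw [← h1]
    exact (closure_mono (convexHull_mono hcon)).trans (by simp)
  obtain ⟨u, hu, huk⟩ := h.nontrivial k
  obtain ⟨l, hl, hul⟩ := h.attained k (realVec u)
  have h3 : realVec l = 0 := h2 (h.mem_nabla_of_mem hl)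
  rw [huk, h3] at hul
  norm_num at hul

/-- Choose in each block an element attaining φ*_k at the functional that cuts out the face. Their
sum lies on the face, so it minimizes every μ of the cone on P*; a sum of one element per block is
minimal only if every summand is minimal in its block. -/
lemma exists_dualSupport_eq_on_cone (h : IsNefDatum φ R L) {σ : Set (ι → ℝ)}
    (hσ : σ ∈ normalFan (polar (dualPolar φ))) :
    ∃ m : Fin c → ι → ℤ, ∀ k, ∀ μ ∈ σ, dualSupport φ R k μ = realVec (m k) ⬝ᵥ μ := by
  obtain ⟨F, ⟨⟨x₀, hx₀⟩, ν₀, hF⟩, rfl⟩ := hσ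
  choose e he hek using fun k => exists_dualSupport_eq φ R k ν₀
  have hx : ∑ k, realVec (e k) ∈ F := by
    rw [hF]
    refine ⟨h.sum_mem_polar he, fun y hy => ?_⟩
    have := h.neg_sum_dualSupport_le_of_mem_polar hy ν₀
    simp only [hek, Finset.sum_neg_distrib, neg_neg] at this
    rwa [dotProduct_comm, sum_dotProduct, dotProduct_comm ν₀]
  refine ⟨fun k => -e k, fun k μ hμ => ?_⟩
  choose e' he' hek' using fun k => exists_dualSupport_eq φ R k μ
  have h1 := hμ _ hx _ (h.sum_mem_polar he')
  rw [dotProduct_comm, sum_dotProduct, dotProduct_comm, sum_dotProduct] at h1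
  have h2 : ∀ l ∈ Finset.univ, realVec (e' l) ⬝ᵥ μ ≤ realVec (e l) ⬝ᵥ μ := fun l _ => by
    have := le_dualSupport (he l) μ
    rw [hek'] at this
    linarith
  have h3 := (Finset.sum_eq_sum_iff_of_le h2).mp (le_antisymm (Finset.sum_le_sum h2) h1) k
    (Finset.mem_univ k)
  rw [hek', h3, realVec_neg, neg_dotProduct]

theorem isNefPartition (h : IsNefDatum φ R L) : IsNefPartition (dualPolar φ) (dualBlock φ) := by
  refine ⟨h.iUnion_dualBlock, h.dualBlock_nonempty, fun i j hij => ?_, dualSupport φ R,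
    fun i => ⟨convexOn_dualSupport i, fun σ hσ => ?_⟩,
    fun i j e he => h.dualSupport_of_mem_dualBlock he i⟩
  · refine Set.disjoint_left.mpr fun v hvi hvj => ?_
    have h1 := h.dualSupport_of_mem_dualBlock hvi i
    have h2 := h.dualSupport_of_mem_dualBlock hvj i
    rw [if_pos rfl] at h1
    rw [if_neg hij, h1] at h2
    norm_num at h2
  · obtain ⟨m, hm⟩ := h.exists_dualSupport_eq_on_cone hσ
    exact ⟨m i, hm i⟩

/-! ### The fan of the dual polytope -/

lemma exists_dualPolar_eq_convexHull (h : IsNefDatum φ R L) :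
    ∃ V : Finset (ι → ℤ), realVec '' (V : Set (ι → ℤ)) = ⋃ k, dualBlock φ k ∧
      dualPolar φ = convexHull ℝ (realVec '' (V : Set (ι → ℤ))) := by
  classical
  have hsub : ⋃ k, dualBlock φ k ⊆ realVec '' ((Finset.univ.biUnion L : Finset (ι → ℤ)) :
      Set (ι → ℤ)) := by
    refine Set.iUnion_subset fun k v hv => ?_
    obtain ⟨l, hl, rfl, -⟩ := h.exists_of_mem_dualBlock hv
    exact ⟨l, by simpa using ⟨k, hl⟩, rfl⟩
  obtain ⟨V, -, hV⟩ := (Set.subset_image_iff).mp hsub |>.imp fun _ h => h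
  have hfin : V.Finite := Set.Finite.of_finite_image (hV ▸ ((Finset.finite_toSet _).image _).subset
    hsub) realVec_injective.injOn
  refine ⟨hfin.toFinset, by simpa using hV, ?_⟩
  rw [hfin.coe_toFinset, hV, h.iUnion_dualBlock]
  have hcompact : IsCompact (dualPolar φ) := by
    rw [h.dualPolar_eq]
    exact ((Finset.finite_toSet _).image _).isCompact_convexHull ℝ
  have hconv : Convex ℝ (dualPolar φ) := convex_convexHull ℝ _
  rw [← closure_convexHull_extremePoints hcompact hconv]
  have hf : ((dualPolar φ).extremePoints ℝ).Finite := by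
    rw [← h.iUnion_dualBlock]
    exact ((Finset.finite_toSet _).image _).subset hsub
  rw [(hf.isClosed_convexHull ℝ).closure_eq]
  congr 1
  rw [← (hf.isClosed_convexHull ℝ).closure_eq, closure_convexHull_extremePoints hcompact hconv]

lemma polar_convexHull_eq_polyhedron (V : Finset (ι → ℤ)) :
    polar (convexHull ℝ (realVec '' (V : Set (ι → ℤ)))) =
      polyhedron (fun v : V => v.1) fun _ => 1 := by
  ext ξ
  rw [mem_polar_convexHull]
  simp [polyhedron]

lemma exists_generators_of_mem_normalFan (h : IsNefDatum φ R L) {σ : Set (ι → ℝ)}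
    (hσ : σ ∈ normalFan (polar (dualPolar φ))) :
    ∃ G : Finset (ι → ℤ), (∀ g ∈ G, ∃ k, realVec g ∈ dualBlock φ k) ∧ σ = coneHull G := by
  obtain ⟨V, hV, hVφ⟩ := h.exists_dualPolar_eq_convexHull
  obtain ⟨F, hF, rfl⟩ := hσ
  rw [hVφ, polar_convexHull_eq_polyhedron] at hF ⊢
  obtain ⟨G, hG, hGF⟩ := normalCone_polyhedron _ _ hF
  refine ⟨G, fun g hg => ?_, hGF⟩
  obtain ⟨v, rfl⟩ := hG g hg
  exact Set.mem_iUnion.mp (hV ▸ Set.mem_image_of_mem realVec v.2)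

/-- Strong convexity: if x and -x lie in the cone, x is constant on P*, which contains 0 and `R`, so
x vanishes. -/
lemma isGeneratedByRays (h : IsNefDatum φ R L) {σ : Set (ι → ℝ)}
    (hσ : σ ∈ normalFan (polar (dualPolar φ))) : IsGeneratedByRays σ := by
  obtain ⟨G, -, hG⟩ := h.exists_generators_of_mem_normalFan hσ
  refine IsRationalCone.isGeneratedByRays ⟨G, hG⟩ fun x hx hx' => ?_
  obtain ⟨F, ⟨⟨z, hz⟩, ν₀, hF⟩, rfl⟩ := hσ
  have hz' : z ∈ polar (dualPolar φ) := by rw [hF] at hz; exact hz.1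
  have key : ∀ y ∈ polar (dualPolar φ), x ⬝ᵥ y = x ⬝ᵥ z := fun y hy => by
    have h1 := hx z hz y hy
    have h2 := hx' z hz y hy
    rw [neg_dotProduct, neg_dotProduct] at h2
    linarith
  refine h.eq_zero_of_nonneg fun u hu => ?_
  rw [dotProduct_comm, key _ (h.realVec_mem_polar hu), ← key _ (zero_mem_polar φ)]
  simp

/-- The ray is spanned by a block element f = a • u. Since φ*_k(f) = 1 is a times an integer, a = 1.
-/
lemma mem_dualBlock_of_mem_rays (h : IsNefDatum φ R L) {u : ι → ℤ}
    (hu : u ∈ (dualVariety φ).rays) : ∃ k, realVec u ∈ dualBlock φ k := by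
  obtain ⟨hprim, (σ : (fanVariety _).Index), hray⟩ := hu
  obtain ⟨G, hG, hσ⟩ := h.exists_generators_of_mem_normalFan σ.2
  have hray' : IsRayOf (latticeDual (coneHull G)) u := hσ ▸ hray
  obtain ⟨f, hf, a, ha, hfa⟩ := hray'.exists_generator hprim
  obtain ⟨k, hk⟩ := hG f hf
  have h1 := h.dualSupport_of_mem_dualBlock hk k
  obtain ⟨e, -, he⟩ := exists_dualSupport_eq φ R k (realVec f)
  rw [if_pos rfl] at h1
  rw [h1, realVec_dotProduct, hfa, dotProduct_smul, smul_eq_mul] at he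
  have h2 : a * (-(e ⬝ᵥ u)) = 1 := by
    have : (1 : ℤ) = -(a * (e ⬝ᵥ u)) := by exact_mod_cast he
    linarith
  have h3 : a = 1 := by
    rcases Int.isUnit_iff.mp (IsUnit.of_mul_eq_one _ h2) with h | h
    · exact h
    · omega
  rw [h3, one_smul] at hfa
  exact ⟨k, hfa ▸ hk⟩

lemma dualDivisor_eq (h : IsNefDatum φ R L) (k : Fin c) (u : (dualVariety φ).rays) :
    (dualDivisor φ k u : ℝ) = dualSupport φ R k (realVec u.1) := by
  obtain ⟨j, hj⟩ := h.mem_dualBlock_of_mem_rays u.2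
  rw [h.dualSupport_of_mem_dualBlock hj]
  unfold dualDivisor
  by_cases hkj : k = j
  · subst hkj
    simp [hj]
  · have : realVec u.1 ∉ dualBlock φ k := fun hk =>
      Set.disjoint_left.mp (h.isNefPartition.2.2.1 hkj) hk hj
    simp [this, hkj]

end IsNefDatum

/-! ### The polyhedron of the dual model -/

section Total

variable {ι : Type} [Fintype ι] {c : ℕ}

/-- The polyhedral set `{(ν, x) | x_k ≥ max(0, φ_k(ν) - 1)}`. -/
def totalPolyhedron (φ : Fin c → (ι → ℝ) → ℝ) : Set (ι ⊕ Fin c → ℝ) :=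
  {q | ∀ k, 0 ≤ q (Sum.inr k) ∧ φ k (q ∘ Sum.inl) - 1 ≤ q (Sum.inr k)}

/-- The epigraph of the functions `ψ_k` over `σ`. -/
def epigraph (ψ : Fin c → (ι → ℝ) → ℝ) (σ : Set (ι → ℝ)) : Set (ι ⊕ Fin c → ℝ) :=
  {w | w ∘ Sum.inl ∈ σ ∧ ∀ k, ψ k (w ∘ Sum.inl) ≤ w (Sum.inr k)}

/-- The face of `P` on which `μ` attains its minimum. -/
def minFace {κ : Type} [Fintype κ] (P : Set (κ → ℝ)) (μ : κ → ℝ) : Set (κ → ℝ) :=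
  {x | x ∈ P ∧ ∀ y ∈ P, μ ⬝ᵥ x ≤ μ ⬝ᵥ y}

lemma sum_dotProduct_eq (w q : ι ⊕ Fin c → ℝ) :
    w ⬝ᵥ q = (w ∘ Sum.inl) ⬝ᵥ (q ∘ Sum.inl) + ∑ k, w (Sum.inr k) * q (Sum.inr k) := by
  simp [dotProduct]

lemma normalCone_minFace_subset {κ : Type} [Fintype κ] {P F : Set (κ → ℝ)} (hF : F ⊆ P)
    {μ : κ → ℝ} (hμ : μ ∈ normalCone P F) : normalCone P (minFace P μ) ⊆ normalCone P F :=
  fun _ hν x hx => hν x ⟨hF hx, hμ x hx⟩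

lemma IsFace.subset {κ : Type} [Fintype κ] {P F : Set (κ → ℝ)} (hF : IsFace P F) : F ⊆ P := by
  obtain ⟨-, ν, rfl⟩ := hF
  exact fun x hx => hx.1

lemma zero_mem_normalCone {κ : Type} [Fintype κ] (P F : Set (κ → ℝ)) : 0 ∈ normalCone P F :=
  fun x _ y _ => by simp

/-- Changing the lift of the class translates the polyhedron; the fan is thus independent of the
lift. -/
lemma normalFan_translate {κ : Type} [Fintype κ] (P : Set (κ → ℝ)) (t : κ → ℝ) :
    normalFan {x | x + t ∈ P} = normalFan P := by
  have key : ∀ (P : Set (κ → ℝ)) (t : κ → ℝ), normalFan P ⊆ normalFan {x | x + t ∈ P} := by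
    rintro P t σ ⟨F, ⟨⟨z, hz⟩, ν, hF⟩, rfl⟩
    refine ⟨{x | x + t ∈ F}, ⟨⟨z - t, by simpa using hz⟩, ν, ?_⟩, ?_⟩
    · ext x
      simp only [hF, Set.mem_ofPred_eq]
      refine and_congr_right fun _ => ⟨fun h y hy => ?_, fun h y hy => ?_⟩
      · have := h _ hy
        rwa [dotProduct_add, dotProduct_add, add_le_add_iff_right] at this
      · have := h (y - t) (by simpa using hy)
        rw [dotProduct_sub] at this
        rw [dotProduct_add]
        linarith
    · ext μ
      constructor
      · intro hμ x hx y hy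
        have := hμ _ hx _ hy
        rwa [dotProduct_add, dotProduct_add, add_le_add_iff_right] at this
      · intro hμ x hx y hy
        have := hμ (x - t) (by simpa using hx) (y - t) (by simpa using hy)
        rwa [dotProduct_sub, dotProduct_sub, sub_le_sub_iff_right] at this
  refine subset_antisymm ?_ (key P t)
  have := key {x | x + t ∈ P} (-t)
  simpa using this

end Total

namespace IsNefDatum

variable {ι : Type} [Fintype ι] {c : ℕ} {φ : Fin c → (ι → ℝ) → ℝ}
  {R : Finset (ι → ℤ)} {L : Fin c → Finset (ι → ℤ)}

lemma sumElim_zero_mem (h : IsNefDatum φ R L) {ξ : ι → ℝ} (hξ : ξ ∈ polar (dualPolar φ)) :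
    Sum.elim ξ 0 ∈ totalPolyhedron φ := fun k => by
  have := h.mem_polar_iff.mp hξ k
  simpa using this

lemma mem_polar_of_sumElim_mem (h : IsNefDatum φ R L) {ξ : ι → ℝ}
    (hξ : Sum.elim ξ 0 ∈ totalPolyhedron φ) : ξ ∈ polar (dualPolar φ) :=
  h.mem_polar_iff.mpr fun k => by
    have := (hξ k).2
    simpa using this

lemma minFace_mem_normalFan (h : IsNefDatum φ R L) (μ : ι → ℝ) :
    normalCone (polar (dualPolar φ)) (minFace (polar (dualPolar φ)) μ) ∈
      normalFan (polar (dualPolar φ)) := by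
  choose e he hek using fun k => exists_dualSupport_eq φ R k μ
  refine ⟨minFace (polar (dualPolar φ)) μ,
    ⟨⟨∑ k, realVec (e k), h.sum_mem_polar he, fun y hy => ?_⟩, μ, rfl⟩, rfl⟩
  have := h.neg_sum_dualSupport_le_of_mem_polar hy μ
  simp only [hek, Finset.sum_neg_distrib, neg_neg] at this
  rwa [dotProduct_comm, sum_dotProduct, dotProduct_comm μ]

lemma dotProduct_of_mem_minFace (h : IsNefDatum φ R L) {μ x : ι → ℝ}
    (hx : x ∈ minFace (polar (dualPolar φ)) μ) : μ ⬝ᵥ x = -∑ k, dualSupport φ R k μ := by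
  choose e he hek using fun k => exists_dualSupport_eq φ R k μ
  refine le_antisymm ?_ ?_
  · have := hx.2 _ (h.sum_mem_polar he)
    rw [dotProduct_comm μ (∑ k, _), sum_dotProduct] at this
    simpa [hek] using this
  · rw [dotProduct_comm]
    exact h.neg_sum_dualSupport_le_of_mem_polar hx.1 μ

lemma le_dotProduct_total (h : IsNefDatum φ R L) {w q : ι ⊕ Fin c → ℝ}
    (hq : q ∈ totalPolyhedron φ) :
    -∑ k, dualSupport φ R k (w ∘ Sum.inl) +
      ∑ k, (w (Sum.inr k) - dualSupport φ R k (w ∘ Sum.inl)) * q (Sum.inr k) ≤ w ⬝ᵥ q := by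
  rw [sum_dotProduct_eq, dotProduct_comm]
  exact h.neg_sum_dualSupport_le (y := fun k => w (Sum.inr k)) fun k => (hq k).2

/-- If `e` attains φ*_k, the vector with base part `e` and fibre part the k-th unit vector is a
recession direction, by subadditivity of the φ_l. A functional with a minimum is non-negative on it.
-/
lemma dualSupport_le_of_minimum (h : IsNefDatum φ R L) {w q : ι ⊕ Fin c → ℝ}
    (hq : q ∈ totalPolyhedron φ) (hw : ∀ y ∈ totalPolyhedron φ, w ⬝ᵥ q ≤ w ⬝ᵥ y) (k : Fin c) :
    dualSupport φ R k (w ∘ Sum.inl) ≤ w (Sum.inr k) := by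
  obtain ⟨e, he, hek⟩ := exists_dualSupport_eq φ R k (w ∘ Sum.inl)
  have hmem : q + Sum.elim (realVec e) (Pi.single k 1) ∈ totalPolyhedron φ := by
    intro l
    have h1 := h.value_blockPoints he l
    have h2 := h.add_le l (q ∘ Sum.inl) (realVec e)
    have h3 : (q + Sum.elim (realVec e) (Pi.single k 1)) ∘ Sum.inl =
        q ∘ Sum.inl + realVec e := by funext i; simp
    have h4 := hq l
    simp only [h3, Pi.add_apply, Sum.elim_inr, Pi.single_apply]
    split_ifs at h1 ⊢ <;> constructor <;> linarith
  have h1 := hw _ hmem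
  rw [dotProduct_add, sum_dotProduct_eq w (Sum.elim _ _)] at h1
  have h2 : ∑ l, w (Sum.inr l) * (Sum.elim (realVec e) (Pi.single k 1) : ι ⊕ Fin c → ℝ)
      (Sum.inr l) = w (Sum.inr k) := by
    simp [Pi.single_apply]
  rw [h2, Sum.elim_comp_inl, dotProduct_comm (w ∘ Sum.inl)] at h1
  linarith

/-- The cones of the fan of the total space over the cones of the base. -/
theorem epigraph_mem_normalFan (h : IsNefDatum φ R L) {σ : Set (ι → ℝ)}
    (hσ : σ ∈ normalFan (polar (dualPolar φ))) :
    epigraph (dualSupport φ R) σ ∈ normalFan (totalPolyhedron φ) := by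
  obtain ⟨F, ⟨⟨z, hz⟩, ν₀, hF⟩, rfl⟩ := hσ
  have hFP : F ⊆ polar (dualPolar φ) := by rw [hF]; exact fun x hx => hx.1
  have hFmin : ∀ x ∈ F, x ∈ minFace (polar (dualPolar φ)) ν₀ := fun x hx => by rwa [hF] at hx
  -- The summand 1 places `w₀` strictly above the graph of φ*, so its minimum forces x = 0 and the
  -- face is F × {0}.
  let w₀ : ι ⊕ Fin c → ℝ := Sum.elim ν₀ fun k => dualSupport φ R k ν₀ + 1
  have hw₀ : ∀ x : ι → ℝ, w₀ ⬝ᵥ Sum.elim x 0 = ν₀ ⬝ᵥ x := fun x => by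
    rw [sum_dotProduct_eq]
    simp [w₀]
  have hw₀' : ∀ q ∈ totalPolyhedron φ,
      -∑ k, dualSupport φ R k ν₀ + ∑ k, q (Sum.inr k) ≤ w₀ ⬝ᵥ q := fun q hq => by
    simpa [w₀] using h.le_dotProduct_total (w := w₀) hq
  refine ⟨{q | ∃ x ∈ F, q = Sum.elim x 0}, ⟨⟨_, z, hz, rfl⟩, w₀, ?_⟩, ?_⟩
  · ext q
    constructor
    · rintro ⟨x, hx, rfl⟩
      refine ⟨h.sumElim_zero_mem (hFP hx), fun y hy => ?_⟩
      have h1 := hw₀' y hy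
      have h2 : 0 ≤ ∑ k, y (Sum.inr k) := Finset.sum_nonneg fun k _ => (hy k).1
      rw [hw₀, h.dotProduct_of_mem_minFace (hFmin x hx)]
      linarith
    · rintro ⟨hq, hmin⟩
      have h1 := hmin _ (h.sumElim_zero_mem (hFP hz))
      rw [hw₀, h.dotProduct_of_mem_minFace (hFmin z hz)] at h1
      have h2 := hw₀' q hq
      have h3 : ∀ k ∈ Finset.univ, 0 ≤ q (Sum.inr k) := fun k _ => (hq k).1
      have h4 := (Finset.sum_eq_zero_iff_of_nonneg h3).mp
        (le_antisymm (by linarith) (Finset.sum_nonneg h3))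
      have hq' : q = Sum.elim (q ∘ Sum.inl) 0 := by
        funext i
        rcases i with i | k
        · rfl
        · exact h4 k (Finset.mem_univ k)
      refine ⟨q ∘ Sum.inl, ?_, hq'⟩
      rw [hF]
      refine ⟨h.mem_polar_of_sumElim_mem (hq' ▸ hq), fun y hy => ?_⟩
      have h5 := hmin _ (h.sumElim_zero_mem hy)
      rw [hq', hw₀, hw₀] at h5
      exact h5
  · ext w
    constructor
    · rintro ⟨hwσ, hwψ⟩ _ ⟨x, hx, rfl⟩ y hy
      have h1 := h.le_dotProduct_total (w := w) hy
      have h2 : 0 ≤ ∑ k, (w (Sum.inr k) - dualSupport φ R k (w ∘ Sum.inl)) * y (Sum.inr k) :=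
        Finset.sum_nonneg fun k _ => mul_nonneg (sub_nonneg.mpr (hwψ k)) (hy k).1
      have h3 : w ⬝ᵥ Sum.elim x 0 = (w ∘ Sum.inl) ⬝ᵥ x := by
        rw [sum_dotProduct_eq]
        simp
      rw [h3, h.dotProduct_of_mem_minFace ⟨hFP hx, hwσ x hx⟩]
      linarith
    · intro hw
      refine ⟨fun x hx y hy => ?_, h.dualSupport_le_of_minimum (h.sumElim_zero_mem (hFP hz))
        (hw _ ⟨z, hz, rfl⟩)⟩
      have := hw _ ⟨x, hx, rfl⟩ _ (h.sumElim_zero_mem hy)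
      rw [sum_dotProduct_eq, sum_dotProduct_eq] at this
      simpa using this

/-- Every cone of the normal fan of the total polyhedron lies in a smallest cone over the base. -/
theorem exists_base_cone (h : IsNefDatum φ R L) {s : Set (ι ⊕ Fin c → ℝ)}
    (hs : s ∈ normalFan (totalPolyhedron φ)) :
    ∃ τ ∈ normalFan (polar (dualPolar φ)), ∀ σ ∈ normalFan (polar (dualPolar φ)),
      τ ⊆ σ ↔ s ⊆ epigraph (dualSupport φ R) σ := by
  obtain ⟨F, hFf, rfl⟩ := hs
  have hFQ := hFf.subset
  obtain ⟨⟨q, hq⟩, w₀, hF⟩ := hFf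
  have hw₀ : w₀ ∈ normalCone (totalPolyhedron φ) F := fun x hx y hy => by
    rw [hF] at hx
    exact hx.2 y hy
  have hle : ∀ w ∈ normalCone (totalPolyhedron φ) F, ∀ k,
      dualSupport φ R k (w ∘ Sum.inl) ≤ w (Sum.inr k) := fun w hw =>
    h.dualSupport_le_of_minimum (hFQ hq) (hw q hq)
  have hsub : normalCone (totalPolyhedron φ) F ⊆ epigraph (dualSupport φ R)
      (normalCone (polar (dualPolar φ)) (minFace (polar (dualPolar φ)) (w₀ ∘ Sum.inl))) := by
    refine fun w hw => ⟨fun x hx y hy => ?_, hle w hw⟩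
    have hxF : Sum.elim x 0 ∈ F := by
      rw [hF]
      refine ⟨h.sumElim_zero_mem hx.1, fun y hy => ?_⟩
      have h1 := h.le_dotProduct_total (w := w₀) hy
      have h2 : 0 ≤ ∑ k, (w₀ (Sum.inr k) - dualSupport φ R k (w₀ ∘ Sum.inl)) * y (Sum.inr k) :=
        Finset.sum_nonneg fun k _ => mul_nonneg (sub_nonneg.mpr (hle w₀ hw₀ k)) (hy k).1
      have h3 : w₀ ⬝ᵥ Sum.elim x 0 = (w₀ ∘ Sum.inl) ⬝ᵥ x := by
        rw [sum_dotProduct_eq]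
        simp
      rw [h3, h.dotProduct_of_mem_minFace hx]
      linarith
    have := hw _ hxF _ (h.sumElim_zero_mem hy)
    rw [sum_dotProduct_eq, sum_dotProduct_eq] at this
    simpa using this
  -- The base cone belongs to the face of P* minimizing the base part of `w₀`; it is contained in
  -- every normal cone containing that base part.
  refine ⟨_, h.minFace_mem_normalFan (w₀ ∘ Sum.inl), fun σ hσ => ⟨fun hσ' => ?_, fun hσ' => ?_⟩⟩
  · exact hsub.trans fun w hw => ⟨hσ' hw.1, hw.2⟩
  · obtain ⟨E, hE, rfl⟩ := hσ
    exact normalCone_minFace_subset hE.subset (hσ' hw₀).1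

/-- Where the φ*_k are linear, the epigraph is a sheared product of the cone with an orthant, so it
suffices to test the graph of φ* and the fibre unit vectors. -/
lemma mem_tot_dualVariety_monoid (h : IsNefDatum φ R L) (j : (dualVariety φ).Index)
    {x : ι ⊕ Fin c → ℤ} :
    x ∈ ((dualVariety φ).tot (dualDivisor φ)).monoid j ↔
      ∀ w ∈ epigraph (dualSupport φ R) j.1, 0 ≤ w ⬝ᵥ realVec x := by
  classical
  obtain ⟨m, hm⟩ := h.exists_dualSupport_eq_on_cone j.2
  have hD : ∀ k, ∀ u : (dualVariety φ).rays, realVec u.1 ∈ j.1 →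
      dualDivisor φ k u = m k ⬝ᵥ u.1 := fun k u hu => by
    have := h.dualDivisor_eq k u
    rw [hm k _ hu, realVec_dotProduct] at this
    exact_mod_cast this
  refine (mem_tot_monoid (h.isGeneratedByRays j.2) hD).trans ?_
  have hdot : ∀ μ ∈ j.1, μ ⬝ᵥ realVec ((fun i => x (Sum.inl i)) + ∑ k, x (Sum.inr k) • m k) =
      μ ⬝ᵥ (realVec x ∘ Sum.inl) + ∑ k, dualSupport φ R k μ * realVec x (Sum.inr k) := by
    intro μ hμ
    rw [realVec_add, realVec_sum, dotProduct_add, dotProduct_sum]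
    congr 1
    refine Finset.sum_congr rfl fun k _ => ?_
    rw [realVec_smul, dotProduct_smul, hm k μ hμ, dotProduct_comm, smul_eq_mul, mul_comm]
    rfl
  constructor
  · rintro ⟨hx, hxm⟩ w ⟨hw, hwk⟩
    have h1 := hxm _ hw
    rw [hdot _ hw] at h1
    rw [sum_dotProduct_eq]
    refine h1.trans (add_le_add_right (Finset.sum_le_sum fun k _ => ?_) _)
    exact mul_le_mul_of_nonneg_right (hwk k) (by simpa [realVec] using hx k)
  · intro hw
    refine ⟨fun k => ?_, fun μ hμ => ?_⟩
    · have h0 : (0 : ι → ℝ) ∈ j.1 := by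
        obtain ⟨F, -, hF⟩ := j.2
        rw [hF]
        exact zero_mem_normalCone _ _
      have := hw (Sum.elim 0 (Pi.single k 1)) ⟨h0, fun l => by
        rw [Sum.elim_comp_inl, dualSupport_zero, Sum.elim_inr, Pi.single_apply]
        split_ifs <;> norm_num⟩
      rw [sum_dotProduct_eq, Sum.elim_comp_inl, zero_dotProduct, zero_add] at this
      simpa [realVec, Pi.single_apply] using this
    · have := hw (Sum.elim μ fun k => dualSupport φ R k μ) ⟨hμ, fun k => le_rfl⟩
      rw [sum_dotProduct_eq] at this
      rw [hdot μ hμ]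
      simpa using this

/-- The toric variety of the total polyhedron is the total space over the dual variety. -/
theorem sameToricVariety (h : IsNefDatum φ R L) :
    (fanVariety (normalFan (totalPolyhedron φ))).SameToricVariety
      ((dualVariety φ).tot (dualDivisor φ)) := by
  choose g hg hgσ using fun s : normalFan (totalPolyhedron φ) => h.exists_base_cone s.2
  have hbot : normalCone (totalPolyhedron φ) (totalPolyhedron φ) ∈
      normalFan (totalPolyhedron φ) := by
    refine ⟨_, ⟨⟨_, h.sumElim_zero_mem (zero_mem_polar φ)⟩, 0, ?_⟩, rfl⟩
    ext x
    simp
  refine Charts.sameToricVariety_of_galoisConnection _ _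
    (fun j => (⟨_, h.epigraph_mem_normalFan j.2⟩ : normalFan (totalPolyhedron φ)))
    (fun s => (⟨g s, hg s⟩ : normalFan (polar (dualPolar φ))))
    (fun s j => hgσ s j.1 j.2) (⟨_, hbot⟩ : normalFan (totalPolyhedron φ)) (fun s => ?_)
    fun j => ?_
  · obtain ⟨_, F, hF, rfl⟩ := s
    exact fun w hw x hx => hw x (hF.subset hx)
  · ext x
    exact h.mem_tot_dualVariety_monoid j

end IsNefDatum

/-! ### Nef partitions on complete fans -/

section CompleteFan

variable {ι : Type} [Fintype ι]

lemma Fan.isGeneratedByRays (Y : Fan ι) {σ : Set (ι → ℝ)} (hσ : σ ∈ Y.cones) :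
    IsGeneratedByRays σ :=
  (Y.rational σ hσ).isGeneratedByRays (Y.stronglyConvex σ hσ)

/-- Baire: the interiors of the cones have dense union, so the closed union of the full-dimensional
cones is everything. -/
lemma Fan.exists_fullDimensional (Y : Fan ι) (hY : ⋃₀ Y.cones = Set.univ) (ν : ι → ℝ) :
    ∃ σ ∈ Y.cones, (interior σ).Nonempty ∧ ν ∈ σ := by
  have hclosed : ∀ σ ∈ Y.cones, IsClosed σ := fun σ hσ => by
    obtain ⟨F, rfl⟩ := Y.rational σ hσ
    exact isClosed_coneHull F
  have hdense := dense_sUnion_interior_of_closed hclosed Y.finite.countable hY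
  have hsub : (⋃ σ ∈ Y.cones, interior σ) ⊆ ⋃ σ ∈ {σ ∈ Y.cones | (interior σ).Nonempty}, σ := by
    intro x hx
    obtain ⟨σ, hσ, hxσ⟩ := Set.mem_iUnion₂.mp hx
    exact Set.mem_iUnion₂.mpr ⟨σ, ⟨hσ, x, hxσ⟩, interior_subset hxσ⟩
  have hcl : IsClosed (⋃ σ ∈ {σ ∈ Y.cones | (interior σ).Nonempty}, σ) :=
    (Y.finite.subset (Set.sep_subset _ _)).isClosed_biUnion fun σ hσ => hclosed σ hσ.1
  have := closure_minimal hsub hcl (hdense ν)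
  obtain ⟨σ, hσ, hν⟩ := Set.mem_iUnion₂.mp this
  exact ⟨σ, hσ.1, hσ.2, hν⟩

/-- The segment from an interior point of `σ` to `ν` begins inside `σ`, where `φ` is linear;
convexity compares that initial piece with φ(ν). -/
lemma dotProduct_le_of_convexOn {φ : (ι → ℝ) → ℝ} (hφ : ConvexOn ℝ Set.univ φ)
    {σ : Set (ι → ℝ)} (hσ : (interior σ).Nonempty) {m : ι → ℝ} (hm : ∀ x ∈ σ, φ x = m ⬝ᵥ x)
    (ν : ι → ℝ) : m ⬝ᵥ ν ≤ φ ν := by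
  obtain ⟨x, hx⟩ := hσ
  have hcont : Filter.Tendsto (fun ε : ℝ => (1 - ε) • x + ε • ν) (nhdsWithin 0 (Set.Ioi 0))
      (nhds x) := by
    have : Continuous fun ε : ℝ => (1 - ε) • x + ε • ν := by fun_prop
    have h0 := this.tendsto 0
    simp only [sub_zero, one_smul, zero_smul, add_zero] at h0
    exact h0.mono_left nhdsWithin_le_nhds
  have h1 := hcont.eventually (mem_interior_iff_mem_nhds.mp hx)
  have h2 : ∀ᶠ ε in nhdsWithin (0 : ℝ) (Set.Ioi 0), ε < 1 :=
    nhdsWithin_le_nhds (gt_mem_nhds one_pos)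
  obtain ⟨ε, ⟨hε, hε1⟩, hε0⟩ := ((h1.and h2).and self_mem_nhdsWithin).exists
  have hε0 : 0 < ε := hε0
  have h3 := hφ.2 (Set.mem_univ x) (Set.mem_univ ν) (by linarith : (0 : ℝ) ≤ 1 - ε) hε0.le
    (by ring)
  rw [hm _ hε, hm x (interior_subset hx), dotProduct_add, dotProduct_smul, dotProduct_smul] at h3
  simp only [smul_eq_mul] at h3
  exact le_of_mul_le_mul_left (by linarith) hε0

variable {c : ℕ} {Y : Fan ι} {D : Fin c → Y.variety.rays → ℤ}

/-- The difference is div(m), non-negative on all rays. As -m lies in some cone, ⟨-m, m⟩ ≥ 0 and m =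
0. -/
lemma sum_eq_one_of_isCalabiYau (hY : ⋃₀ Y.cones = Set.univ) (hD : IsGivental Y.variety D)
    (hCY : IsCalabiYau Y.variety D) (u : Y.variety.rays) : ∑ k, D k u = 1 := by
  obtain ⟨m, hm⟩ := hCY
  have hm0 : m = 0 := by
    obtain ⟨σ, hσ, hmσ⟩ : ∃ σ ∈ Y.cones, -realVec m ∈ σ := by
      have : -realVec m ∈ ⋃₀ Y.cones := hY ▸ Set.mem_univ _
      exact this
    obtain ⟨G, hG, hray⟩ := Y.isGeneratedByRays hσ
    have h1 : 0 ≤ (-realVec m) ⬝ᵥ realVec m := by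
      refine nonneg_of_mem_coneHull (hG ▸ hmσ) fun u hu => ?_
      have h2 := hD.2 ⟨u, (hray u hu).1, (⟨σ, hσ⟩ : Y.cones), (hray u hu).2⟩
      rw [hm] at h2
      rw [realVec_dotProduct]
      exact_mod_cast h2
    have h2 : 0 ≤ realVec m ⬝ᵥ realVec m := Finset.sum_nonneg fun i _ => mul_self_nonneg _
    rw [neg_dotProduct] at h1
    exact realVec_eq_zero.mp (dotProduct_self_eq_zero.mp (by linarith))
  have := hm u
  rw [hm0, dotProduct_zero] at this
  linarith

lemma exists_divisor_eq_ite (hY : ⋃₀ Y.cones = Set.univ) (hD : IsGivental Y.variety D)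
    (hCY : IsCalabiYau Y.variety D) (u : Y.variety.rays) :
    ∃ k, ∀ l, D l u = if l = k then 1 else 0 := by
  have hsum := sum_eq_one_of_isCalabiYau hY hD hCY u
  have hpos : ∀ k, 0 ≤ D k u := fun k => (hD.1 k).le u
  obtain ⟨k, hk⟩ : ∃ k, D k u ≠ 0 := by
    by_contra! hcon
    simp [hcon] at hsum
  have hk1 : 1 ≤ D k u := Int.add_one_le_iff.mpr (lt_of_le_of_ne (hpos k) hk.symm)
  rw [← Finset.add_sum_erase _ _ (Finset.mem_univ k)] at hsum
  have hz := Finset.sum_nonneg (f := fun l => D l u) (s := Finset.univ.erase k) fun l _ => hpos l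
  refine ⟨k, fun l => ?_⟩
  split_ifs with hlk
  · subst hlk
    omega
  · have := Finset.single_le_sum (f := fun l => D l u) (fun l _ => hpos l)
      (Finset.mem_erase.mpr ⟨hlk, Finset.mem_univ l⟩)
    have h2 := hpos l
    omega

/-- The support functions of a Calabi–Yau nef partition of a complete fan. -/
theorem exists_isNefDatum (hc : 0 < c) (hY : ⋃₀ Y.cones = Set.univ)
    (hD : IsGivental Y.variety D) (hCY : IsCalabiYau Y.variety D) {φ : Fin c → (ι → ℝ) → ℝ}
    (hφ : ∀ k, IsIntegralConvexPL Y.cones (φ k)) (hφD : ∀ k, Y.IsSupportFunction (D k) (φ k)) :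
    ∃ R L, IsNefDatum φ R L ∧ ∀ u ∈ R, u ∈ Y.variety.rays := by
  classical
  choose G hG hray using fun σ : Y.cones => Y.isGeneratedByRays σ.2
  choose m hm using fun k (σ : Y.cones) => (hφ k).2 σ.1 σ.2
  have := Y.finite.fintype
  have hR : ∀ u ∈ Finset.univ.biUnion G, u ∈ Y.variety.rays := by
    intro u hu
    obtain ⟨σ, -, hu⟩ := Finset.mem_biUnion.mp hu
    exact ⟨(hray σ u hu).1, σ, (hray σ u hu).2⟩
  have hvalue : ∀ u ∈ Finset.univ.biUnion G, ∃ k, ∀ l, φ l (realVec u) = if l = k then 1 else 0 := by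
    intro u hu
    obtain ⟨k, hk⟩ := exists_divisor_eq_ite hY hD hCY ⟨u, hR u hu⟩
    refine ⟨k, fun l => ?_⟩
    rw [hφD l ⟨u, hR u hu⟩, hk l]
    split_ifs <;> simp
  have hdecomp : ∀ ν, ∃ a : (ι → ℤ) → ℝ, (∀ u, 0 ≤ a u) ∧
      ν = ∑ u ∈ Finset.univ.biUnion G, a u • realVec u ∧
      ∀ k, φ k ν = ∑ u ∈ Finset.univ.biUnion G, a u * φ k (realVec u) := by
    intro ν
    obtain ⟨σ, hσ, hν⟩ : ∃ σ ∈ Y.cones, ν ∈ σ := by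
      have : ν ∈ ⋃₀ Y.cones := hY ▸ Set.mem_univ _
      exact this
    obtain ⟨a, ha, haν⟩ := (hG ⟨σ, hσ⟩).subset hν
    have hsub : G ⟨σ, hσ⟩ ⊆ Finset.univ.biUnion G :=
      Finset.subset_biUnion_of_mem G (Finset.mem_univ _)
    -- Coefficients are extended by zero from one cone to all of `R`; a general target module covers
    -- both the vectors and the values of φ_k.
    have hext : ∀ {E : Type} [AddCommGroup E] [Module ℝ E] (f : (ι → ℤ) → E),
        ∑ u ∈ G ⟨σ, hσ⟩, a u • f u =
          ∑ u ∈ Finset.univ.biUnion G, (if u ∈ G ⟨σ, hσ⟩ then a u else 0) • f u := by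
      intro E _ _ f
      refine (Finset.sum_congr rfl fun u hu => ?_).trans
        (Finset.sum_subset hsub fun u _ hu => ?_)
      · rw [if_pos hu]
      · rw [if_neg hu, zero_smul]
    refine ⟨fun u => if u ∈ G ⟨σ, hσ⟩ then a u else 0, fun u => ?_, haν.trans (hext _),
      fun k => ?_⟩
    · dsimp only
      split_ifs
      exacts [ha u, le_rfl]
    · refine Eq.trans ?_ (hext fun u => φ k (realVec u))
      rw [hm k ⟨σ, hσ⟩ ν hν, haν, dotProduct_sum]
      refine Finset.sum_congr rfl fun u hu => ?_
      rw [hm k ⟨σ, hσ⟩ (realVec u) ((hG ⟨σ, hσ⟩).symm.subset (mem_coneHull_of_mem hu)), dotProduct_smul]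
  -- The points of L_k are the negated linear pieces on full-dimensional cones, where convexity
  -- makes each piece a global lower bound of φ_k.
  refine ⟨Finset.univ.biUnion G, fun k => (Finset.univ.filter fun σ : Y.cones =>
    (interior σ.1).Nonempty).image fun σ => -m k σ, ⟨hc, hvalue, hdecomp, ?_, ?_, ?_⟩, hR⟩
  · intro k l hl ν
    obtain ⟨σ, hσ, rfl⟩ := Finset.mem_image.mp hl
    rw [realVec_neg, dotProduct_neg, neg_le_neg_iff, dotProduct_comm]
    exact dotProduct_le_of_convexOn (hφ k).1 (Finset.mem_filter.mp hσ).2 (hm k σ) ν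
  · intro k ν
    obtain ⟨σ, hσ, hint, hν⟩ := Y.exists_fullDimensional hY ν
    refine ⟨-m k ⟨σ, hσ⟩, Finset.mem_image.mpr ⟨⟨σ, hσ⟩, by simpa using hint, rfl⟩, ?_⟩
    rw [realVec_neg, dotProduct_neg, neg_neg, dotProduct_comm]
    exact hm k ⟨σ, hσ⟩ ν hν
  · intro k
    by_contra! hcon
    have hzero : ∀ u ∈ Finset.univ.biUnion G, φ k (realVec u) = 0 := by
      intro u hu
      obtain ⟨i, hi⟩ := hvalue u hu
      have h1 := hi k
      split_ifs at h1
      · exact absurd h1 (hcon u hu)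
      · exact h1
    refine (hD.1 k).ne' (funext fun u => ?_)
    obtain ⟨a, -, -, ha⟩ := hdecomp (realVec u.1)
    have h1 := hφD k u
    rw [ha k, Finset.sum_eq_zero fun v hv => by rw [hzero v hv, mul_zero]] at h1
    exact_mod_cast h1.symm

end CompleteFan

/-! ### Functions linear on the fibres -/

section SectionFunction

variable {ι : Type} {c : ℕ}

/-- The exponent of the function `χ^m t_k`. -/
def fibreLinear (k : Fin c) (m : ι → ℤ) : ι ⊕ Fin c → ℤ := Sum.elim m (Pi.single k 1)

lemma fibreLinear_inj {k l : Fin c} {m n : ι → ℤ} :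
    fibreLinear k m = fibreLinear l n ↔ k = l ∧ m = n := by
  refine ⟨fun h => ?_, fun h => by rw [h.1, h.2]⟩
  refine ⟨?_, funext fun i => congrFun h (Sum.inl i)⟩
  by_contra hkl
  have := congrFun h (Sum.inr k)
  simp [fibreLinear, hkl] at this

lemma sectionFunction_eq (s : Fin c → Laurent ι) :
    sectionFunction s = ∑ k, AddMonoidAlgebra.mapDomain (fibreLinear k) (s k) := rfl

lemma coeff_sectionFunction (s : Fin c → Laurent ι) (k : Fin c) (m : ι → ℤ) :
    (sectionFunction s).coeff (fibreLinear k m) = (s k).coeff m := by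
  classical
  rw [sectionFunction_eq, AddMonoidAlgebra.coeff_sum, Finsupp.finsetSum_apply,
    Finset.sum_eq_single k]
  · exact Finsupp.mapDomain_apply (fun a b h => (fibreLinear_inj.mp h).2) _ _
  · intro l _ hl
    refine Finsupp.mapDomain_of_notMem_range _ _ ?_
    rintro ⟨n, hn⟩
    exact hl (fibreLinear_inj.mp hn).1
  · simp

lemma exists_of_mem_support_sectionFunction {s : Fin c → Laurent ι} {x : ι ⊕ Fin c → ℤ}
    (hx : x ∈ (sectionFunction s).coeff.support) : ∃ k, ∃ m, x = fibreLinear k m := by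
  classical
  have := support_finsum (fun k => AddMonoidAlgebra.mapDomain (fibreLinear k) (s k))
    {x | ∃ k, ∃ m, x = fibreLinear k m} (fun k m hm => by
      obtain ⟨n, -, rfl⟩ := Finset.mem_image.mp (Finsupp.mapDomain_support hm)
      exact ⟨k, n, rfl⟩) x
  rw [finsum_eq_sum_of_fintype] at this
  exact this hx

/-- A function linear on the fibres is defined by a section. -/
lemma exists_sectionFunction_eq (W : Laurent (ι ⊕ Fin c)) (S : Fin c → Set (ι → ℤ))
    (hW : ∀ x ∈ W.coeff.support, ∃ k, ∃ m ∈ S k, x = fibreLinear k m) :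
    ∃ s : Fin c → Laurent ι, (∀ k, ∀ m ∈ (s k).coeff.support, m ∈ S k) ∧
      W = sectionFunction s := by
  classical
  choose k m hm hx using fun x : W.coeff.support => hW x.1 x.2
  refine ⟨fun l => ∑ᶠ x : {x : W.coeff.support // k x = l},
    AddMonoidAlgebra.single (m x.1) (W.coeff x.1.1), fun l n hn => ?_, ?_⟩
  · refine support_finsum _ (S l) (fun x p hp => ?_) n hn
    have := Finsupp.support_single_subset hp
    rw [Finset.mem_singleton] at this
    obtain ⟨x, rfl⟩ := x
    rw [this]
    exact hm x
  · rw [sectionFunction_eq]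
    have h1 : ∀ l, AddMonoidAlgebra.mapDomain (fibreLinear l)
        (∑ᶠ x : {x : W.coeff.support // k x = l},
          AddMonoidAlgebra.single (m x.1) (W.coeff x.1.1)) =
        ∑ x : {x : W.coeff.support // k x = l}, AddMonoidAlgebra.single x.1.1 (W.coeff x.1.1) := by
      intro l
      rw [finsum_eq_sum_of_fintype]
      refine (map_sum (⟨⟨AddMonoidAlgebra.mapDomain (fibreLinear l),
        AddMonoidAlgebra.mapDomain_zero _⟩, AddMonoidAlgebra.mapDomain_add _⟩ :
          Laurent ι →+ Laurent (ι ⊕ Fin c)) _ _).trans (Finset.sum_congr rfl fun x _ => ?_)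
      refine AddMonoidAlgebra.mapDomain_single.trans ?_
      obtain ⟨x, rfl⟩ := x
      rw [← hx]
    rw [Finset.sum_congr rfl fun l _ => h1 l,
      Fintype.sum_fiberwise k fun x : W.coeff.support =>
        (AddMonoidAlgebra.single x.1 (W.coeff x.1) : Laurent (ι ⊕ Fin c)),
      Finset.sum_coe_sort W.coeff.support fun x =>
        (AddMonoidAlgebra.single x (W.coeff x) : Laurent (ι ⊕ Fin c))]
    exact W.sum_coeff_single.symm

end SectionFunction

/-! ### Linear data -/

section LinearData

variable {ι : Type} [Fintype ι]

/-- The imaginary part of an element of `ℂ/ℤ`. -/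
noncomputable def imCZ : CZ →+ ℝ :=
  QuotientAddGroup.lift _ Complex.imAddGroupHom (by
    rw [AddSubgroup.zmultiples_le]
    simp [AddMonoidHom.mem_ker])

lemma imCZ_coe (z : ℂ) : imCZ (z : CZ) = z.im := rfl

/-- Different lifts of a class have translated polyhedra. -/
lemma exists_translate_of_ofComplex_eq {T : Type} {C : T → ι → ℤ} {α β : T → ℂ}
    (h : Coker.ofComplex C α = Coker.ofComplex C β) :
    ∃ t, polyhedron C (fun i => (α i).im) = {x | x + t ∈ polyhedron C fun i => (β i).im} := by
  obtain ⟨g, hg⟩ := QuotientAddGroup.eq.mp h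
  refine ⟨fun i => -imCZ (g i), ?_⟩
  have key : ∀ s, (α s).im = realVec (C s) ⬝ᵥ (fun i => -imCZ (g i)) + (β s).im := by
    intro s
    have := congrArg imCZ (congrFun hg s)
    simp only [rowMap, AddMonoidHom.coe_mk, ZeroHom.coe_mk, map_sum, map_zsmul, Pi.add_apply,
      Pi.neg_apply, map_add, map_neg, imCZ_coe, zsmul_eq_mul] at this
    simp only [dotProduct, realVec, mul_neg, Finset.sum_neg_distrib]
    linarith
  ext x
  simp only [polyhedron, Set.mem_ofPred_eq, dotProduct_add, key, add_assoc]

lemma Coker.ofComplex_surjective {T : Type} (C : T → ι → ℤ) :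
    Function.Surjective (Coker.ofComplex C) := by
  intro y
  obtain ⟨x, rfl⟩ := QuotientAddGroup.mk_surjective y
  choose z hz using fun t => QuotientAddGroup.mk_surjective (x t)
  exact ⟨z, congrArg (Coker.mk C) (funext hz)⟩

lemma pushGen_eq {T R G : Type} [AddCommGroup G] (k : T → Option R) (x : T → G) {t : T} {ρ : R}
    (ht : k t = some ρ) (hu : ∀ t', k t' = some ρ → t' = t) : pushGen k x ρ = x t := by
  unfold pushGen
  rw [finsum_eq_single _ t fun t' ht' => ?_]
  · simp [ht]
  · have : IsEmpty (k t' = some ρ) := ⟨fun h => ht' (hu t' h)⟩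
    exact finsum_of_isEmpty _

end LinearData

/-! ### The Batyrev–Borisov model -/

section BatyrevBorisov

variable {ι : Type} [Fintype ι] {c : ℕ}

-- Finiteness matters: a `finsum` with infinite support is zero by convention.
open Classical in
lemma coeff_wBB {Y : Charts ι} {D : Fin c → Y.rays → ℤ} {k : Fin c}
    (hfin : (Y.sectionPoints (D k)).Finite) (m : ι → ℤ) :
    (wBB Y D k).coeff m =
      if m ∈ Y.sectionPoints (D k) then (if m = 0 then 1 else Complex.exp (-2 * Real.pi)) else 0 := by
  have := hfin.fintype
  unfold wBB
  rw [finsum_eq_sum_of_fintype, AddMonoidAlgebra.coeff_sum, Finsupp.finsetSum_apply]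
  simp only [AddMonoidAlgebra.coeff_single, Finsupp.single_apply]
  split_ifs with hm hm0
  · rw [Finset.sum_eq_single ⟨m, hm⟩]
    · simp [hm0]
    · intro n _ hn
      exact if_neg fun h => hn (Subtype.ext h)
    · simp
  · rw [Finset.sum_eq_single ⟨m, hm⟩]
    · simp [hm0]
    · intro n _ hn
      exact if_neg fun h => hn (Subtype.ext h)
    · simp
  · exact Finset.sum_eq_zero fun n _ => if_neg fun h => hm (by
      rw [← h]
      exact n.2)

lemma realVec_fibreLinear_dotProduct (k : Fin c) (m : ι → ℤ) (ξ : ι ⊕ Fin c → ℝ) :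
    realVec (fibreLinear k m) ⬝ᵥ ξ = realVec m ⬝ᵥ (ξ ∘ Sum.inl) + ξ (Sum.inr k) := by
  simp [fibreLinear, realVec, dotProduct, Pi.single_apply]

lemma isPrimitive_fibreLinear (k : Fin c) (m : ι → ℤ) : IsPrimitive (fibreLinear k m) := by
  intro d hd
  have := hd (Sum.inr k)
  simp only [fibreLinear, Sum.elim_inr, Pi.single_eq_same] at this
  exact isUnit_of_dvd_one this

lemma im_log_coefficient (p : Prop) [Decidable p] :
    (Complex.log (if p then 1 else Complex.exp (-2 * Real.pi)) /
      (2 * Real.pi * Complex.I)).im = if p then 0 else 1 := by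
  split_ifs
  · simp
  · rw [Complex.log_exp (by simp [Real.pi_pos]) (by simp [Real.pi_pos.le])]
    have h : (Real.pi : ℂ) ≠ 0 := by exact_mod_cast Real.pi_ne_zero
    have : -2 * (Real.pi : ℂ) / (2 * Real.pi * Complex.I) = Complex.I := by
      field_simp
      simp
    rw [this, Complex.I_im]

variable {Y : Fan ι} {D : Fin c → Y.variety.rays → ℤ} {φ : Fin c → (ι → ℝ) → ℝ}
  {R : Finset (ι → ℤ)} {L : Fin c → Finset (ι → ℤ)}

namespace IsNefDatum

lemma mem_sectionPoints (h : IsNefDatum φ R L) (hR : ∀ u ∈ R, u ∈ Y.variety.rays)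
    (hφD : ∀ k, Y.IsSupportFunction (D k) (φ k)) {k : Fin c} {m : ι → ℤ} :
    m ∈ Y.variety.sectionPoints (D k) ↔ realVec m ∈ nabla (φ k) := by
  have key : ∀ u : Y.variety.rays, 0 ≤ Y.variety.div u ⬝ᵥ m + D k u ↔
      -φ k (realVec u.1) ≤ realVec u.1 ⬝ᵥ realVec m := by
    intro u
    rw [hφD k u, realVec_dotProduct, neg_le_iff_add_nonneg]
    exact_mod_cast Iff.rfl
  constructor
  · intro hm
    rw [h.mem_nabla]
    exact fun u hu => (key ⟨u, hR u hu⟩).mp (hm ⟨u, hR u hu⟩)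
  · exact fun hm u => (key u).mpr (hm _)

lemma finite_sectionPoints (h : IsNefDatum φ R L) (hR : ∀ u ∈ R, u ∈ Y.variety.rays)
    (hφD : ∀ k, Y.IsSupportFunction (D k) (φ k)) (k : Fin c) :
    (Y.variety.sectionPoints (D k)).Finite := by
  have hcompact : IsCompact (nabla (φ k)) := by
    rw [h.nabla_eq]
    exact ((L k).finite_toSet.image _).isCompact_convexHull ℝ
  classical
  obtain ⟨B, hB⟩ := hcompact.isBounded.exists_norm_le
  refine (Set.finite_Icc (fun _ : ι => -⌈B⌉) (fun _ : ι => ⌈B⌉)).subset fun m hm => ?_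
  have h1 : ∀ i, |(m i : ℝ)| ≤ B := fun i =>
    (norm_le_pi_norm (realVec m) i).trans (hB _ ((h.mem_sectionPoints hR hφD).mp hm))
  refine ⟨fun i => ?_, fun i => ?_⟩
  · have h2 : -(m i : ℝ) ≤ (⌈B⌉ : ℝ) := ((neg_le_abs _).trans (h1 i)).trans (Int.le_ceil B)
    have h3 : -(m i) ≤ ⌈B⌉ := by exact_mod_cast h2
    simp only
    omega
  · have h2 : (m i : ℝ) ≤ (⌈B⌉ : ℝ) := ((le_abs_self _).trans (h1 i)).trans (Int.le_ceil B)
    exact_mod_cast h2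

open Classical in
lemma coeff_modelBB (h : IsNefDatum φ R L) (hR : ∀ u ∈ R, u ∈ Y.variety.rays)
    (hφD : ∀ k, Y.IsSupportFunction (D k) (φ k)) (κ : Y.variety.rays → CZ) {k : Fin c}
    {m : ι → ℤ} (hm : realVec m ∈ nabla (φ k)) :
    (modelBB Y.variety D κ).W.coeff (fibreLinear k m) =
      if m = 0 then 1 else Complex.exp (-2 * Real.pi) := by
  refine (coeff_sectionFunction _ _ _).trans ?_
  rw [coeff_wBB (h.finite_sectionPoints hR hφD k), if_pos ((h.mem_sectionPoints hR hφD).mpr hm)]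

lemma fibreLinear_mem_support (h : IsNefDatum φ R L) (hR : ∀ u ∈ R, u ∈ Y.variety.rays)
    (hφD : ∀ k, Y.IsSupportFunction (D k) (φ k)) (κ : Y.variety.rays → CZ) {k : Fin c}
    {m : ι → ℤ} (hm : realVec m ∈ nabla (φ k)) :
    fibreLinear k m ∈ (modelBB Y.variety D κ).W.coeff.support := by
  classical
  rw [Finsupp.mem_support_iff, h.coeff_modelBB hR hφD κ hm]
  split_ifs
  · exact one_ne_zero
  · exact Complex.exp_ne_zero _

lemma exists_of_mem_support (h : IsNefDatum φ R L) (hR : ∀ u ∈ R, u ∈ Y.variety.rays)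
    (hφD : ∀ k, Y.IsSupportFunction (D k) (φ k)) (κ : Y.variety.rays → CZ) {x : ι ⊕ Fin c → ℤ}
    (hx : x ∈ (modelBB Y.variety D κ).W.coeff.support) :
    ∃ k, ∃ m, x = fibreLinear k m ∧ realVec m ∈ nabla (φ k) := by
  classical
  obtain ⟨k, m, rfl⟩ := exists_of_mem_support_sectionFunction hx
  refine ⟨k, m, rfl, ?_⟩
  rw [Finsupp.mem_support_iff] at hx
  have h1 := (coeff_sectionFunction (wBB Y.variety D) k m).symm.trans_ne hx
  by_contra hm
  rw [coeff_wBB (h.finite_sectionPoints hR hφD k),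
    if_neg fun hm' => hm ((h.mem_sectionPoints hR hφD).mp hm')] at h1
  exact h1 rfl

lemma im_log_coeff_modelBB_nonneg (h : IsNefDatum φ R L) (hR : ∀ u ∈ R, u ∈ Y.variety.rays)
    (hφD : ∀ k, Y.IsSupportFunction (D k) (φ k)) (κ : Y.variety.rays → CZ)
    (t : (modelBB Y.variety D κ).monData.T) :
    0 ≤ (Complex.log ((modelBB Y.variety D κ).W.coeff t.1) / (2 * Real.pi * Complex.I)).im := by
  classical
  obtain ⟨k, m, ht, hm⟩ := h.exists_of_mem_support hR hφD κ t.2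
  rw [ht, h.coeff_modelBB hR hφD κ hm, im_log_coefficient]
  split_ifs <;> norm_num

/-- The monomial m = 0 gives x_k ≥ 0 and m ≠ 0 gives x_k ≥ -⟨m, ν⟩ - 1, where φ_k(ν) is the maximum
of -⟨m, ν⟩ over the lattice points of ∇_k. -/
lemma polyhedron_modelBB (h : IsNefDatum φ R L) (hR : ∀ u ∈ R, u ∈ Y.variety.rays)
    (hφD : ∀ k, Y.IsSupportFunction (D k) (φ k)) (κ : Y.variety.rays → CZ) :
    polyhedron (modelBB Y.variety D κ).monData.C (fun t =>
      (Complex.log ((modelBB Y.variety D κ).W.coeff t.1) / (2 * Real.pi * Complex.I)).im) =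
      totalPolyhedron φ := by
  classical
  have hval : ∀ k m, realVec m ∈ nabla (φ k) →
      (Complex.log ((modelBB Y.variety D κ).W.coeff (fibreLinear k m)) /
        (2 * Real.pi * Complex.I)).im = if m = 0 then 0 else 1 := fun k m hm => by
    rw [h.coeff_modelBB hR hφD κ hm, im_log_coefficient]
  ext ξ
  constructor
  · intro hξ k
    have key : ∀ m : ι → ℤ, realVec m ∈ nabla (φ k) →
        0 ≤ realVec m ⬝ᵥ (ξ ∘ Sum.inl) + ξ (Sum.inr k) + if m = 0 then 0 else 1 := by
      intro m hm
      have h1 : 0 ≤ realVec (fibreLinear k m) ⬝ᵥ ξ + _ :=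
        hξ ⟨_, h.fibreLinear_mem_support hR hφD κ hm⟩
      dsimp only at h1
      rwa [hval k m hm, realVec_fibreLinear_dotProduct] at h1
    have h0 := key 0 (by rw [realVec_zero]; exact h.zero_mem_nabla k)
    rw [if_pos rfl, realVec_zero, zero_dotProduct, zero_add, add_zero] at h0
    refine ⟨h0, ?_⟩
    obtain ⟨l, hl, hlk⟩ := h.attained k (ξ ∘ Sum.inl)
    have h1 := key l (h.mem_nabla_of_mem hl)
    rw [dotProduct_comm] at h1
    rw [hlk]
    -- If the maximizer is the origin, the bound without the summand 1 is stronger than needed.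
    split_ifs at h1 <;> linarith
  · intro hξ t
    obtain ⟨k, m, ht, hm⟩ := h.exists_of_mem_support hR hφD κ t.2
    have h1 : (modelBB Y.variety D κ).monData.C t = fibreLinear k m := ht
    have h4 : (Complex.log ((modelBB Y.variety D κ).W.coeff t.1) /
        (2 * Real.pi * Complex.I)).im = if m = 0 then 0 else 1 := by rw [ht, hval k m hm]
    rw [h1]
    beta_reduce
    rw [h4, realVec_fibreLinear_dotProduct]
    have h2 := hξ k
    have h3 := hm (ξ ∘ Sum.inl)
    rw [dotProduct_comm] at h3
    split_ifs with hm0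
    · rw [hm0, realVec_zero, zero_dotProduct]
      linarith
    · linarith

lemma normalFan_dual (h : IsNefDatum φ R L) (hR : ∀ u ∈ R, u ∈ Y.variety.rays)
    (hφD : ∀ k, Y.IsSupportFunction (D k) (φ k)) {κ : Y.variety.rays → CZ}
    (r : (modelBB Y.variety D κ).Dual) : normalFan r.P = normalFan (totalPolyhedron φ) := by
  obtain ⟨t, ht⟩ := exists_translate_of_ofComplex_eq r.lift_α
  have h1 : r.P = {x | x + t ∈ totalPolyhedron φ} := by
    rw [← h.polyhedron_modelBB hR hφD κ]
    exact ht
  rw [h1, normalFan_translate]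

/-- The rays of the fan of the dual model are monomials of the superpotential. -/
lemma mem_support_of_mem_rays (h : IsNefDatum φ R L) (hR : ∀ u ∈ R, u ∈ Y.variety.rays)
    (hφD : ∀ k, Y.IsSupportFunction (D k) (φ k)) (κ : Y.variety.rays → CZ) {v : ι ⊕ Fin c → ℤ}
    (hv : v ∈ (fanVariety (normalFan (totalPolyhedron φ))).rays) :
    v ∈ (modelBB Y.variety D κ).W.coeff.support := by
  obtain ⟨hprim, (σ : (fanVariety _).Index), hray⟩ := hv
  obtain ⟨F, hF, hσ⟩ := σ.2
  rw [← h.polyhedron_modelBB hR hφD κ] at hF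
  have : Finite (modelBB Y.variety D κ).monData.T :=
    inferInstanceAs (Finite (modelBB Y.variety D κ).W.coeff.support)
  obtain ⟨G, hG, hGF⟩ := normalCone_polyhedron _ _ hF
  rw [h.polyhedron_modelBB hR hφD κ] at hGF
  have hray' : IsRayOf (latticeDual (coneHull G)) v := (hσ.trans hGF) ▸ hray
  obtain ⟨f, hf, a, ha, hfa⟩ := hray'.exists_generator hprim
  obtain ⟨t, rfl⟩ := hG f hf
  obtain ⟨k, m, ht, -⟩ := h.exists_of_mem_support hR hφD κ t.2
  have h1 : (modelBB Y.variety D κ).monData.C t = fibreLinear k m := ht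
  have h2 := IsPrimitive.eq_of_smul (h1 ▸ isPrimitive_fibreLinear k m) ha hfa
  rw [← h2]
  exact t.2

theorem nonempty_dual (h : IsNefDatum φ R L) (hR : ∀ u ∈ R, u ∈ Y.variety.rays)
    (hφD : ∀ k, Y.IsSupportFunction (D k) (φ k)) (κ : Y.variety.rays → CZ) :
    Nonempty (modelBB Y.variety D κ).Dual := by
  classical
  obtain ⟨β, hβ⟩ := Coker.ofComplex_surjective _ (modelBB Y.variety D κ).divData.c
  have hP := h.polyhedron_modelBB hR hφD κ
  have hmem : ∀ ρ : (fanVariety (normalFan (polyhedron (modelBB Y.variety D κ).monData.C (fun t =>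
      (Complex.log ((modelBB Y.variety D κ).W.coeff t.1) /
        (2 * Real.pi * Complex.I)).im)))).rays,
      ρ.1 ∈ (modelBB Y.variety D κ).W.coeff.support := by
    rw [hP]
    exact fun ρ => h.mem_support_of_mem_rays hR hφD κ ρ.2
  have : Finite (modelBB Y.variety D κ).monData.T :=
    inferInstanceAs (Finite (modelBB Y.variety D κ).W.coeff.support)
  refine ⟨{
    α := fun t => Complex.log ((modelBB Y.variety D κ).W.coeff t.1) / (2 * Real.pi * Complex.I)
    lift_α := rfl
    interior_nonempty := ?_
    k := fun t => if ht : t.1 ∈ (fanVariety (normalFan (polyhedron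
        (modelBB Y.variety D κ).monData.C (fun t =>
          (Complex.log ((modelBB Y.variety D κ).W.coeff t.1) /
            (2 * Real.pi * Complex.I)).im)))).rays then some ⟨t.1, ht⟩ else none
    k_surjective := fun ρ => ⟨⟨ρ.1, hmem ρ⟩, dif_pos ρ.2⟩
    k_div := ?_
    nonneg := ?_
    β := β
    lift_β := hβ }⟩
  -- At (0, 1, …, 1) each inequality reads 1 + Im α_t > 0.
  · refine ⟨Sum.elim 0 1, mem_interior.mpr ⟨⋂ t, {ξ | 0 < realVec
      ((modelBB Y.variety D κ).monData.C t) ⬝ᵥ ξ + (Complex.log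
        ((modelBB Y.variety D κ).W.coeff t.1) / (2 * Real.pi * Complex.I)).im},
      fun ξ hξ t => (Set.mem_iInter.mp hξ t).le, isOpen_iInter_of_finite fun t => ?_,
      Set.mem_iInter.mpr fun t => ?_⟩⟩
    · refine isOpen_lt continuous_const ?_
      unfold dotProduct
      fun_prop
    · obtain ⟨k, m, ht, -⟩ := h.exists_of_mem_support hR hφD κ t.2
      have h1 : (modelBB Y.variety D κ).monData.C t = fibreLinear k m := ht
      have h2 := h.im_log_coeff_modelBB_nonneg hR hφD κ t
      rw [Set.mem_ofPred_eq, h1, realVec_fibreLinear_dotProduct]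
      simp only [Sum.elim_comp_inl, dotProduct_zero, Sum.elim_inr, Pi.one_apply]
      linarith
  · funext ρ
    refine pushGen_eq _ _ (t := (⟨ρ.1, hmem ρ⟩ : (modelBB Y.variety D κ).W.coeff.support))
      (dif_pos ρ.2) fun t ht => ?_
    split_ifs at ht with h1
    have h2 := Option.some.inj ht
    have h3 : t.1 = ρ.1 := by rw [← h2]
    exact Subtype.ext h3
  -- A monomial regular on a chart has no pole along a divisor meeting it.
  · rintro t ⟨v, hv⟩
    obtain ⟨-, j, hnonneg, -⟩ := hv
    rw [dotProduct_comm]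
    exact hnonneg _ ((modelBB Y.variety D κ).regular _ t.2 j)

/-- A ray v of Y* in the j-th block is a vertex of ∇_j, so ⟨v, m⟩ ≥ -φ_j(m), which is at least minus
the coefficient of D*_k at v. -/
lemma mem_sectionPoints_dualDivisor (h : IsNefDatum φ R L) {k : Fin c} {m : ι → ℤ}
    (hm : ∀ l, φ l (realVec m) ≤ if l = k then 1 else 0) :
    m ∈ (dualVariety φ).sectionPoints (dualDivisor φ k) := by
  intro v
  obtain ⟨j, hj⟩ := h.mem_dualBlock_of_mem_rays v.2
  have h1 := h.dualDivisor_eq k v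
  rw [h.dualSupport_of_mem_dualBlock hj] at h1
  rw [h.dualBlock_eq] at hj
  have h2 := extremePoints_subset hj.1 (realVec m)
  have h3 := hm j
  have h4 : (0 : ℝ) ≤ ((v.1 ⬝ᵥ m : ℤ) : ℝ) + (dualDivisor φ k v : ℝ) := by
    rw [← realVec_dotProduct, dotProduct_comm, h1]
    simp only [eq_comm (a := k)]
    linarith
  exact_mod_cast h4

theorem exists_section (h : IsNefDatum φ R L) (hY : ⋃₀ Y.cones = Set.univ)
    (hD : IsGivental Y.variety D) (hCY : IsCalabiYau Y.variety D)
    (hφ : ∀ k, IsIntegralConvexPL Y.cones (φ k))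
    (hφD : ∀ k, Y.IsSupportFunction (D k) (φ k)) {κ : Y.variety.rays → CZ}
    (r : (modelBB Y.variety D κ).Dual) :
    ∃ s : Fin c → Laurent ι, (dualVariety φ).IsGlobalSection (dualDivisor φ) s ∧
      r.model.W = sectionFunction s := by
  refine exists_sectionFunction_eq _ (fun k => (dualVariety φ).sectionPoints (dualDivisor φ k))
    fun x hx => ?_
  refine support_finsum _ {x | ∃ k, ∃ m ∈ (dualVariety φ).sectionPoints (dualDivisor φ k),
    x = fibreLinear k m} (fun v p hp => ?_) x hx
  have hp := Finsupp.support_single_subset hp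
  rw [Finset.mem_singleton] at hp
  have hcartier : ∀ k, ∀ σ ∈ Y.cones, ∃ m : ι → ℤ, ∀ u : Y.variety.rays, realVec u.1 ∈ σ →
      D k u = m ⬝ᵥ u.1 := by
    intro k σ hσ
    obtain ⟨m, hm⟩ := (hφ k).2 σ hσ
    refine ⟨m, fun u hu => ?_⟩
    have := hm _ hu
    rw [hφD k u, realVec_dotProduct] at this
    exact_mod_cast this
  have hv : v.1 ∈ (Y.variety.tot D).rays := v.2
  -- A ray (0, e_k) contributes the section χ^0 of O(D*_k); a ray over `u` contributes χ^u, with k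
  -- the block of `u`.
  rcases tot_rays (fun σ hσ => Y.isGeneratedByRays hσ) hcartier hv with ⟨k, hk⟩ | ⟨u, hu⟩
  · refine ⟨k, 0, h.mem_sectionPoints_dualDivisor fun l => ?_, hp.trans hk⟩
    rw [realVec_zero, h.map_zero]
    split_ifs <;> norm_num
  · obtain ⟨k, hk⟩ := exists_divisor_eq_ite hY hD hCY u
    refine ⟨k, u.1, h.mem_sectionPoints_dualDivisor fun l => ?_, hp.trans (hu.trans ?_)⟩
    · rw [hφD l u, hk l]
      split_ifs <;> simp
    · unfold fibreLinear
      congr 1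
      funext l
      rw [hk l, Pi.single_apply]

end IsNefDatum

end BatyrevBorisov

end ToricLG

theorem mainTheorem1 {n c : ℕ} (hc : 0 < c) (Y : ToricLG.Fan (Fin n)) (hY : Y.IsFano)
    (D : Fin c → Y.variety.rays → ℤ) (hD : ToricLG.IsNefSubPartition Y.variety D)
    (hCY : ToricLG.IsCalabiYau Y.variety D)
    (φ : Fin c → (Fin n → ℝ) → ℝ) (hφ : ∀ k, ToricLG.IsIntegralConvexPL Y.cones (φ k))
    (hφD : ∀ k, Y.IsSupportFunction (D k) (φ k))
    (κ : Y.variety.rays → ToricLG.CZ) :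
    ToricLG.IsReflexive (ToricLG.dualPolar φ) ∧
    ToricLG.IsNefPartition (ToricLG.dualPolar φ) (ToricLG.dualBlock φ) ∧
    Nonempty (ToricLG.modelBB Y.variety D κ).Dual ∧
    ∀ r : (ToricLG.modelBB Y.variety D κ).Dual,
      r.model.X.SameToricVariety
        ((ToricLG.dualVariety φ).tot (ToricLG.dualDivisor φ)) ∧
      ∃ s : Fin c → ToricLG.Laurent (Fin n),
        (ToricLG.dualVariety φ).IsGlobalSection (ToricLG.dualDivisor φ) s ∧
        r.model.W = ToricLG.sectionFunction s := by
  obtain ⟨R, L, h, hR⟩ := ToricLG.exists_isNefDatum hc hY.1 hD.1 hCY hφ hφD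
  refine ⟨h.isReflexive, h.isNefPartition, h.nonempty_dual hR hφD κ, fun r =>
    ⟨?_, h.exists_section hY.1 hD.1 hCY hφ hφD r⟩⟩
  have : r.model.X = ToricLG.fanVariety (ToricLG.normalFan (ToricLG.totalPolyhedron φ)) :=
    congrArg ToricLG.fanVariety (h.normalFan_dual hR hφD r)
  rw [this]
  exact h.sameToricVariety
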